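/- Let $\Bbbk$ be an algebraically closed field of characteristic $p>0$. Let $Y_2$ be the Yangian of $\mathfrak{gl}_2$ over $\Bbbk$: the associative $\Bbbk$-algebra with generators $t_{i,j}^{(r)}$ ($1\le i,j\le 2$, $r>0$) and relations $$[t_{i,j}^{(r)},t_{k,l}^{(s)}]=\sum_{a=0}^{\min(r,s)-1}\bigl(t_{k,j}^{(a)}t_{i,l}^{(r+s-1-a)}-t_{k,j}^{(r+s-1-a)}t_{i,l}^{(a)}\bigr)\qquad(1\le i,j,k,l\le 2,\ r,s>0),$$ where $t_{i,j}^{(0)}=\delta_{i,j}$. Put $t_{i,j}(u)=\sum_{r\ge0}t_{i,j}^{(r)}u^{-r}\in Y_2[[u^{-1}]]$ and define $d_1(u),d_2(u),e(u),f(u)\in Y_2[[u^{-1}]]$, with coefficients $d_i^{(r)},e^{(r)},f^{(r)}$ at $u^{-r}$, by the Gauss factorization $$\begin{pmatrix}t_{1,1}(u)&t_{1,2}(u)\\t_{2,1}(u)&t_{2,2}(u)\end{pmatrix}=\begin{pmatrix}1&0\\f(u)&1\end{pmatrix}\begin{pmatrix}d_1(u)&0\\0&d_2(u)\end{pmatrix}\begin{pmatrix}1&e(u)\\0&1\end{pmatrix}.$$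 Write $b_i(u)=\sum_{r\ge0}b_i^{(r)}u^{-r}=d_i(u)d_i(u-1)\cdots d_i(u-p+1)$. The restricted Yangian $Y_2^{[p]}$ is the quotient of $Y_2$ by the two-sided ideal generated by the elements $b_i^{(rp)}$, $(e^{(r)})^p$, $(f^{(r)})^p$ for $i=1,2$ and $r>0$. Let $\lambda_1(u),\lambda_2(u)\in 1+u^{-1}\Bbbk[[u^{-1}]]$ be restricted, i.e. $\lambda_i(u)\lambda_i(u-1)\cdots\lambda_i(u-p+1)=1$ for $i=1,2$, and write $\lambda_i^{(r)}$ for the coefficient of $u^{-r}$ in $\lambda_i(u)$. The baby Verma module $Z^{[p]}(\lambda_1(u),\lambda_2(u))$ is the quotient of $Y_2^{[p]}$ by the left ideal generated by the images of $e^{(r)}$ and $d_i^{(r)}-\lambda_i^{(r)}$ for $i=1,2$ and $r>0$. It has a unique maximal submodule, namely the sum of all its proper submodules, and $L^{[p]}(\lambda_1(u),\lambda_2(u))$ denotes the corresponding simple quotient. **Theorem.** The simple module $L^{[p]}(\lambda_1(u),\lambda_2(u))$ is finite-dimensional over $\Bbbk$ if and only if there exists a monic polynomial $P(u)\in\Bbbk[u]$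 such that $$\frac{\lambda_1(u)}{\lambda_2(u)}=\frac{P(u+1)}{P(u)}\quad\text{in }\Bbbk((u^{-1})).$$ -/

import Mathlib

noncomputable section

namespace RestrictedYangian

/-! ### Formal power series in `u⁻¹`

A series `∑ aᵣ u⁻ʳ` with coefficients in `A` is the element `∑ aᵣ Xʳ` of `PowerSeries A`,
so that the formal variable `X` of `PowerSeries` is `u⁻¹`. -/

/-- The expansion `(u - c)⁻¹ = u⁻¹ (1 - c u⁻¹)⁻¹ = ∑ₘ cᵐ u⁻ᵐ⁻¹` in powers of `u⁻¹`. -/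
def invSub {k : Type*} [Field k] (c : k) : PowerSeries k :=
  PowerSeries.X * PowerSeries.mk (fun m => c ^ m)

/-- The series `g(u - c) = ∑ᵣ gᵣ (u - c)⁻ʳ`, re-expanded in powers of `u⁻¹`. Since `(u - c)⁻ʳ` is
divisible by `u⁻ʳ`, only the terms with `r ≤ n` contribute to the coefficient of `u⁻ⁿ`. -/
def shift {k A : Type*} [Field k] [Ring A] [Algebra k A] (c : k) (g : PowerSeries A) :
    PowerSeries A :=
  PowerSeries.mk fun n =>
    ∑ r ∈ Finset.range (n + 1), PowerSeries.coeff n (invSub c ^ r) • PowerSeries.coeff r g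

/-- The product `g(u) g(u - 1) ⋯ g(u - p + 1)`, in this order. -/
def shiftProd (k : Type*) {A : Type*} [Field k] [Ring A] [Algebra k A] (p : ℕ)
    (g : PowerSeries A) : PowerSeries A :=
  ((List.range p).map fun j : ℕ => shift (j : k) g).prod

/-- A series `g(u) ∈ 1 + u⁻¹ k[[u⁻¹]]` is restricted if `g(u) g(u - 1) ⋯ g(u - p + 1) = 1`. -/
def IsRestricted {k : Type*} [Field k] (p : ℕ) (g : PowerSeries k) : Prop :=
  PowerSeries.constantCoeff g = 1 ∧ shiftProd k p g = 1

/-! ### The Yangian of `gl₂`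

The indices `1, 2` are the elements `0, 1` of `Fin 2`. -/

/-- The symbol `tᵢⱼ⁽ʳ⁾` in the free algebra: the free generator labelled `(i, j, r)` is
`tᵢⱼ⁽ʳ⁺¹⁾`, and `tᵢⱼ⁽⁰⁾ = δᵢⱼ`. -/
def tFree (k : Type*) [Field k] (i j : Fin 2) : ℕ → FreeAlgebra k (Fin 2 × Fin 2 × ℕ)
  | 0 => if i = j then 1 else 0
  | r + 1 => FreeAlgebra.ι k (i, j, r)

/-- The RTT relations
`[tᵢⱼ⁽ʳ⁾, tₖₗ⁽ˢ⁾] = ∑_{0 ≤ a < min(r,s)} (tₖⱼ⁽ᵃ⁾ tᵢₗ⁽ʳ⁺ˢ⁻¹⁻ᵃ⁾ - tₖⱼ⁽ʳ⁺ˢ⁻¹⁻ᵃ⁾ tᵢₗ⁽ᵃ⁾)`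
for `r, s > 0`. -/
inductive RTTRel (k : Type*) [Field k] :
    FreeAlgebra k (Fin 2 × Fin 2 × ℕ) → FreeAlgebra k (Fin 2 × Fin 2 × ℕ) → Prop
  | comm (i j m l : Fin 2) (r s : ℕ) (hr : 0 < r) (hs : 0 < s) :
      RTTRel k
        (tFree k i j r * tFree k m l s - tFree k m l s * tFree k i j r)
        (∑ a ∈ Finset.range (min r s),
          (tFree k m j a * tFree k i l (r + s - 1 - a)
            - tFree k m j (r + s - 1 - a) * tFree k i l a))

/-- The Yangian `Y₂` of `gl₂` over `k`. -/
def Y2 (k : Type*) [Field k] : Type _ := RingQuot (RTTRel k)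

instance (k : Type*) [Field k] : Ring (Y2 k) := inferInstanceAs (Ring (RingQuot (RTTRel k)))

instance (k : Type*) [Field k] : Algebra k (Y2 k) :=
  inferInstanceAs (Algebra k (RingQuot (RTTRel k)))

/-- The generating series `tᵢⱼ(u) = ∑ᵣ tᵢⱼ⁽ʳ⁾ u⁻ʳ` in `Y₂[[u⁻¹]]`. -/
def t (k : Type*) [Field k] (i j : Fin 2) : PowerSeries (Y2 k) :=
  PowerSeries.mk fun r => RingQuot.mkAlgHom k (RTTRel k) (tFree k i j r)

/-- The series `d₁(u)⁻¹`, where `d₁(u) = t₁₁(u)` has constant term `1`. -/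
def d1Inv (k : Type*) [Field k] : PowerSeries (Y2 k) :=
  PowerSeries.invOfUnit (t k 0 0) 1

/-- The series `e(u) = d₁(u)⁻¹ t₁₂(u)` of the Gauss factorization `T(u) = F(u) D(u) E(u)`. -/
def e (k : Type*) [Field k] : PowerSeries (Y2 k) := d1Inv k * t k 0 1

/-- The series `f(u) = t₂₁(u) d₁(u)⁻¹` of the Gauss factorization `T(u) = F(u) D(u) E(u)`. -/
def f (k : Type*) [Field k] : PowerSeries (Y2 k) := t k 1 0 * d1Inv k

/-- The diagonal series of the Gauss factorization `T(u) = F(u) D(u) E(u)`: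
`d₁(u) = t₁₁(u)` and `d₂(u) = t₂₂(u) - f(u) d₁(u) e(u)`. -/
def d (k : Type*) [Field k] : Fin 2 → PowerSeries (Y2 k) :=
  ![t k 0 0, t k 1 1 - f k * t k 0 0 * e k]

/-- The series `bᵢ(u) = dᵢ(u) dᵢ(u - 1) ⋯ dᵢ(u - p + 1)`. -/
def b (k : Type*) [Field k] (p : ℕ) (i : Fin 2) : PowerSeries (Y2 k) :=
  shiftProd k p (d k i)

/-- The generators `bᵢ⁽ʳᵖ⁾`, `(e⁽ʳ⁾)ᵖ`, `(f⁽ʳ⁾)ᵖ` (`i = 1, 2` and `r > 0`) of the `p`-center. -/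
inductive IsPCenterGen (k : Type*) [Field k] (p : ℕ) : Y2 k → Prop
  | b (i : Fin 2) (r : ℕ) (hr : 0 < r) : IsPCenterGen k p (PowerSeries.coeff (r * p) (b k p i))
  | e (r : ℕ) (hr : 0 < r) : IsPCenterGen k p (PowerSeries.coeff r (e k) ^ p)
  | f (r : ℕ) (hr : 0 < r) : IsPCenterGen k p (PowerSeries.coeff r (f k) ^ p)

/-- The restricted Yangian `Y₂^[p]`: the quotient of `Y₂` by the two-sided ideal generated by the
generators of the `p`-center. -/
def Y2p (k : Type*) [Field k] (p : ℕ) : Type _ :=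
  RingQuot fun x y : Y2 k => IsPCenterGen k p x ∧ y = 0

instance (k : Type*) [Field k] (p : ℕ) : Ring (Y2p k p) :=
  inferInstanceAs (Ring (RingQuot fun x y : Y2 k => IsPCenterGen k p x ∧ y = 0))

instance (k : Type*) [Field k] (p : ℕ) : Algebra k (Y2p k p) :=
  inferInstanceAs (Algebra k (RingQuot fun x y : Y2 k => IsPCenterGen k p x ∧ y = 0))

/-- The projection `Y₂ → Y₂^[p]`. -/
def proj (k : Type*) [Field k] (p : ℕ) : Y2 k →ₐ[k] Y2p k p :=
  RingQuot.mkAlgHom k fun x y : Y2 k => IsPCenterGen k p x ∧ y = 0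

/-! ### Baby Verma modules and their simple heads -/

/-- The left ideal of `Y₂^[p]` generated by all `e⁽ʳ⁾` and `dᵢ⁽ʳ⁾ - λᵢ⁽ʳ⁾` with `r > 0`. -/
def babyVermaIdeal {k : Type*} [Field k] (p : ℕ) (lam : Fin 2 → PowerSeries k) :
    Submodule (Y2p k p) (Y2p k p) :=
  Submodule.span (Y2p k p)
    ({x | ∃ r : ℕ, 0 < r ∧ x = proj k p (PowerSeries.coeff r (e k))} ∪
      {x | ∃ (i : Fin 2) (r : ℕ), 0 < r ∧
        x = proj k p (PowerSeries.coeff r (d k i))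
          - algebraMap k (Y2p k p) (PowerSeries.coeff r (lam i))})

/-- The baby Verma module `Z^[p](λ(u))`. -/
abbrev BabyVerma {k : Type*} [Field k] (p : ℕ) (lam : Fin 2 → PowerSeries k) : Type _ :=
  Y2p k p ⧸ babyVermaIdeal p lam

/-- The maximal proper submodule of `Z^[p](λ(u))`. When there is exactly one maximal submodule,
as for restricted `λ(u)`, it is the sum of all proper submodules (`Z^[p](λ(u))` is cyclic). -/
def maxSubmodule {k : Type*} [Field k] (p : ℕ) (lam : Fin 2 → PowerSeries k) :
    Submodule (Y2p k p) (BabyVerma p lam) :=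
  sSup {N | N ≠ ⊤}

/-- The simple module `L^[p](λ(u))`, the quotient of `Z^[p](λ(u))` by its maximal submodule. -/
abbrev L {k : Type*} [Field k] (p : ℕ) (lam : Fin 2 → PowerSeries k) : Type _ :=
  BabyVerma p lam ⧸ maxSubmodule p lam

/-! ### The field `k((u⁻¹))` -/

/-- The element `u` of `k((u⁻¹))`, the inverse of the formal variable. -/
def u (k : Type*) [Field k] : LaurentSeries k := HahnSeries.single (-1) 1

end RestrictedYangian

end

noncomputable section
namespace RestrictedYangian

/-! ### Exchange relations of the Gauss factors, as identities in a ring -/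

section Gauss

variable {K B : Type*} [CommRing K] [Ring B] [Algebra K B] {w q : K}

/-! Let v be the highest weight vector of L, let h(u) = d₁(u)⁻¹d₂(u), and call λᵢ the weight of dᵢ.

Finite dimension forces a rational ratio. If L is finite-dimensional, some nontrivial combination ∑
q_r f⁽ʳ⁺¹⁾v vanishes. Applying e⁽ˢ⁺¹⁾, which kills v, and using [e⁽ʳ⁺¹⁾, f⁽ˢ⁺¹⁾] = -h⁽ʳ⁺ˢ⁺¹⁾ gives a
linear recurrence for the coefficients of λ₂/λ₁, which is therefore rational
(`IsYangian.exists_rational`). Restrictedness makes its product over the p shifts equal to 1. The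
shift u ↦ u - 1 has order p on k[u], so Hilbert 90 (`exists_mul_map_eq_mul`) writes the ratio as
P(u+1)/P(u) (`exists_monic_of_rational`).

This needs v ≠ 0, which is proved without a PBW theorem. A truncation of λ to a polynomial in u⁻¹ is
the weight of a vector in a tensor product of evaluation Verma modules of gl₂, with a functional ε
that is nonzero on that vector and kills the image of t₂₁(u). The elements (e⁽ʳ⁾)ᵖ and the
coefficients of bᵢ(u) commute with all f⁽ˢ⁾, so those that kill the vector kill all it generates;
the (f⁽ʳ⁾)ᵖ only reach a submodule inside ker ε. Hence 1 avoids the defining left ideal at each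
truncation (`one_notMem_truncIdeal`), and so in the limit (`one_notMem_babyVermaIdeal`). The head is
nonzero because the f⁽ʳ⁾ generate an algebra whose augmentation ideal consists of nilpotents, so
proper submodules lie in (augmentation)·v and two of them cannot add up to everything
(`maxSubmodule_ne_top`).

Conversely, given P, a scalar series s(u) makes both sλ₁ and sλ₂ polynomials in u⁻¹ of degree at
most n = deg P. Replacing T by sT keeps e and f. Simplicity then forces all coefficients of sT
beyond n to act by zero on L (`IsYangian.truncated`), so every f⁽ʳ⁾ with r > n reduces to earlier
ones, and L is spanned by products of f⁽¹⁾, …, f⁽ⁿ⁾ applied to v. These span a nilpotent space V,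
since f's commute up to quadratic terms in intermediate f's and each (f⁽ʳ⁾)ᵖ is 0 (`initSpan_pow`);
so L is finite-dimensional (`IsYangian.finite_of_truncated`). -/

theorem commute_of_self_exchange (h : ∀ z : B, (w - q) • z = 0 → z = 0) {s t : B}
    (hst : w • (s * t - t * s) = q • (s * t - t * s)) : s * t = t * s := by
  refine sub_eq_zero.1 (h _ ?_)
  rw [sub_smul, hst, sub_self]

variable {au av au' av' bu bv cu cv du dv eu ev fu fv gu gv : B}

/-- In this section `w` and `q` play the roles of u - v and 1, up to a common factor; the suffix of
a letter is its variable; a, b, c, d are the entries of T and g is d₂. Here b = ae is substituted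
into the exchange relation of a and b, and a(v) is cancelled on the left. -/
theorem gauss_ae (haa : au * av = av * au) (hav : av' * av = 1)
    (hbu : bu = au * eu) (hbv : bv = av * ev)
    (hab : w • (au * bv - bv * au) = q • (au * bv - av * bu)) :
    w • (au * ev - ev * au) = q • (au * (ev - eu)) := by
  have key : av * (w • (au * ev - ev * au) - q • (au * (ev - eu))) = 0 := by
    subst hbu hbv
    have h1 : ∀ z, av * (au * z) = au * (av * z) := fun z => by
      rw [← mul_assoc, ← haa, mul_assoc]
    simp only [mul_sub, mul_smul_comm, mul_assoc, h1] at hab ⊢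
    linear_combination (norm := module) hab
  have := congrArg (av' * ·) key
  simpa [← mul_assoc, hav, sub_eq_zero] using this

theorem gauss_af (haa : au * av = av * au) (hav : av * av' = 1)
    (hcu : cu = fu * au) (hcv : cv = fv * av)
    (hac : w • (au * cv - cv * au) = q • (cu * av - cv * au)) :
    w • (au * fv - fv * au) = q • ((fu - fv) * au) := by
  have key : (w • (au * fv - fv * au) - q • ((fu - fv) * au)) * av = 0 := by
    subst hcu hcv
    simp only [sub_mul, smul_mul_assoc, mul_assoc, haa] at hac ⊢
    linear_combination (norm := module) hac
  have := congrArg (· * av') key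
  simpa [mul_assoc, hav, sub_eq_zero] using this

/-- This is the commutation of t₁₂(u) with t₁₂(v), after both factors a are moved to the left by the
a–e relation in either order of the variables. -/
theorem gauss_ee (haa : au * av = av * au) (hau : au' * au = 1) (hav : av' * av = 1)
    (hbb : au * eu * (av * ev) = av * ev * (au * eu))
    (haeuv : w • (au * ev - ev * au) = q • (au * (ev - eu)))
    (haevu : (-w) • (av * eu - eu * av) = q • (av * (eu - ev))) :
    w • (eu * ev - ev * eu) = q • ((eu - ev) * (eu - ev)) := by
  have key : av * (au * (w • (eu * ev - ev * eu) - q • ((eu - ev) * (eu - ev)))) = 0 := by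
    have h1 : ∀ z, av * (au * z) = au * (av * z) := fun z => by
      rw [← mul_assoc, ← haa, mul_assoc]
    have h2 := congrArg (fun z => au * z * ev) haevu
    have h3 := congrArg (fun z => av * z * eu) haeuv
    simp only [mul_sub, sub_mul, mul_smul_comm, smul_mul_assoc, mul_assoc, h1] at hbb h2 h3 ⊢
    linear_combination (norm := module) w • hbb - h2 - h3
  have := congrArg (fun z => au' * (av' * z)) key
  simpa [← mul_assoc, hav, hau, sub_eq_zero] using this

/-- The relation of a and d, minus f(v) times that of a and b, minus that of a and c times e(v), has
right-hand side zero. -/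
theorem gauss_ad (h : ∀ z : B, w • z = 0 → z = 0) (haa : au * av = av * au)
    (hbv : bv = av * ev) (hcv : cv = fv * av)
    (hab : w • (au * bv - bv * au) = q • (au * bv - av * bu))
    (hac : w • (au * cv - cv * au) = q • (cu * av - cv * au))
    (had : w • (au * dv - dv * au) = q • (cu * bv - cv * bu)) :
    au * (dv - fv * av * ev) = (dv - fv * av * ev) * au := by
  refine sub_eq_zero.1 (h _ ?_)
  subst hbv hcv
  have h1 := congrArg (fun z => fv * z) hab
  have h2 := congrArg (fun z => z * ev) hac
  have h3 : ∀ z, av * (au * z) = au * (av * z) := fun z => by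
      rw [← mul_assoc, ← haa, mul_assoc]
  simp only [mul_sub, sub_mul, mul_smul_comm, smul_mul_assoc, mul_assoc, h3] at had h1 h2 ⊢
  linear_combination (norm := module) had - h1 - h2

/-- `[t₁₂(u), d₂(v)]`. -/
theorem gauss_bd (hbv : bv = av * ev) (hcv : cv = fv * av)
    (hbb : bu * bv = bv * bu)
    (hba : w • (bu * av - av * bu) = q • (bu * av - bv * au))
    (hbc : w • (bu * cv - cv * bu) = q • (du * av - dv * au))
    (hbd : w • (bu * dv - dv * bu) = q • (du * bv - dv * bu)) :
    w • (bu * (dv - fv * av * ev) - (dv - fv * av * ev) * bu)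
      = q • ((dv - fv * av * ev) * (au * ev - bu)) := by
  subst hbv hcv
  have h1 := congrArg (fun z => fv * z) hbb
  have h2 := congrArg (fun z => z * ev) hbc
  have h3 := congrArg (fun z => fv * z * ev) hba
  simp only [mul_sub, sub_mul, mul_smul_comm, smul_mul_assoc, mul_assoc] at h1 h2 h3 hbd ⊢
  linear_combination (norm := module) hbd - w • h1 + q • h1 - h2 + h3

theorem gauss_de (hau : au' * au = 1) (hag : au * gv = gv * au)
    (hbg : w • (au * eu * gv - gv * (au * eu)) = q • (gv * (au * ev - au * eu))) :
    w • (eu * gv - gv * eu) = q • (gv * (ev - eu)) := by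
  have key : au * (w • (eu * gv - gv * eu) - q • (gv * (ev - eu))) = 0 := by
    have h1 : ∀ z, gv * (au * z) = au * (gv * z) := fun z => by
      rw [← mul_assoc, ← hag, mul_assoc]
    simp only [mul_sub, mul_smul_comm, mul_assoc, h1] at hbg ⊢
    linear_combination (norm := module) hbg
  have := congrArg (au' * ·) key
  simpa [← mul_assoc, hau, sub_eq_zero] using this

/-- `[t₂₁(u), d₂(v)]`. -/
theorem gauss_cd (hbv : bv = av * ev) (hcv : cv = fv * av)
    (hcc : cu * cv = cv * cu)
    (hca : w • (cu * av - av * cu) = q • (au * cv - av * cu))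
    (hcb : w • (cu * bv - bv * cu) = q • (au * dv - av * du))
    (hcd : w • (cu * dv - dv * cu) = q • (cu * dv - cv * du)) :
    w • (cu * (dv - fv * av * ev) - (dv - fv * av * ev) * cu)
      = q • ((cu - fv * au) * (dv - fv * av * ev)) := by
  subst hbv hcv
  have h1 := congrArg (fun z => z * ev) hcc
  have h2 := congrArg (fun z => fv * z) hcb
  have h3 := congrArg (fun z => fv * z * ev) hca
  simp only [mul_sub, sub_mul, mul_smul_comm, smul_mul_assoc, mul_assoc] at h1 h2 h3 hcd ⊢
  linear_combination (norm := module) hcd - w • h1 + q • h1 - h2 + h3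

theorem gauss_df (hau : au * au' = 1) (hag : au * gv = gv * au)
    (hcg : w • (fu * au * gv - gv * (fu * au)) = q • ((fu * au - fv * au) * gv)) :
    w • (fu * gv - gv * fu) = q • ((fu - fv) * gv) := by
  have key : (w • (fu * gv - gv * fu) - q • ((fu - fv) * gv)) * au = 0 := by
    simp only [sub_mul, smul_mul_assoc, mul_assoc, hag] at hcg ⊢
    linear_combination (norm := module) hcg
  have := congrArg (· * au') key
  simpa [mul_assoc, hau, sub_eq_zero] using this

/-- The relations combine to zero only after multiplication by w(w - q), hence the two cancellation
hypotheses. -/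
theorem gauss_dd (h : ∀ z : B, w • z = 0 → z = 0) (h' : ∀ z : B, (w - q) • z = 0 → z = 0)
    (hbv : bv = av * ev) (hcv : cv = fv * av) (hcu : cu = fu * au) (hdu : du = gu + fu * bu)
    (hgv : gv = dv - fv * av * ev)
    (hda : w • (du * av - av * du) = q • (bu * cv - bv * cu))
    (hdb : w • (du * bv - bv * du) = q • (bu * dv - bv * du))
    (hdc : w • (du * cv - cv * du) = q • (du * cv - dv * cu))
    (hdd : w • (du * dv - dv * du) = q • (du * dv - dv * du))
    (hbg : w • (bu * gv - gv * bu) = q • (gv * (au * ev - bu)))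
    (hfg : w • (fu * gv - gv * fu) = q • ((fu - fv) * gv)) :
    gu * gv = gv * gu := by
  have key : w • (du * gv - gv * du) = q • ((du - fv * bu) * gv - gv * (du - cu * ev)) := by
    subst hbv hcv hgv
    have h1 := congrArg (fun z => fv * z) hdb
    have h2 := congrArg (fun z => z * ev) hdc
    have h3 := congrArg (fun z => fv * z * ev) hda
    simp only [mul_sub, sub_mul, mul_smul_comm, smul_mul_assoc, mul_assoc] at h1 h2 h3 hdd ⊢
    linear_combination (norm := module) hdd - h1 - h2 + h3
  refine sub_eq_zero.1 (h _ (h' _ ?_))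
  rw [hdu, hcu] at key
  have h1 := congrArg (fun z => fu * z) hbg
  have h2 := congrArg (fun z => z * bu) hfg
  have h3 := congrArg (fun z => fv * z) hbg
  have h4 := congrArg (fun z => z * (au * ev)) hfg
  simp only [mul_sub, sub_mul, mul_add, add_mul, mul_smul_comm, smul_mul_assoc, mul_assoc]
    at key h1 h2 h3 h4 ⊢
  linear_combination (norm := module) w • key - w • h1 - w • h2 + q • h1 - q • h3 - q • h4 + q • h2

/-- The b–c relation with f(v)·(b–a relation) removed and a(v) cancelled gives [t₁₂(u), f(v)]; then
b = ae and the a–f relation allow a(u) to be cancelled on the left. -/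
theorem gauss_ef (hau : au' * au = 1) (hau' : au * au' = 1) (hav : av * av' = 1) (hav' : av' * av = 1)
    (haa : au * av = av * au) (hag : au * gv = gv * au)
    (hbu : bu = au * eu) (hcv : cv = fv * av) (hdu : du = gu + fu * bu)
    (hgv : gv = dv - fv * av * ev) (hbv : bv = av * ev)
    (hba : w • (bu * av - av * bu) = q • (bu * av - bv * au))
    (hbc : w • (bu * cv - cv * bu) = q • (du * av - dv * au))
    (haf : w • (au * fv - fv * au) = q • ((fu - fv) * au)) :
    w • (eu * fv - fv * eu) = q • (au' * gu - gv * av') := by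
  have key : (w • (bu * fv - fv * bu) - q • (du - fv * bu)) * av = - q • (gv * au) := by
    subst hcv hbv hgv
    have h1 := congrArg (fun z => fv * z) hba
    simp only [mul_sub, sub_mul, mul_smul_comm, smul_mul_assoc, mul_assoc] at h1 hbc ⊢
    linear_combination (norm := module) hbc - h1
  have haav : au * av' = av' * au := by
    calc au * av' = av' * (av * au) * av' := by rw [← mul_assoc av', hav', one_mul]
      _ = av' * au := by rw [← haa, mul_assoc, mul_assoc, hav, mul_one]
  have key2 := congrArg (· * av') key
  simp only [mul_assoc, hav, mul_one, smul_mul_assoc, haav] at key2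
  have key3 : au * (w • (eu * fv - fv * eu)) = au * (q • (au' * gu - gv * av')) := by
    have h1 := congrArg (fun z => z * eu) haf
    have h2 : au * (gv * av') = gv * (av' * au) := by
      rw [← mul_assoc, hag, mul_assoc, haav]
    have h3 : au * (au' * gu) = gu := by
      rw [← mul_assoc, hau', one_mul]
    subst hbu hdu
    simp only [mul_sub, sub_mul, mul_smul_comm, smul_mul_assoc, mul_assoc, h2, h3] at h1 key2 ⊢
    linear_combination (norm := module) key2 - h1
  have := congrArg (au' * ·) key3
  simpa only [← mul_assoc, hau, one_mul] using this

end Gauss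
end RestrictedYangian

end

noncomputable section
namespace RestrictedYangian
open PowerSeries

/-! ### Series in two variables, with u - v cleared of denominators -/

section TwoVariables

variable {A : Type*} [Ring A]

/-- A series in `u⁻¹`, as a series in `u⁻¹` (inner variable) and `v⁻¹` (outer variable). -/
def inU : A⟦X⟧ →+* A⟦X⟧⟦X⟧ := PowerSeries.C

/-- A series in `v⁻¹`, as a series in `u⁻¹` and `v⁻¹`. -/
def inV : A⟦X⟧ →+* A⟦X⟧⟦X⟧ := PowerSeries.map PowerSeries.C

theorem commute_C_X (F : A⟦X⟧⟦X⟧) : Commute (PowerSeries.C (PowerSeries.X : A⟦X⟧)) F := by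
  ext n : 1
  rw [coeff_C_mul, coeff_mul_C]
  exact (PowerSeries.commute_X _).symm

/-- The central element `u⁻¹`. -/
def cX (A : Type*) [Ring A] : Subring.center A⟦X⟧⟦X⟧ :=
  ⟨PowerSeries.C PowerSeries.X, Subring.mem_center_iff.2 fun F => ((commute_C_X F).symm).eq⟩

/-- The central element `v⁻¹`. -/
def cY (A : Type*) [Ring A] : Subring.center A⟦X⟧⟦X⟧ :=
  ⟨PowerSeries.X, Subring.mem_center_iff.2 fun F => (PowerSeries.commute_X F).eq⟩

/-- The factor `u - v`, multiplied by `u⁻¹v⁻¹`. -/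
def wt (A : Type*) [Ring A] : Subring.center A⟦X⟧⟦X⟧ := cY A - cX A

/-- The central element `u⁻¹v⁻¹`. -/
def qt (A : Type*) [Ring A] : Subring.center A⟦X⟧⟦X⟧ := cX A * cY A

/-- The coefficient of `u⁻ʳ v⁻ˢ`. -/
def coeff2 (r s : ℕ) (F : A⟦X⟧⟦X⟧) : A := coeff r (coeff s F)

theorem ext2 {F G : A⟦X⟧⟦X⟧} (h : ∀ r s, coeff2 r s F = coeff2 r s G) : F = G := by
  ext s r
  exact h r s

@[simp] theorem coeff2_zero (r s : ℕ) : coeff2 r s (0 : A⟦X⟧⟦X⟧) = 0 := by simp [coeff2]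

@[simp] theorem coeff2_sub (r s : ℕ) (F G : A⟦X⟧⟦X⟧) :
    coeff2 r s (F - G) = coeff2 r s F - coeff2 r s G := by simp [coeff2]

@[simp] theorem coeff2_inU_mul_inV (r s : ℕ) (g h : A⟦X⟧) :
    coeff2 r s (inU g * inV h) = coeff r g * coeff s h := by
  simp [coeff2, inU, inV, coeff_C_mul, coeff_mul_C]

@[simp] theorem coeff2_inV_mul_inU (r s : ℕ) (g h : A⟦X⟧) :
    coeff2 r s (inV h * inU g) = coeff s h * coeff r g := by
  simp [coeff2, inU, inV, coeff_C_mul, coeff_mul_C]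

theorem cX_smul (F : A⟦X⟧⟦X⟧) : cX A • F = PowerSeries.C PowerSeries.X * F := rfl
theorem cY_smul (F : A⟦X⟧⟦X⟧) : cY A • F = PowerSeries.X * F := rfl

@[simp] theorem coeff2_cX_zero (s : ℕ) (F : A⟦X⟧⟦X⟧) : coeff2 0 s (cX A • F) = 0 := by
  simp [cX_smul, coeff2, coeff_C_mul]
@[simp] theorem coeff2_cX_succ (r s : ℕ) (F : A⟦X⟧⟦X⟧) :
    coeff2 (r + 1) s (cX A • F) = coeff2 r s F := by
  simp [cX_smul, coeff2, coeff_C_mul, coeff_succ_X_mul]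
@[simp] theorem coeff2_cY_zero (r : ℕ) (F : A⟦X⟧⟦X⟧) : coeff2 r 0 (cY A • F) = 0 := by
  simp [cY_smul, coeff2]
@[simp] theorem coeff2_cY_succ (r s : ℕ) (F : A⟦X⟧⟦X⟧) :
    coeff2 r (s + 1) (cY A • F) = coeff2 r s F := by
  simp [cY_smul, coeff2, coeff_succ_X_mul]

theorem wt_smul (F : A⟦X⟧⟦X⟧) : wt A • F = cY A • F - cX A • F := sub_smul _ _ _
theorem qt_smul (F : A⟦X⟧⟦X⟧) : qt A • F = cX A • cY A • F := mul_smul _ _ _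

/-- The coefficient of (v⁻¹ - u⁻¹)F at u⁻ʳv⁻ˢ⁻¹ is F_{r,s} - F_{r-1,s+1}, so vanishing propagates
upwards in r. -/
theorem wt_cancel (F : A⟦X⟧⟦X⟧) (h : wt A • F = 0) : F = 0 := by
  have key : ∀ r s, coeff2 r s F = 0 := by
    intro r
    induction r with
    | zero =>
      intro s
      have := congrArg (coeff2 0 (s + 1)) h
      rw [wt_smul] at this
      simpa using this
    | succ r ih =>
      intro s
      have := congrArg (coeff2 (r + 1) (s + 1)) h
      rw [wt_smul] at this
      simpa [ih] using this
  exact ext2 fun r s => by rw [key, coeff2_zero]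

theorem wt_sub_qt_cancel (F : A⟦X⟧⟦X⟧) (h : (wt A - qt A) • F = 0) : F = 0 := by
  have key : ∀ r s, coeff2 r s F = 0 := by
    intro r
    induction r with
    | zero =>
      intro s
      have := congrArg (coeff2 0 (s + 1)) h
      rw [sub_smul, wt_smul, qt_smul] at this
      simpa using this
    | succ r ih =>
      intro s
      have := congrArg (coeff2 (r + 1) (s + 1)) h
      rw [sub_smul, wt_smul, qt_smul] at this
      simpa [ih] using this
  exact ext2 fun r s => by rw [key, coeff2_zero]

/-- Coefficientwise form of an identity `(u - v) F = G`. -/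
theorem wt_smul_eq_qt_smul_iff (F G : A⟦X⟧⟦X⟧) :
    wt A • F = qt A • G ↔ (∀ r s, coeff2 (r + 1) s F - coeff2 r (s + 1) F = coeff2 r s G) ∧
      (∀ s, coeff2 0 s F = 0) ∧ ∀ r, coeff2 r 0 F = 0 := by
  constructor
  · intro h
    refine ⟨fun r s => ?_, fun s => ?_, fun r => ?_⟩
    · have := congrArg (coeff2 (r + 1) (s + 1)) h
      rw [wt_smul, qt_smul] at this
      simpa using this
    · have := congrArg (coeff2 0 (s + 1)) h
      rw [wt_smul, qt_smul] at this
      simpa using this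
    · have := congrArg (coeff2 (r + 1) 0) h
      rw [wt_smul, qt_smul] at this
      simpa using this
  · rintro ⟨h1, h2, h3⟩
    refine ext2 fun r s => ?_
    rw [wt_smul, qt_smul]
    rcases r with _ | r <;> rcases s with _ | s <;> simp [h1, h2, h3]

end TwoVariables

/-! ### RTT matrices and the relations between d₁, d₂, e, f -/

section Yangian

variable {A : Type*} [Ring A]

/-- A `2 × 2` matrix of series over `A` satisfying the RTT relations, in the form
`[tᵢⱼ⁽ʳ⁺¹⁾, tₘₗ⁽ˢ⁾] - [tᵢⱼ⁽ʳ⁾, tₘₗ⁽ˢ⁺¹⁾] = tₘⱼ⁽ʳ⁾ tᵢₗ⁽ˢ⁾ - tₘⱼ⁽ˢ⁾ tᵢₗ⁽ʳ⁾`. -/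
structure IsYangian (T : Fin 2 → Fin 2 → A⟦X⟧) : Prop where
  const : ∀ i j, coeff 0 (T i j) = if i = j then 1 else 0
  rel : ∀ i j m l r s,
    (coeff (r + 1) (T i j) * coeff s (T m l) - coeff s (T m l) * coeff (r + 1) (T i j))
      - (coeff r (T i j) * coeff (s + 1) (T m l) - coeff (s + 1) (T m l) * coeff r (T i j))
      = coeff r (T m j) * coeff s (T i l) - coeff s (T m j) * coeff r (T i l)

variable {T : Fin 2 → Fin 2 → A⟦X⟧}

theorem isYangian_of_rtt (hc : ∀ i j, coeff 0 (T i j) = if i = j then 1 else 0)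
    (h : ∀ i j m l, wt A • (inU (T i j) * inV (T m l) - inV (T m l) * inU (T i j))
      = qt A • (inU (T m j) * inV (T i l) - inV (T m j) * inU (T i l))) : IsYangian T where
  const := hc
  rel i j m l r s := by
    simpa using ((wt_smul_eq_qt_smul_iff _ _).1 (h i j m l)).1 r s

namespace IsYangian
variable (hT : IsYangian T)
include hT

theorem rtt (i j m l : Fin 2) :
    wt A • (inU (T i j) * inV (T m l) - inV (T m l) * inU (T i j))
      = qt A • (inU (T m j) * inV (T i l) - inV (T m j) * inU (T i l)) := by
  refine (wt_smul_eq_qt_smul_iff _ _).2 ⟨fun r s => ?_, fun s => ?_, fun r => ?_⟩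
  · simpa using hT.rel i j m l r s
  · simp only [coeff2_sub, coeff2_inU_mul_inV, coeff2_inV_mul_inU, hT.const]
    split_ifs <;> simp
  · simp only [coeff2_sub, coeff2_inU_mul_inV, coeff2_inV_mul_inU, hT.const]
    split_ifs <;> simp

/-- The same relation with u and v interchanged; the Gauss identities need both orders. -/
theorem rtt_swap (i j m l : Fin 2) :
    (-wt A) • (inV (T i j) * inU (T m l) - inU (T m l) * inV (T i j))
      = qt A • (inV (T m j) * inU (T i l) - inU (T m j) * inV (T i l)) := by
  rw [neg_smul, ← smul_neg]
  refine (wt_smul_eq_qt_smul_iff _ _).2 ⟨fun r s => ?_, fun s => ?_, fun r => ?_⟩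
  · have := hT.rel i j m l s r
    simp only [neg_sub, coeff2_sub, coeff2_inU_mul_inV, coeff2_inV_mul_inU]
    rw [← this]
    abel
  · simp only [neg_sub, coeff2_sub, coeff2_inU_mul_inV, coeff2_inV_mul_inU, hT.const]
    split_ifs <;> simp
  · simp only [neg_sub, coeff2_sub, coeff2_inU_mul_inV, coeff2_inV_mul_inU, hT.const]
    split_ifs <;> simp

end IsYangian

/-- The series `d₁(u)⁻¹`. -/
def d1InvOf (T : Fin 2 → Fin 2 → A⟦X⟧) : A⟦X⟧ := PowerSeries.invOfUnit (T 0 0) 1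
/-- The series `e(u)` of the Gauss factorization of `T`. -/
def eOf (T : Fin 2 → Fin 2 → A⟦X⟧) : A⟦X⟧ := d1InvOf T * T 0 1
/-- The series `f(u)` of the Gauss factorization of `T`. -/
def fOf (T : Fin 2 → Fin 2 → A⟦X⟧) : A⟦X⟧ := T 1 0 * d1InvOf T
/-- The series `d₂(u)` of the Gauss factorization of `T`. -/
def d2Of (T : Fin 2 → Fin 2 → A⟦X⟧) : A⟦X⟧ := T 1 1 - fOf T * T 0 0 * eOf T
/-- The series `d₁(u)⁻¹ d₂(u)`. -/
def hOf (T : Fin 2 → Fin 2 → A⟦X⟧) : A⟦X⟧ := d1InvOf T * d2Of T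

namespace IsYangian
variable (hT : IsYangian T)
include hT

theorem d1_mul_inv : T 0 0 * d1InvOf T = 1 :=
  mul_invOfUnit _ _ (by rw [← coeff_zero_eq_constantCoeff_apply, hT.const]; rfl)
theorem inv_mul_d1 : d1InvOf T * T 0 0 = 1 :=
  invOfUnit_mul _ _ (by rw [← coeff_zero_eq_constantCoeff_apply, hT.const]; rfl)
theorem t12_eq : T 0 1 = T 0 0 * eOf T := by
  rw [eOf, ← mul_assoc, hT.d1_mul_inv, one_mul]
theorem t21_eq : T 1 0 = fOf T * T 0 0 := by
  rw [fOf, mul_assoc, hT.inv_mul_d1, mul_one]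
theorem t22_eq : T 1 1 = d2Of T + fOf T * T 0 1 := by
  rw [d2Of, hT.t12_eq]; noncomm_ring

theorem self_comm (i j : Fin 2) : inU (T i j) * inV (T i j) = inV (T i j) * inU (T i j) :=
  commute_of_self_exchange wt_sub_qt_cancel (hT.rtt i j i j)

theorem d1_d2 : inU (T 0 0) * inV (d2Of T) = inV (d2Of T) * inU (T 0 0) := by
  have := gauss_ad wt_cancel (hT.self_comm 0 0) (ev := inV (eOf T)) (fv := inV (fOf T))
    (by rw [← map_mul, hT.t12_eq]) (by rw [← map_mul, hT.t21_eq])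
    (hT.rtt 0 0 0 1) (hT.rtt 0 0 1 0) (hT.rtt 0 0 1 1)
  simpa only [d2Of, map_sub, map_mul] using this

theorem d1_e : wt A • (inU (T 0 0) * inV (eOf T) - inV (eOf T) * inU (T 0 0))
    = qt A • (inU (T 0 0) * (inV (eOf T) - inU (eOf T))) :=
  gauss_ae (hT.self_comm 0 0) (by rw [← map_mul, hT.inv_mul_d1, map_one])
    (by rw [← map_mul, hT.t12_eq]) (by rw [← map_mul, hT.t12_eq]) (hT.rtt 0 0 0 1)

theorem d1_e_swap : (-wt A) • (inV (T 0 0) * inU (eOf T) - inU (eOf T) * inV (T 0 0))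
    = qt A • (inV (T 0 0) * (inU (eOf T) - inV (eOf T))) :=
  gauss_ae (hT.self_comm 0 0).symm (by rw [← map_mul, hT.inv_mul_d1, map_one])
    (by rw [← map_mul, hT.t12_eq]) (by rw [← map_mul, hT.t12_eq]) (hT.rtt_swap 0 0 0 1)

theorem d1_f : wt A • (inU (T 0 0) * inV (fOf T) - inV (fOf T) * inU (T 0 0))
    = qt A • ((inU (fOf T) - inV (fOf T)) * inU (T 0 0)) :=
  gauss_af (hT.self_comm 0 0) (by rw [← map_mul, hT.d1_mul_inv, map_one])
    (by rw [← map_mul, hT.t21_eq]) (by rw [← map_mul, hT.t21_eq]) (hT.rtt 0 0 1 0)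

theorem e_e : wt A • (inU (eOf T) * inV (eOf T) - inV (eOf T) * inU (eOf T))
    = qt A • ((inU (eOf T) - inV (eOf T)) * (inU (eOf T) - inV (eOf T))) :=
  gauss_ee (hT.self_comm 0 0) (by rw [← map_mul, hT.inv_mul_d1, map_one])
    (by rw [← map_mul, hT.inv_mul_d1, map_one])
    (by rw [← map_mul, ← map_mul, ← hT.t12_eq, hT.self_comm]) hT.d1_e hT.d1_e_swap

theorem t12_d2_swap :
    (-wt A) • (inV (T 0 1) * inU (d2Of T) - inU (d2Of T) * inV (T 0 1))
      = qt A • (inU (d2Of T) * (inV (T 0 0) * inU (eOf T) - inV (T 0 1))) := by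
  have := gauss_bd (w := -wt A) (ev := inU (eOf T)) (fv := inU (fOf T))
    (by rw [← map_mul, hT.t12_eq]) (by rw [← map_mul, hT.t21_eq])
    (hT.self_comm 0 1).symm (hT.rtt_swap 0 1 0 0) (hT.rtt_swap 0 1 1 0) (hT.rtt_swap 0 1 1 1)
  simpa only [d2Of, map_sub, map_mul] using this

theorem t12_d2 :
    wt A • (inU (T 0 1) * inV (d2Of T) - inV (d2Of T) * inU (T 0 1))
      = qt A • (inV (d2Of T) * (inU (T 0 0) * inV (eOf T) - inU (T 0 1))) := by
  have := gauss_bd (w := wt A) (ev := inV (eOf T)) (fv := inV (fOf T))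
    (by rw [← map_mul, hT.t12_eq]) (by rw [← map_mul, hT.t21_eq])
    (hT.self_comm 0 1) (hT.rtt 0 1 0 0) (hT.rtt 0 1 1 0) (hT.rtt 0 1 1 1)
  simpa only [d2Of, map_sub, map_mul] using this

theorem coeff_d1_d2 (r s : ℕ) : Commute (coeff r (T 0 0)) (coeff s (d2Of T)) := by
  simpa [commute_iff_eq] using congrArg (coeff2 r s) hT.d1_d2

theorem d2_e : (-wt A) • (inV (eOf T) * inU (d2Of T) - inU (d2Of T) * inV (eOf T))
    = qt A • (inU (d2Of T) * (inU (eOf T) - inV (eOf T))) := by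
  refine gauss_de (au := inV (T 0 0)) (au' := inV (d1InvOf T))
    (by rw [← map_mul, hT.inv_mul_d1, map_one]) ?_ ?_
  · exact ext2 fun r s => by simpa using (hT.coeff_d1_d2 s r).eq
  · rw [← map_mul, ← hT.t12_eq]
    exact hT.t12_d2_swap

theorem d2_f : wt A • (inU (fOf T) * inV (d2Of T) - inV (d2Of T) * inU (fOf T))
    = qt A • ((inU (fOf T) - inV (fOf T)) * inV (d2Of T)) := by
  refine gauss_df (au := inU (T 0 0)) (au' := inU (d1InvOf T))
    (by rw [← map_mul, hT.d1_mul_inv, map_one]) hT.d1_d2 ?_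
  have := gauss_cd (w := wt A) (ev := inV (eOf T)) (fv := inV (fOf T))
    (by rw [← map_mul, hT.t12_eq]) (by rw [← map_mul, hT.t21_eq])
    (hT.self_comm 1 0) (hT.rtt 1 0 0 0) (hT.rtt 1 0 0 1) (hT.rtt 1 0 1 1)
  rw [← map_mul, ← hT.t21_eq]
  simpa only [d2Of, map_sub, map_mul] using this

theorem d2_d2 : inU (d2Of T) * inV (d2Of T) = inV (d2Of T) * inU (d2Of T) :=
  gauss_dd wt_cancel wt_sub_qt_cancel (ev := inV (eOf T)) (fv := inV (fOf T))
    (by rw [← map_mul, hT.t12_eq]) (by rw [← map_mul, hT.t21_eq])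
    (by rw [← map_mul, hT.t21_eq])
    (by rw [← map_mul, ← map_add, hT.t22_eq]) (by simp only [d2Of, map_sub, map_mul])
    (hT.rtt 1 1 0 0) (hT.rtt 1 1 0 1) (hT.rtt 1 1 1 0) (hT.rtt 1 1 1 1)
    hT.t12_d2 hT.d2_f

theorem coeff_d2_d2 (r s : ℕ) : Commute (coeff r (d2Of T)) (coeff s (d2Of T)) := by
  simpa [commute_iff_eq] using congrArg (coeff2 r s) hT.d2_d2

theorem e_f : wt A • (inU (eOf T) * inV (fOf T) - inV (fOf T) * inU (eOf T))
    = qt A • (inU (d1InvOf T) * inU (d2Of T) - inV (d2Of T) * inV (d1InvOf T)) :=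
  gauss_ef (au := inU (T 0 0)) (av := inV (T 0 0)) (ev := inV (eOf T))
    (by rw [← map_mul, hT.inv_mul_d1, map_one])
    (by rw [← map_mul, hT.d1_mul_inv, map_one])
    (by rw [← map_mul, hT.d1_mul_inv, map_one])
    (by rw [← map_mul, hT.inv_mul_d1, map_one]) (hT.self_comm 0 0) hT.d1_d2
    (by rw [← map_mul, hT.t12_eq]) (by rw [← map_mul, hT.t21_eq])
    (by rw [← map_mul, ← map_add, hT.t22_eq]) (by simp only [d2Of, map_sub, map_mul])
    (by rw [← map_mul, hT.t12_eq])
    (hT.rtt 0 1 0 0) (hT.rtt 0 1 1 0) hT.d1_f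

end IsYangian
end Yangian
end RestrictedYangian

end

noncomputable section
namespace RestrictedYangian
open PowerSeries

/-! ### The substitution v = u - c and the shift g(u) ↦ g(u - c) -/

section Shift

variable {k A : Type*} [Field k] [Ring A] [Algebra k A]

/-- A scalar series, viewed in `A[[u⁻¹]]`. -/
def sc (A : Type*) [Ring A] [Algebra k A] : k⟦X⟧ →+* A⟦X⟧ := PowerSeries.map (algebraMap k A)

theorem sc_comm (s : k⟦X⟧) (g : A⟦X⟧) : sc A s * g = g * sc A s := by
  ext n
  rw [coeff_mul, coeff_mul, ← Finset.Nat.sum_antidiagonal_swap]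
  refine Finset.sum_congr rfl fun x _ => ?_
  simp [sc, Algebra.commutes]

theorem coeff_sc (n : ℕ) (s : k⟦X⟧) : coeff n (sc A s) = algebraMap k A (coeff n s) := by
  simp [sc]

theorem sc_X : sc A (X : k⟦X⟧) = X := by simp [sc]

theorem X_mul_cancel {g h : A⟦X⟧} (H : (X : A⟦X⟧) * g = X * h) : g = h := by
  ext n
  simpa [coeff_succ_X_mul] using congrArg (coeff (n + 1)) H

theorem invSub_mul (c : k) : invSub c * (1 - PowerSeries.C c * X) = X := by
  rw [invSub, mul_assoc, mul_sub, mul_one]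
  convert mul_one (X : k⟦X⟧) using 2
  ext n
  rw [mul_left_comm, coeff_one]
  rcases n with _ | n
  · simp
  · rw [map_sub, coeff_C_mul, coeff_succ_mul_X]
    simp [pow_succ']

theorem coeff_sc_invSub_pow_mul (c : k) {a i : ℕ} (h : a < i) (g : A⟦X⟧) :
    coeff a (sc A (invSub c) ^ i * g) = 0 := by
  refine X_pow_dvd_iff.1 ?_ a h
  rw [← map_pow, invSub, mul_pow, map_mul, map_pow, sc_X, mul_assoc]
  exact dvd_mul_right _ _

/-- A sequence of series with `Δₛ = (u - c)⁻¹ Δₛ₊₁` vanishes. -/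
theorem eq_zero_of_invSub_descent (c : k) (D : ℕ → A⟦X⟧)
    (h : ∀ s, D s = sc A (invSub c) * D (s + 1)) (s : ℕ) : D s = 0 := by
  have key : ∀ n s, D s = sc A (invSub c) ^ n * D (s + n) := by
    intro n
    induction n with
    | zero => simp
    | succ n ih =>
      intro s
      rw [ih s, h (s + n), ← mul_assoc, ← pow_succ, add_assoc]
  ext n
  rw [key (n + 1) s, coeff_sc_invSub_pow_mul c (Nat.lt_succ_self n), map_zero]

/-- The specialization `v = u - c`, as a map. -/
def specializeFun (c : k) (G : A⟦X⟧⟦X⟧) : A⟦X⟧ :=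
  PowerSeries.mk fun n =>
    ∑ r ∈ Finset.range (n + 1), coeff n (sc A (invSub c) ^ r * coeff r G)

theorem coeff_specializeFun (c : k) (G : A⟦X⟧⟦X⟧) {n N : ℕ} (h : n < N) :
    coeff n (specializeFun c G) =
      coeff n (∑ r ∈ Finset.range N, sc A (invSub c) ^ r * coeff r G) := by
  rw [specializeFun, coeff_mk, map_sum]
  refine Finset.sum_subset (Finset.range_subset_range.2 h) fun r _ hr => ?_
  exact coeff_sc_invSub_pow_mul c (by simpa using hr) _

/-- Since z = (u - c)⁻¹ has central coefficients, zⁱg·zʲh = zⁱ⁺ʲgh. Terms with i + j > n do not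
reach the coefficient of u⁻ⁿ, so the square of index pairs can be replaced by its diagonals. -/
theorem specializeFun_mul (c : k) (G H : A⟦X⟧⟦X⟧) :
    specializeFun c (G * H) = specializeFun c G * specializeFun c H := by
  ext n
  set z := sc A (invSub c) with hz
  have h1 : coeff n (specializeFun c G * specializeFun c H) =
      coeff n ((∑ r ∈ Finset.range (n + 1), z ^ r * coeff r G) *
        ∑ r ∈ Finset.range (n + 1), z ^ r * coeff r H) := by
    rw [coeff_mul, coeff_mul]
    refine Finset.sum_congr rfl fun x hx => ?_
    have := Finset.HasAntidiagonal.mem_antidiagonal.1 hx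
    rw [coeff_specializeFun c G (N := n + 1) (by omega),
      coeff_specializeFun c H (N := n + 1) (by omega)]
  have hcomm : ∀ i j (g h : A⟦X⟧), z ^ i * g * (z ^ j * h) = z ^ (i + j) * (g * h) := by
    intro i j g h
    have : g * z ^ j = z ^ j * g := by rw [hz, ← map_pow, sc_comm]
    rw [mul_assoc, ← mul_assoc g, this, pow_add, mul_assoc, mul_assoc]
  rw [h1, coeff_specializeFun c _ (Nat.lt_succ_self n), Finset.sum_mul_sum, map_sum,
    ← Finset.sum_product', map_sum]
  simp only [hcomm, coeff_mul (_ : ℕ) G, Finset.mul_sum, map_sum]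
  rw [Finset.sum_sigma']
  refine Finset.sum_bij_ne_zero (fun x _ _ => x.2) ?_ ?_ ?_ ?_
  · rintro ⟨m, i, j⟩ h _
    simp only [Finset.mem_sigma, Finset.mem_range, Finset.HasAntidiagonal.mem_antidiagonal,
      Finset.mem_product] at h ⊢
    omega
  · rintro ⟨m, i, j⟩ h _ ⟨m', i', j'⟩ h' _ e
    simp only [Finset.mem_sigma, Finset.mem_range, Finset.HasAntidiagonal.mem_antidiagonal] at h h'
    simp only [Prod.mk.injEq] at e
    obtain ⟨rfl, rfl⟩ := e
    obtain ⟨-, rfl⟩ := h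
    obtain ⟨-, rfl⟩ := h'
    rfl
  · rintro ⟨i, j⟩ h hne
    have hij : i + j < n + 1 := by
      by_contra hlt
      exact hne (coeff_sc_invSub_pow_mul c (by omega) _)
    refine ⟨⟨i + j, i, j⟩, ?_, ?_, rfl⟩
    · simp [hij]
    · exact hne
  · rintro ⟨m, i, j⟩ h _
    simp only [Finset.mem_sigma, Finset.mem_range, Finset.HasAntidiagonal.mem_antidiagonal] at h
    rw [h.2]

/-- The specialization `v = u - c`. -/
def specialize (c : k) : A⟦X⟧⟦X⟧ →+* A⟦X⟧ where
  toFun := specializeFun c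
  map_one' := by
    ext n
    rw [coeff_specializeFun c _ (Nat.lt_succ_self n), Finset.sum_range_succ']
    simp [coeff_one]
  map_mul' := specializeFun_mul c
  map_zero' := by ext n; simp [specializeFun]
  map_add' G H := by ext n; simp [specializeFun, mul_add, Finset.sum_add_distrib]

theorem coeff_specialize (c : k) (G : A⟦X⟧⟦X⟧) {n N : ℕ} (h : n < N) :
    coeff n (specialize c G) =
      coeff n (∑ r ∈ Finset.range N, sc A (invSub c) ^ r * coeff r G) :=
  coeff_specializeFun c G h

theorem specialize_inU (c : k) (g : A⟦X⟧) : specialize c (inU g) = g := by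
  ext n
  rw [coeff_specialize c _ (Nat.lt_succ_self n), Finset.sum_range_succ']
  simp [inU, coeff_C]

/-- The substitution `g(u) ↦ g(u - c)`. -/
def shiftHom (c : k) : A⟦X⟧ →+* A⟦X⟧ := (specialize c).comp inV

theorem coeff_shiftHom (c : k) (g : A⟦X⟧) {n N : ℕ} (h : n < N) :
    coeff n (shiftHom c g) =
      coeff n (∑ r ∈ Finset.range N, sc A (invSub c) ^ r * PowerSeries.C (coeff r g)) := by
  rw [shiftHom, RingHom.comp_apply, coeff_specialize c _ h]
  simp [inV]

theorem shift_eq_shiftHom (c : k) (g : A⟦X⟧) : shift c g = shiftHom c g := by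
  ext n
  rw [coeff_shiftHom c g (Nat.lt_succ_self n), shift, coeff_mk, map_sum]
  refine Finset.sum_congr rfl fun r _ => ?_
  rw [coeff_mul_C, ← map_pow, sc, coeff_map, Algebra.smul_def]

theorem specialize_inV (c : k) (g : A⟦X⟧) : specialize c (inV g) = shiftHom c g := rfl

theorem specialize_X (c : k) : specialize c (X : A⟦X⟧⟦X⟧) = sc A (invSub c) := by
  ext n
  rw [coeff_specialize c _ (show n < n + 2 by omega), Finset.sum_range_succ',
    Finset.sum_range_succ']
  simp [coeff_X]

theorem shiftHom_X (c : k) : shiftHom c (X : A⟦X⟧) = sc A (invSub c) := by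
  rw [← specialize_inV, ← specialize_X]; simp [inV]

theorem shiftHom_C (c : k) (a : A) : shiftHom c (PowerSeries.C a) = PowerSeries.C a := by
  ext n
  rw [coeff_shiftHom c _ (Nat.lt_succ_self n), Finset.sum_range_succ']
  simp [coeff_C]

theorem shiftHom_sc (c : k) (s : k⟦X⟧) : shiftHom c (sc A s) = sc A (shiftHom c s) := by
  have e0 : sc k (invSub c) = invSub c := by ext n; simp [sc]
  ext n
  rw [coeff_shiftHom c _ (Nat.lt_succ_self n), coeff_sc,
    coeff_shiftHom c _ (Nat.lt_succ_self n), map_sum, map_sum, map_sum]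
  refine Finset.sum_congr rfl fun r _ => ?_
  rw [coeff_mul_C, coeff_mul_C, map_mul, ← map_pow, coeff_sc, coeff_sc, e0]

theorem invSub_add (c d : k) : shiftHom c (invSub d) = invSub (c + d) := by
  have h1 := congrArg (shiftHom c) (invSub_mul d)
  simp only [map_mul, map_sub, map_one, shiftHom_C, shiftHom_X] at h1
  have h2 := invSub_mul c
  have h3 := invSub_mul (c + d)
  have hX : (X : k⟦X⟧) ≠ 0 := X_ne_zero
  have e0 : sc k (invSub c) = invSub c := by ext n; simp [sc]
  rw [e0] at h1
  have h4 : (1 - PowerSeries.C d * invSub c) * (1 - PowerSeries.C c * X) =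
      1 - PowerSeries.C (c + d) * X := by
    rw [map_add]; linear_combination (- PowerSeries.C d) * h2
  have h5 : (1 - PowerSeries.C (c + d) * (X : k⟦X⟧)) ≠ 0 := by
    intro h
    rw [h, mul_zero] at h3
    exact hX h3.symm
  refine mul_right_cancel₀ h5 ?_
  rw [h3, ← h4, ← mul_assoc, h1, h2]

/-- Modulo u⁻ᴺ the inner shift is a finite sum of powers of (u - d)⁻¹, on which the outer shift is
explicit; the remainder stays divisible by u⁻ᴺ under substitution. -/
theorem shiftHom_shiftHom (c d : k) (g : A⟦X⟧) :
    shiftHom c (shiftHom d g) = shiftHom (c + d) g := by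
  ext n
  set N := n + 1
  have h1 : X ^ N ∣ shiftHom d g -
      ∑ r ∈ Finset.range N, sc A (invSub d) ^ r * PowerSeries.C (coeff r g) := by
    refine X_pow_dvd_iff.2 fun m hm => ?_
    rw [map_sub, coeff_shiftHom d g hm, sub_self]
  obtain ⟨q, hq⟩ := h1
  rw [sub_eq_iff_eq_add] at hq
  rw [hq, map_add, map_mul, map_pow, shiftHom_X, map_add,
    coeff_sc_invSub_pow_mul c (Nat.lt_succ_self n), zero_add,
    coeff_shiftHom (c + d) g (Nat.lt_succ_self n), map_sum]
  simp only [map_mul, map_pow, shiftHom_sc, invSub_add, shiftHom_C]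
  rfl

theorem shiftHom_zero (g : A⟦X⟧) : shiftHom (0 : k) g = g := by
  ext n
  have h0 : invSub (0 : k) = X := by
    have := invSub_mul (0 : k)
    simpa using this
  rw [coeff_shiftHom _ g (Nat.lt_succ_self n), h0, sc_X, map_sum]
  simp only [coeff_mul_C, coeff_X_pow, ite_mul, one_mul, zero_mul]
  simp

end Shift
end RestrictedYangian

end

noncomputable section
namespace RestrictedYangian
open PowerSeries

/-! ### Tails of series: commutators with a single coefficient -/

section Tails

variable {A : Type*} [Ring A]

/-- The series `∑_{r > i} g⁽ʳ⁾ u^{i-r}`. -/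
def tl (i : ℕ) (g : A⟦X⟧) : A⟦X⟧ := X * PowerSeries.mk fun n => coeff (i + 1 + n) g

theorem coeff_tl_zero (i : ℕ) (g : A⟦X⟧) : coeff 0 (tl i g) = 0 := by simp [tl]

theorem coeff_tl_succ (i n : ℕ) (g : A⟦X⟧) : coeff (n + 1) (tl i g) = coeff (i + 1 + n) g := by
  rw [tl, coeff_succ_X_mul, coeff_mk]

theorem tl_eq (i : ℕ) (g : A⟦X⟧) :
    tl i g = X * (PowerSeries.C (coeff (i + 1) g) + tl (i + 1) g) := by
  rw [tl]
  congr 1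
  ext n
  rcases n with _ | n
  · rw [map_add, coeff_tl_zero, coeff_mk, coeff_zero_C, add_zero, add_zero]
  · rw [map_add, coeff_tl_succ, coeff_mk, coeff_C, if_neg n.succ_ne_zero, zero_add]
    congr 2
    omega

theorem tl_zero {g : A⟦X⟧} (h : coeff 0 g = 0) : tl 0 g = g := by
  ext n
  rcases n with _ | n
  · rw [coeff_tl_zero, h]
  · rw [coeff_tl_succ]; congr 2; omega

/-- The factor u⁻¹ on the right is what makes every descent below work: an error term reproducing
itself in this way is divisible by all powers of u⁻¹. -/
theorem coeff_of_rel {F G : A⟦X⟧⟦X⟧} (h : wt A • F = qt A • G) (s : ℕ) :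
    coeff s F = X * (coeff (s + 1) F + coeff s G) := by
  have h1 := congrArg (coeff (s + 1)) h
  rw [wt_smul, qt_smul, cX_smul, cX_smul, cY_smul, cY_smul, map_sub, coeff_succ_X_mul,
    coeff_C_mul, coeff_C_mul, coeff_succ_X_mul] at h1
  rw [mul_add, ← h1]; abel

theorem coeff_inU_mul_inV (s : ℕ) (g h : A⟦X⟧) :
    coeff s (inU g * inV h) = g * PowerSeries.C (coeff s h) := by
  simp [inU, inV, coeff_C_mul]

theorem coeff_inV_mul_inU (s : ℕ) (g h : A⟦X⟧) :
    coeff s (inV h * inU g) = PowerSeries.C (coeff s h) * g := by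
  simp [inU, inV, coeff_mul_C]

theorem coeff_inU_succ (s : ℕ) (g : A⟦X⟧) : coeff (s + 1) (inU g) = 0 := by
  simp [inU]

theorem X_descent (D : ℕ → A⟦X⟧) (h : ∀ s, D s = X * D (s + 1)) (s : ℕ) : D s = 0 := by
  have key : ∀ n s, D s = X ^ n * D (s + n) := by
    intro n
    induction n with
    | zero => simp
    | succ n ih =>
      intro s
      rw [ih s, h (s + n), ← mul_assoc, ← pow_succ, add_assoc]
  ext n
  rw [key (n + 1) s]
  exact X_pow_dvd_iff.1 (dvd_mul_right _ _) n (Nat.lt_succ_self n)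

/-- The difference Δᵢ of the two sides satisfies Δᵢ = u⁻¹Δᵢ₊₁, hence vanishes. The sign ε is 1 for
d₁ and -1 for d₂. -/
theorem comm_tl {g e : A⟦X⟧} {ε : ℤ} (h : wt A • (inU g * inV e - inV e * inU g)
      = qt A • (ε • (inU g * (inV e - inU e)))) (i : ℕ) :
    g * PowerSeries.C (coeff (i + 1) e) - PowerSeries.C (coeff (i + 1) e) * g
      = ε • (g * tl i e) := by
  refine sub_eq_zero.1 (X_descent (fun i => g * PowerSeries.C (coeff (i + 1) e) -
    PowerSeries.C (coeff (i + 1) e) * g - ε • (g * tl i e)) (fun i => ?_) i)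
  have h1 := coeff_of_rel h (i + 1)
  rw [map_sub, coeff_inU_mul_inV, coeff_inV_mul_inU, map_sub, coeff_inU_mul_inV,
    coeff_inV_mul_inU, map_zsmul, mul_sub, map_sub, ← map_mul, coeff_inU_succ, sub_zero,
    coeff_inU_mul_inV] at h1
  have h2 : g * tl i e = X * (g * (PowerSeries.C (coeff (i + 1) e) + tl (i + 1) e)) := by
    rw [tl_eq i e, ← mul_assoc, ← mul_assoc, X_mul]
  simp only [h1, h2, mul_add, mul_sub, smul_add, mul_smul_comm]
  abel

/-- Moving a tail of e across d₁ or d₂ shifts its argument by ε: the difference Δᵢ of the two sides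
satisfies Δᵢ = (u - ε)⁻¹Δᵢ₊₁. -/
theorem shiftHom_tl_mul {k : Type*} [Field k] [Algebra k A] {g e : A⟦X⟧} {ε : ℤ}
    (h : ∀ i, g * PowerSeries.C (coeff (i + 1) e) - PowerSeries.C (coeff (i + 1) e) * g
      = ε • (g * tl i e)) (i : ℕ) :
    shiftHom (ε : k) (tl i e) * g = g * tl i e := by
  refine sub_eq_zero.1 (eq_zero_of_invSub_descent (ε : k)
    (fun i => shiftHom (ε : k) (tl i e) * g - g * tl i e) (fun i => ?_) i)
  set z := sc A (invSub (ε : k)) with hz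
  set b := PowerSeries.C (coeff (i + 1) e) + tl (i + 1) e with hb
  have hzX : z - ε • (z * X) = X := by
    have h1 := congrArg (sc A) (invSub_mul (ε : k))
    rw [map_mul, sc_X, ← hz, map_sub, map_mul, sc_X, map_one, mul_sub, mul_one] at h1
    have h2 : sc A (PowerSeries.C (ε : k)) = (ε : A⟦X⟧) := by rw [map_intCast, map_intCast]
    rw [h2, (Int.cast_commute ε z).symm.left_comm, ← zsmul_eq_mul] at h1
    exact h1
  have h2 : g * tl i e = X * (g * b) := by
    rw [tl_eq i e, ← mul_assoc, ← mul_assoc, X_mul]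
  have h3 : shiftHom (ε : k) (tl i e) =
      z * (PowerSeries.C (coeff (i + 1) e) + shiftHom (ε : k) (tl (i + 1) e)) := by
    conv_lhs => rw [tl_eq i e]
    rw [map_mul, map_add, shiftHom_X, shiftHom_C]
  have h4 : PowerSeries.C (coeff (i + 1) e) * g =
      g * PowerSeries.C (coeff (i + 1) e) - ε • (X * (g * b)) := by
    rw [← h2, ← h i]; abel
  have h5 : z * (g * b) - ε • (z * (X * (g * b))) = X * (g * b) := by
    have := congrArg (· * (g * b)) hzX
    simpa [sub_mul, smul_mul_assoc, mul_assoc] using this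
  simp only [h3, mul_assoc, add_mul, h4, h2, mul_add, mul_sub, mul_smul_comm]
  rw [hb] at h5 ⊢
  simp only [mul_add, smul_add] at h5 ⊢
  linear_combination (norm := module) h5

/-- The relation `(u - v)[g(u), g(v)] = (g(u) - g(v))²`. -/
def SelfRel (g : A⟦X⟧) : Prop := wt A • (inU g * inV g - inV g * inU g)
    = qt A • ((inU g - inV g) * (inU g - inV g))

theorem SelfRel.comm {g : A⟦X⟧} (h : SelfRel g) (h0 : coeff 0 g = 0) :
    PowerSeries.C (coeff 1 g) * g - g * PowerSeries.C (coeff 1 g) = g * g := by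
  have h1 := coeff_of_rel h 0
  rw [map_sub, coeff_inU_mul_inV, coeff_inV_mul_inU, map_sub, coeff_inU_mul_inV,
    coeff_inV_mul_inU, h0] at h1
  simp only [mul_sub, sub_mul, map_sub, coeff_inU_mul_inV, coeff_inV_mul_inU, ← map_mul] at h1
  have h2 : coeff 0 (inV (g * g)) = 0 := by simp [inV, coeff_mul, h0]
  have h3 : coeff 0 (inU (g * g)) = g * g := by simp [inU]
  rw [h2, h3, h0, zero_add] at h1
  have h4 := X_mul_cancel (show X * (0 : A⟦X⟧) = X * (g * PowerSeries.C (coeff 1 g) -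
    PowerSeries.C (coeff 1 g) * g + g * g) by rw [mul_zero]; simpa [mul_sub, mul_add] using h1)
  rw [← sub_eq_zero, ← neg_eq_zero]
  rw [h4]; abel

theorem inU_X_mul (g : A⟦X⟧) : inU (X * g) = cX A • inU g := by rw [map_mul]; rfl
theorem inV_X_mul (g : A⟦X⟧) : inV (X * g) = cY A • inV g := by
  rw [map_mul, cY_smul]; simp [inV]

theorem cX_cancel {F : A⟦X⟧⟦X⟧} (h : cX A • F = 0) : F = 0 :=
  ext2 fun r s => by simpa using congrArg (coeff2 (r + 1) s) h
theorem cY_cancel {F : A⟦X⟧⟦X⟧} (h : cY A • F = 0) : F = 0 :=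
  ext2 fun r s => by simpa using congrArg (coeff2 r (s + 1)) h

/-- Passes the relation from one tail to the next. The larger series satisfies [a, g] = u⁻¹(a + g)²;
with this identity in u and in v subtracted, its relation becomes that of g times u⁻¹v⁻¹. -/
theorem selfRel_tail {a : A} {g : A⟦X⟧} (h : SelfRel (X * (PowerSeries.C a + g)))
    (h0 : coeff 0 g = 0) : SelfRel g := by
  have h1 := h.comm (by simp)
  have hc : coeff 1 (X * (PowerSeries.C a + g)) = a := by
    rw [coeff_succ_X_mul, map_add, h0, coeff_zero_C, add_zero]
  rw [hc] at h1
  set α := PowerSeries.C a + g with hα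
  have h2 : PowerSeries.C a * g - g * PowerSeries.C a = X * (α * α) := by
    refine X_mul_cancel ?_
    have e1 : X * α * (X * α) = X * (X * (α * α)) := by
      rw [mul_assoc, ← mul_assoc α, (PowerSeries.commute_X α).eq, mul_assoc]
    rw [e1] at h1
    rw [← h1, hα]
    have e2 : ∀ z : A⟦X⟧, PowerSeries.C a * (X * z) = X * (PowerSeries.C a * z) := fun z => by
      rw [← mul_assoc, (PowerSeries.commute_X _).eq, mul_assoc]
    rw [e2, mul_assoc, ← mul_sub]
    congr 1
    noncomm_ring
  have hU := congrArg inU h2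
  have hV := congrArg inV h2
  rw [inU_X_mul] at hU
  rw [inV_X_mul] at hV
  have hVa : inV (PowerSeries.C a) = inU (PowerSeries.C a) := by simp [inV, inU]
  unfold SelfRel at h ⊢
  rw [inU_X_mul, inV_X_mul] at h
  simp only [hα, map_add, map_mul, map_sub, hVa] at h hU hV
  set â := inU (PowerSeries.C a)
  generalize inU g = p at *
  generalize inV g = q at *
  rw [← sub_eq_zero]
  refine cX_cancel (cY_cancel ?_)
  unfold wt qt at *
  generalize cX A = x at *
  generalize cY A = y at *
  simp only [mul_add, add_mul, mul_sub, sub_mul, smul_mul_assoc, mul_smul_comm] at h hU hV ⊢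
  linear_combination (norm := module) h + (x * y * (y - x)) • hU - (x * y * (y - x)) • hV

theorem SelfRel.tl {g : A⟦X⟧} (h : SelfRel g) (h0 : coeff 0 g = 0) (i : ℕ) :
    SelfRel (tl i g) := by
  induction i with
  | zero => rwa [tl_zero h0]
  | succ i ih =>
    rw [tl_eq] at ih
    exact selfRel_tail ih (coeff_tl_zero _ _)

theorem sc_C_mul {k : Type*} [Field k] [Algebra k A] (c : k) (g : A⟦X⟧) :
    sc A (PowerSeries.C c) * g = c • g := by
  ext n
  rw [sc, map_C, coeff_C_mul, coeff_smul, Algebra.smul_def]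

/-- Under v = u - c the factor u - v becomes the scalar c. -/
theorem SelfRel.specialize {k : Type*} [Field k] [Algebra k A] {g : A⟦X⟧} (h : SelfRel g)
    (c : k) : c • (g * shiftHom c g - shiftHom c g * g)
      = (g - shiftHom c g) * (g - shiftHom c g) := by
  have h1 := congrArg (RestrictedYangian.specialize c) h
  rw [wt_smul, qt_smul, cX_smul, cX_smul, cY_smul, cY_smul] at h1
  have hX : RestrictedYangian.specialize c (PowerSeries.C (X : A⟦X⟧)) = X := specialize_inU c X
  simp only [map_sub, map_mul, hX, specialize_X, specialize_inU, specialize_inV] at h1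
  generalize shiftHom c g = g' at *
  rw [← sub_mul] at h1
  set z := sc A (invSub c)
  have hz : z - X = c • (X * z) := by
    have h2 : invSub c - X = PowerSeries.C c * (X * invSub c) := by
      linear_combination invSub_mul c
    have h3 := congrArg (sc A) h2
    rwa [map_sub, map_mul, map_mul, sc_X, sc_C_mul] at h3
  have h2 : z * (c • (g * g' - g' * g)) = z * ((g - g') * (g - g')) := by
    refine X_mul_cancel ?_
    rw [← h1, hz, smul_mul_assoc, mul_smul_comm, mul_smul_comm, mul_assoc]
  have h3 := congrArg (sc A (1 - PowerSeries.C c * X) * ·) h2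
  simp only [← mul_assoc] at h3
  have h4 : sc A (1 - PowerSeries.C c * X) * z = X := by
    rw [← map_mul, mul_comm, invSub_mul, sc_X]
  rw [h4, mul_assoc X] at h3
  exact X_mul_cancel h3

end Tails
end RestrictedYangian

end

noncomputable section
namespace RestrictedYangian
open PowerSeries

/-! ### Iterated commutators in characteristic p -/

section RingLemmas

/-- If `[A, δ] = δ²` and `B = A - 2δ`, then `∑_{i+j=n-1} Aⁱ Bʲ = n Qₙ` for some `Qₙ`. -/
theorem exists_geom_sum_eq_nsmul {R : Type*} [Ring R] {a δ : R} (h : a * δ - δ * a = δ * δ)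
    (n : ℕ) : ∃ Q : R, ∑ i ∈ Finset.range (n + 1), a ^ i * (a - 2 * δ) ^ (n - i) = (n + 1 : ℕ) • Q ∧
      a ^ (n + 1) = Q * (a + (n : R) * δ) := by
  induction n with
  | zero => exact ⟨1, by simp⟩
  | succ n ih =>
    obtain ⟨Q, h1, h2⟩ := ih
    -- The longer sum is (n+1)Q(a - 2δ) + aⁿ⁺¹. The second property of Q gives Q(a - 2δ) = aⁿ⁺¹ -
    -- (n+2)Qδ, and n + 2 factors out, leaving this quotient.
    refine ⟨a ^ (n + 1) - (n + 1 : ℕ) • (Q * δ), ?_, ?_⟩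
    · rw [Finset.sum_range_succ, Nat.sub_self, pow_zero, mul_one]
      have h3 : ∑ i ∈ Finset.range (n + 1), a ^ i * (a - 2 * δ) ^ (n + 1 - i) =
          (n + 1 : ℕ) • Q * (a - 2 * δ) := by
        rw [← h1, Finset.sum_mul]
        refine Finset.sum_congr rfl fun i hi => ?_
        rw [mul_assoc, ← pow_succ]
        congr 2
        have := Finset.mem_range.1 hi
        omega
      have h4 : Q * (a - 2 * δ) = a ^ (n + 1) - (n + 2 : ℕ) • (Q * δ) := by
        rw [h2]
        simp only [mul_sub, mul_add, nsmul_eq_mul, Nat.cast_add, Nat.cast_ofNat, add_mul]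
        rw [← mul_assoc Q (n : R), ← (Nat.cast_commute n Q).eq, two_mul, two_mul, mul_add, mul_assoc]
        abel
      rw [h3, smul_mul_assoc, h4]
      generalize a ^ (n + 1) = x
      generalize Q * δ = y
      module
    · have h5 : δ * a = a * δ - δ * δ := by rw [← h]; abel
      have h6 : Q * δ * (a + ((n + 1 : ℕ) : R) * δ) = a ^ (n + 1) * δ := by
        rw [h2, mul_assoc, mul_assoc]
        congr 1
        rw [mul_add, h5, add_mul, mul_assoc, Nat.cast_succ, add_mul, one_mul, mul_add,
          ← mul_assoc δ, ← (Nat.cast_commute n δ).eq, mul_assoc]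
        abel
      rw [sub_mul, smul_mul_assoc, h6, pow_succ a (n + 1), mul_add, nsmul_eq_mul, ← mul_assoc,
        ← (Nat.cast_commute (n + 1) (a ^ (n + 1))).eq, mul_assoc]
      abel

/-- Left and right multiplication by y commute, and L = (L - R) + R. In characteristic p the p-th
power is additive on commuting operators, so (ad y)ᵖ = ad(yᵖ). -/
theorem ad_iterate {k R : Type*} [Field k] [Ring R] [Algebra k R] (p : ℕ) [hp : Fact p.Prime]
    [CharP k p] (y x : R) : (fun z => y * z - z * y)^[p] x = y ^ p * x - x * y ^ p := by
  have h0 : ((p : ℕ) : Module.End k R) = 0 := by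
    ext z
    rw [← nsmul_one, LinearMap.smul_apply, Module.End.one_apply, ← Nat.cast_smul_eq_nsmul k,
      CharP.cast_eq_zero, zero_smul, LinearMap.zero_apply]
  have hc : Commute (LinearMap.mulLeft k y - LinearMap.mulRight k y) (LinearMap.mulRight k y) :=
    (LinearMap.commute_mulLeft_right (R := k) y y).sub_left (Commute.refl _)
  obtain ⟨r, h1⟩ := hc.exists_add_pow_prime_eq hp.out
  rw [h0, zero_mul, zero_mul, zero_mul, add_zero, sub_add_cancel, LinearMap.pow_mulLeft,
    LinearMap.pow_mulRight] at h1
  have h2 := congrArg (fun φ : Module.End k R => φ x) h1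
  simp only [LinearMap.add_apply, LinearMap.mulLeft_apply, LinearMap.mulRight_apply] at h2
  rw [h2, Module.End.pow_apply, add_sub_cancel_right]
  rfl

theorem ad_mul {R : Type*} [Ring R] (y a b : R) :
    y * (a * b) - a * b * y = (y * a - a * y) * b + a * (y * b - b * y) := by
  noncomm_ring

section

variable {R : Type*} [Ring R] {y E : R} (hE : y * E - E * y = E * E)
include hE

theorem ad_pow (i : ℕ) : y * E ^ i - E ^ i * y = i • E ^ (i + 1) := by
  induction i with
  | zero => simp
  | succ i ih =>
    rw [pow_succ, ad_mul, ih, hE, ← mul_assoc, ← pow_succ, ← pow_succ, smul_mul_assoc, ← pow_succ,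
      add_smul, one_smul]

/-- The derivation [y, ·] kills aE, since the contributions -aE² and aE² cancel; two applications
therefore suffice. -/
theorem ad_iterate_eq_zero {a : R} (ha : y * a - a * y = -(a * E)) (m : ℕ) :
    (fun z => y * z - z * y)^[m + 2] a = 0 := by
  have h2 : (fun z => y * z - z * y)^[2] a = 0 := by
    simp only [Function.iterate_succ, Function.iterate_zero, Function.comp_apply, id, ha]
    have := ad_mul y a E
    rw [ha, hE] at this
    rw [mul_neg, neg_mul, ← neg_sub', this]
    noncomm_ring
  rw [Function.iterate_add_apply, h2]
  exact Function.iterate_fixed (by simp) m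

theorem ad_iterate_eq_factorial_smul {g : R} (hg : y * g - g * y = g * E) (m : ℕ) :
    (fun z => y * z - z * y)^[m] g = m.factorial • (g * E ^ m) := by
  induction m with
  | zero => simp
  | succ m ih =>
    rw [Function.iterate_succ_apply', ih, mul_smul_comm, smul_mul_assoc, ← smul_sub, ad_mul, hg,
      ad_pow hE, mul_assoc, ← pow_succ', mul_smul_comm, ← succ_nsmul', smul_smul,
      Nat.factorial_succ, mul_comm]

theorem ad_iterate_eq_factorial_smul_sum {h : R} (hh : y * h - h * y = E * h + h * E) (m : ℕ) :
    (fun z => y * z - z * y)^[m] h =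
      m.factorial • ∑ i ∈ Finset.range (m + 1), E ^ i * h * E ^ (m - i) := by
  induction m with
  | zero => simp
  | succ m ih =>
    rw [Function.iterate_succ_apply', ih, mul_smul_comm, smul_mul_assoc, ← smul_sub,
      Nat.factorial_succ, mul_comm (m + 1), mul_smul]
    congr 1
    rw [Finset.mul_sum, Finset.sum_mul, ← Finset.sum_sub_distrib]
    have h1 : ∀ i ∈ Finset.range (m + 1),
        y * (E ^ i * h * E ^ (m - i)) - E ^ i * h * E ^ (m - i) * y =
          (i + 1) • (E ^ (i + 1) * h * E ^ (m + 1 - (i + 1))) +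
            (m + 1 - i) • (E ^ i * h * E ^ (m + 1 - i)) := by
      intro i hi
      have hi' : m + 1 - i = m - i + 1 := by have := Finset.mem_range.1 hi; omega
      rw [ad_mul, ad_mul, ad_pow hE, ad_pow hE, hh, hi', Nat.add_sub_add_right, pow_succ' E (m - i),
        pow_succ E i]
      simp only [mul_add, add_mul, smul_mul_assoc, mul_smul_comm, mul_assoc, add_smul, one_smul]
      abel
    rw [Finset.sum_congr rfl h1, Finset.sum_add_distrib]
    have h2 := Finset.sum_range_succ' (fun i => i • (E ^ i * h * E ^ (m + 1 - i))) (m + 1)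
    have h3 := Finset.sum_range_succ (fun i => (m + 1 - i) • (E ^ i * h * E ^ (m + 1 - i))) (m + 1)
    rw [zero_smul, add_zero] at h2
    rw [Nat.sub_self (m + 1), zero_smul, add_zero] at h3
    rw [← h2, ← h3, ← Finset.sum_add_distrib, Finset.smul_sum]
    refine Finset.sum_congr rfl fun i hi => ?_
    rw [← add_smul]
    congr 1
    have := Finset.mem_range.1 hi
    omega

end

end RingLemmas

/-! ### The elements (e⁽ʳ⁾)ᵖ commute with d₁, d₂ and f -/

section PCenter

variable {k A : Type*} [Field k] [Ring A] [Algebra k A] {T : Fin 2 → Fin 2 → A⟦X⟧}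
  (hT : IsYangian T)
include hT

namespace IsYangian

theorem coeff_zero_e : coeff 0 (eOf T) = 0 := by
  have h := hT.const 0 1
  rw [coeff_zero_eq_constantCoeff_apply] at h ⊢
  rw [eOf, map_mul, h]
  simp

theorem coeff_zero_f : coeff 0 (fOf T) = 0 := by
  have h := hT.const 1 0
  rw [coeff_zero_eq_constantCoeff_apply] at h ⊢
  rw [fOf, map_mul, h]
  simp

theorem d1_comm_e (i : ℕ) :
    T 0 0 * PowerSeries.C (coeff (i + 1) (eOf T)) - PowerSeries.C (coeff (i + 1) (eOf T)) * T 0 0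
      = T 0 0 * tl i (eOf T) := by
  have := comm_tl (ε := 1) (g := T 0 0) (e := eOf T) (by rw [one_smul]; exact hT.d1_e) i
  rwa [one_smul] at this

theorem d2_comm_e (i : ℕ) :
    d2Of T * PowerSeries.C (coeff (i + 1) (eOf T)) - PowerSeries.C (coeff (i + 1) (eOf T)) * d2Of T
      = -(d2Of T * tl i (eOf T)) := by
  have h := hT.d2_e
  rw [neg_smul, ← smul_neg, neg_sub] at h
  have := comm_tl (ε := -1) (by rw [h, neg_smul, one_smul]; noncomm_ring) i
  rwa [neg_smul, one_smul] at this

theorem shift_e_d1 (i : ℕ) :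
    shiftHom (1 : k) (tl i (eOf T)) * T 0 0 = T 0 0 * tl i (eOf T) := by
  have := shiftHom_tl_mul (k := k) (ε := 1) (g := T 0 0) (e := eOf T)
    (fun i => by rw [one_smul]; exact hT.d1_comm_e i) i
  rwa [Int.cast_one] at this

theorem shift_e_d2 (i : ℕ) :
    shiftHom (-1 : k) (tl i (eOf T)) * d2Of T = d2Of T * tl i (eOf T) := by
  have := shiftHom_tl_mul (k := k) (ε := -1) (g := d2Of T) (e := eOf T)
    (fun i => by rw [neg_smul, one_smul]; exact hT.d2_comm_e i) i
  rwa [Int.cast_neg, Int.cast_one] at this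

theorem selfRel_e (i : ℕ) : SelfRel (tl i (eOf T)) := SelfRel.tl hT.e_e hT.coeff_zero_e i

theorem e_comm_tl (i : ℕ) : PowerSeries.C (coeff (i + 1) (eOf T)) * tl i (eOf T)
    - tl i (eOf T) * PowerSeries.C (coeff (i + 1) (eOf T)) = tl i (eOf T) * tl i (eOf T) := by
  have := (hT.selfRel_e i).comm (coeff_tl_zero _ _)
  rwa [coeff_tl_succ i 0, add_zero] at this

theorem d1Inv_comm {g : A⟦X⟧} (h : T 0 0 * g = g * T 0 0) : d1InvOf T * g = g * d1InvOf T := by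
  calc d1InvOf T * g = d1InvOf T * (g * T 0 0) * d1InvOf T := by
        rw [mul_assoc, mul_assoc, hT.d1_mul_inv, mul_one]
    _ = g * d1InvOf T := by rw [← h, ← mul_assoc, hT.inv_mul_d1, one_mul]

theorem d1Inv_d2 : d1InvOf T * d2Of T = d2Of T * d1InvOf T := by
  refine hT.d1Inv_comm ?_
  ext n
  rw [coeff_mul, coeff_mul, ← Finset.Nat.sum_antidiagonal_swap]
  exact Finset.sum_congr rfl fun x _ => (hT.coeff_d1_d2 _ _).eq

/-- The right side of the e–f relation is h(u) - h(v), which has no mixed coefficients. So the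
commutator depends only on r + s, and r = 0 is read off at the boundary. -/
theorem e_comm_f (r s : ℕ) :
    coeff (r + 1) (eOf T) * coeff (s + 1) (fOf T) - coeff (s + 1) (fOf T) * coeff (r + 1) (eOf T)
      = - coeff (r + s + 1) (hOf T) := by
  have h := ((wt_smul_eq_qt_smul_iff _ _).1 hT.e_f).1
  rw [← map_mul, ← map_mul, ← hT.d1Inv_d2] at h
  have hU : ∀ r s (g : A⟦X⟧), coeff2 r (s + 1) (inU g) = 0 := fun r s g => by
    rw [coeff2, coeff_inU_succ, map_zero]
  have hV : ∀ r s (g : A⟦X⟧), coeff2 r s (inV g) = if r = 0 then coeff s g else 0 :=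
    fun r s g => by simp [coeff2, inV, coeff_C]
  simp only [coeff2_sub, coeff2_inU_mul_inV, coeff2_inV_mul_inU] at h
  induction r generalizing s with
  | zero =>
    have := h 0 (s + 1)
    rw [hU, hV, hT.coeff_zero_e] at this
    simpa [hOf] using this
  | succ r ih =>
    have := h (r + 1) (s + 1)
    rw [hU, hV, ih (s + 1), if_neg r.succ_ne_zero, sub_zero, sub_eq_zero] at this
    rw [this]
    congr 3
    omega

theorem tl_e_mul_d1Inv (i : ℕ) :
    tl i (eOf T) * d1InvOf T = d1InvOf T * shiftHom (1 : k) (tl i (eOf T)) := by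
  calc tl i (eOf T) * d1InvOf T = d1InvOf T * (T 0 0 * tl i (eOf T)) * d1InvOf T := by
        rw [← mul_assoc, hT.inv_mul_d1, one_mul]
    _ = d1InvOf T * shiftHom (1 : k) (tl i (eOf T)) := by
        rw [← hT.shift_e_d1 (k := k), mul_assoc, mul_assoc, hT.d1_mul_inv, mul_one]

theorem e_comm_h (i : ℕ) :
    PowerSeries.C (coeff (i + 1) (eOf T)) * hOf T - hOf T * PowerSeries.C (coeff (i + 1) (eOf T))
      = tl i (eOf T) * hOf T + hOf T * tl i (eOf T) := by
  have h1 := hT.d1_comm_e i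
  have h2 := hT.d2_comm_e i
  have h3 := congrArg (fun z => d1InvOf T * z * d1InvOf T) h1
  simp only [mul_sub, sub_mul, mul_assoc, hT.d1_mul_inv, mul_one] at h3
  simp only [← mul_assoc, hT.inv_mul_d1, one_mul] at h3
  rw [hOf, ad_mul, ← neg_sub (d2Of T * _), h2, neg_neg, h3, mul_assoc, mul_assoc]

variable (p : ℕ) [hp : Fact p.Prime]

/-- With x = E(u-1) and y = E(u+1), where E is the tail, the self-relation at distance 2 reads 2[y,
x] = (y - x)². The geometric sum in 2x and 2y is then p times an element, hence zero. -/
theorem geom_sum_shift_e (k : Type*) [Field k] [Algebra k A] [CharP k p] (i : ℕ) : ∑ j ∈ Finset.range p,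
    shiftHom (1 : k) (tl i (eOf T)) ^ j * shiftHom (-1 : k) (tl i (eOf T)) ^ (p - 1 - j) = 0 := by
  -- Dividing by 2 fails for p = 2, but there u - 1 = u + 1, so x = y and the sum is 2x = 0.
  by_cases h2 : (2 : k) = 0
  · have hp2 : p = 2 := by
      have : p ∣ 2 := (CharP.cast_eq_zero_iff k p 2).1 (by exact_mod_cast h2)
      exact (Nat.prime_dvd_prime_iff_eq hp.out Nat.prime_two).1 this
    have h1 : (-1 : k) = 1 := by linear_combination - h2
    rw [h1]
    subst hp2
    rw [Finset.sum_range_succ, Finset.sum_range_one]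
    simp only [pow_zero, one_mul, mul_one, Nat.sub_zero, Nat.add_one_sub_one, Nat.sub_self, pow_one]
    rw [← two_smul k, h2, zero_smul]
  · have h := congrArg (shiftHom (-1 : k)) ((hT.selfRel_e i).specialize (2 : k))
    rw [two_smul] at h
    simp only [map_add, map_sub, map_mul, shiftHom_shiftHom] at h
    rw [show (-1 + 2 : k) = 1 by norm_num] at h
    generalize shiftHom (1 : k) (tl i (eOf T)) = x at *
    generalize shiftHom (-1 : k) (tl i (eOf T)) = y at *
    -- With a = 2x and δ = x - y, the second base a - 2δ is 2y.
    obtain ⟨Q, hQ, -⟩ := exists_geom_sum_eq_nsmul (a := (2 : k) • x) (δ := x - y) (by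
      rw [two_smul]
      have : (x - y) * (x - y) = (y - x) * (y - x) := by noncomm_ring
      rw [this, ← h]
      noncomm_ring) (p - 1)
    have h3 : (2 : k) • x - 2 * (x - y) = (2 : k) • y := by
      rw [two_smul, two_smul, two_mul]; abel
    rw [h3, Nat.sub_add_cancel hp.out.one_le, ← Nat.cast_smul_eq_nsmul k, CharP.cast_eq_zero,
      zero_smul] at hQ
    have h4 : ∀ j ∈ Finset.range p, ((2 : k) • x) ^ j * ((2 : k) • y) ^ (p - 1 - j) =
        (2 : k) ^ (p - 1) • (x ^ j * y ^ (p - 1 - j)) := by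
      intro j hj
      rw [smul_pow, smul_pow, smul_mul_smul_comm, ← pow_add]
      congr 2
      have := Finset.mem_range.1 hj
      omega
    rw [Finset.sum_congr rfl h4, ← Finset.smul_sum] at hQ
    exact (smul_eq_zero.1 hQ).resolve_left (pow_ne_zero _ h2)

/-- The p - 1 brackets give (p-1)! ∑ EʲhEᵖ⁻¹⁻ʲ with h = d₁⁻¹d₂. Moving the left powers across d₁⁻¹
and the right ones across d₂ shifts them in opposite directions, which produces the vanishing
geometric sum. -/
theorem ad_iterate_h (k : Type*) [Field k] [Algebra k A] [CharP k p] (i : ℕ) :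
    (fun z => PowerSeries.C (coeff (i + 1) (eOf T)) * z - z * PowerSeries.C (coeff (i + 1) (eOf T)))^[p - 1]
      (hOf T) = 0 := by
  rw [ad_iterate_eq_factorial_smul_sum (hT.e_comm_tl i) (hT.e_comm_h i),
    Nat.sub_add_cancel hp.out.one_le]
  have hx : ∀ j, tl i (eOf T) ^ j * d1InvOf T =
      d1InvOf T * shiftHom (1 : k) (tl i (eOf T)) ^ j := by
    intro j
    induction j with
    | zero => simp
    | succ j ih =>
      rw [pow_succ, pow_succ, mul_assoc, hT.tl_e_mul_d1Inv (k := k), ← mul_assoc, ih, mul_assoc]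
  have hy : ∀ j, d2Of T * tl i (eOf T) ^ j =
      shiftHom (-1 : k) (tl i (eOf T)) ^ j * d2Of T := by
    intro j
    induction j with
    | zero => simp
    | succ j ih =>
      rw [pow_succ', pow_succ', ← mul_assoc, ← hT.shift_e_d2 (k := k), mul_assoc, ih, mul_assoc]
  have h1 : ∀ j ∈ Finset.range p, tl i (eOf T) ^ j * hOf T * tl i (eOf T) ^ (p - 1 - j) =
      d1InvOf T * (shiftHom (1 : k) (tl i (eOf T)) ^ j *
        shiftHom (-1 : k) (tl i (eOf T)) ^ (p - 1 - j)) * d2Of T := by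
    intro j _
    rw [hOf, ← mul_assoc, hx, mul_assoc, hy]
    simp only [mul_assoc]
  rw [Finset.sum_congr rfl h1, ← Finset.sum_mul, ← Finset.mul_sum, hT.geom_sum_shift_e p k,
    mul_zero, zero_mul, smul_zero]

omit hT in
theorem coeff_ad_iterate (y : A) (g : A⟦X⟧) (m n : ℕ) :
    coeff n ((fun z => PowerSeries.C y * z - z * PowerSeries.C y)^[m] g) =
      (fun z => y * z - z * y)^[m] (coeff n g) := by
  induction m generalizing g with
  | zero => rfl
  | succ m ih =>
    rw [Function.iterate_succ_apply, Function.iterate_succ_apply, ih, map_sub, coeff_C_mul,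
      coeff_mul_C]

theorem commute_e_pow_d1 (k : Type*) [Field k] [Algebra k A] [CharP k p] (r s : ℕ) : Commute (coeff r (eOf T) ^ p) (coeff s (T 0 0)) := by
  rcases r with _ | i
  · rw [hT.coeff_zero_e, zero_pow hp.out.ne_zero]; exact Commute.zero_left _
  · rw [commute_iff_eq, ← sub_eq_zero, ← ad_iterate (k := k) p, ← coeff_ad_iterate,
      ← Nat.sub_add_cancel hp.out.two_le, ad_iterate_eq_zero (hT.e_comm_tl i), map_zero]
    rw [← hT.d1_comm_e i, neg_sub]

/-- Here p brackets give the multiple p! of d₂(u)Eᵖ, whereas for d₁ two brackets already give zero.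
-/
theorem commute_e_pow_d2 (k : Type*) [Field k] [Algebra k A] [CharP k p] (r s : ℕ) : Commute (coeff r (eOf T) ^ p) (coeff s (d2Of T)) := by
  rcases r with _ | i
  · rw [hT.coeff_zero_e, zero_pow hp.out.ne_zero]; exact Commute.zero_left _
  · rw [commute_iff_eq, ← sub_eq_zero, ← ad_iterate (k := k) p, ← coeff_ad_iterate,
      ad_iterate_eq_factorial_smul (hT.e_comm_tl i), ← Nat.cast_smul_eq_nsmul k,
      (CharP.cast_eq_zero_iff k p _).2 (Nat.dvd_factorial hp.out.pos le_rfl), zero_smul, map_zero]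
    rw [← neg_sub (d2Of T * _), hT.d2_comm_e i, neg_neg]

/-- The first bracket with f is a coefficient of -h, and the remaining p - 1 brackets kill h. -/
theorem commute_e_pow_f (k : Type*) [Field k] [Algebra k A] [CharP k p] (r s : ℕ) : Commute (coeff r (eOf T) ^ p) (coeff s (fOf T)) := by
  rcases r with _ | i
  · rw [hT.coeff_zero_e, zero_pow hp.out.ne_zero]; exact Commute.zero_left _
  rcases s with _ | s
  · rw [hT.coeff_zero_f]; exact Commute.zero_right _
  rw [commute_iff_eq, ← sub_eq_zero, ← ad_iterate (k := k) p]
  conv_lhs => rw [← Nat.sub_add_cancel hp.out.one_le]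
  rw [Function.iterate_succ_apply, hT.e_comm_f, ← map_neg, ← coeff_ad_iterate]
  have h1 : ∀ (m : ℕ) (y g : A⟦X⟧), (fun z => y * z - z * y)^[m] (-g) =
      -(fun z => y * z - z * y)^[m] g := by
    intro m y g
    induction m generalizing g with
    | zero => rfl
    | succ m ih =>
      rw [Function.iterate_succ_apply, Function.iterate_succ_apply, ← ih]
      congr 1
      noncomm_ring
  rw [h1, hT.ad_iterate_h p k, neg_zero, map_zero]

end IsYangian

end PCenter
end RestrictedYangian

end

noncomputable section
namespace RestrictedYangian
open PowerSeries

/-! ### Transposition over the opposite ring: from e to f -/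

section Opposite

variable {A : Type*} [Ring A]

/-- A series, viewed over the opposite ring. -/
def opS (g : A⟦X⟧) : Aᵐᵒᵖ⟦X⟧ := PowerSeries.mk fun n => MulOpposite.op (coeff n g)

@[simp] theorem coeff_opS (n : ℕ) (g : A⟦X⟧) : coeff n (opS g) = MulOpposite.op (coeff n g) :=
  coeff_mk _ _

theorem opS_injective : Function.Injective (opS : A⟦X⟧ → Aᵐᵒᵖ⟦X⟧) := fun g h e => by
  ext n
  simpa using congrArg (coeff n) e

theorem opS_mul (g h : A⟦X⟧) : opS (g * h) = opS h * opS g := by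
  ext n
  rw [coeff_opS, coeff_mul, coeff_mul, ← Finset.Nat.sum_antidiagonal_swap, Finset.op_sum]
  simp

theorem opS_sub (g h : A⟦X⟧) : opS (g - h) = opS g - opS h := by ext n; simp
theorem opS_neg (g : A⟦X⟧) : opS (-g) = -opS g := by ext n; simp
theorem opS_one : opS (1 : A⟦X⟧) = 1 := by
  ext n; rw [coeff_opS, coeff_one, coeff_one]; split_ifs <;> simp
theorem opS_C (a : A) : opS (PowerSeries.C a) = PowerSeries.C (MulOpposite.op a) := by
  ext n; rw [coeff_opS, coeff_C, coeff_C]; split_ifs <;> simp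
theorem opS_tl (i : ℕ) (g : A⟦X⟧) : opS (tl i g) = tl i (opS g) := by
  ext n
  rcases n with _ | n
  · rw [coeff_opS, coeff_tl_zero, coeff_tl_zero, MulOpposite.op_zero]
  · rw [coeff_opS, coeff_tl_succ, coeff_tl_succ, coeff_opS]
theorem opS_shiftHom {k : Type*} [Field k] [Algebra k A] (c : k) (g : A⟦X⟧) :
    opS (shiftHom c g) = shiftHom c (opS g) := by
  ext n
  rw [← shift_eq_shiftHom, ← shift_eq_shiftHom, coeff_opS, shift, shift, coeff_mk, coeff_mk,
    Finset.op_sum]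
  simp

variable {T : Fin 2 → Fin 2 → A⟦X⟧}

/-- The transposed matrix over the opposite ring. -/
def opT (T : Fin 2 → Fin 2 → A⟦X⟧) : Fin 2 → Fin 2 → Aᵐᵒᵖ⟦X⟧ := fun i j => opS (T j i)

namespace IsYangian
variable (hT : IsYangian T)
include hT

theorem comm_symm (i j m l : Fin 2) (r s : ℕ) :
    coeff r (T i j) * coeff s (T m l) - coeff s (T m l) * coeff r (T i j) =
      coeff s (T i j) * coeff r (T m l) - coeff r (T m l) * coeff s (T i j) := by
  have h1 := hT.rtt i j m l
  have h2 := hT.rtt_swap i j m l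
  have h3 : wt A • ((inU (T i j) * inV (T m l) - inV (T m l) * inU (T i j)) -
      (inV (T i j) * inU (T m l) - inU (T m l) * inV (T i j))) = 0 := by
    linear_combination (norm := module) h1 + h2
  simpa [sub_eq_zero] using congrArg (coeff2 r s) (wt_cancel _ h3)

/-- Reversing products and transposing indices turns the relation into the original one with r and s
interchanged, up to the symmetry `comm_symm`. Since e and f trade places, each statement about e
yields one about f. -/
theorem op : IsYangian (opT T) where
  const i j := by
    rw [opT, coeff_opS, hT.const]
    simp only [eq_comm (a := i)]
    split_ifs <;> simp
  rel i j m l r s := by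
    simp only [opT, coeff_opS, ← MulOpposite.op_mul, ← MulOpposite.op_sub]
    congr 1
    have h1 := hT.rel l m j i s r
    have h2 := hT.comm_symm j m l i r s
    linear_combination (norm := module) -h1 + h2

theorem d1Inv_op : d1InvOf (opT T) = opS (d1InvOf T) := by
  refine left_inv_eq_right_inv hT.op.inv_mul_d1 ?_
  rw [opT, ← opS_mul, hT.inv_mul_d1, opS_one]

theorem e_op : eOf (opT T) = opS (fOf T) := by
  rw [eOf, hT.d1Inv_op, fOf, opS_mul]; rfl

theorem f_op : fOf (opT T) = opS (eOf T) := by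
  rw [fOf, hT.d1Inv_op, eOf, opS_mul]; rfl

theorem d2_op : d2Of (opT T) = opS (d2Of T) := by
  rw [d2Of, hT.e_op, hT.f_op, d2Of, opS_sub, opS_mul, opS_mul, mul_assoc]; rfl

theorem f_comm_d1 (i : ℕ) :
    PowerSeries.C (coeff (i + 1) (fOf T)) * T 0 0 - T 0 0 * PowerSeries.C (coeff (i + 1) (fOf T))
      = tl i (fOf T) * T 0 0 := by
  have := hT.op.d1_comm_e i
  rw [hT.e_op, coeff_opS, ← opS_C, ← opS_tl, opT, ← opS_mul, ← opS_mul, ← opS_mul,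
    ← opS_sub] at this
  exact opS_injective this

theorem f_comm_d2 (i : ℕ) :
    PowerSeries.C (coeff (i + 1) (fOf T)) * d2Of T - d2Of T * PowerSeries.C (coeff (i + 1) (fOf T))
      = -(tl i (fOf T) * d2Of T) := by
  have := hT.op.d2_comm_e i
  rw [hT.e_op, hT.d2_op, coeff_opS, ← opS_C, ← opS_tl, ← opS_mul, ← opS_mul, ← opS_mul,
    ← opS_sub, ← opS_neg] at this
  exact opS_injective this

theorem f_comm_tl (i : ℕ) : tl i (fOf T) * PowerSeries.C (coeff (i + 1) (fOf T))
    - PowerSeries.C (coeff (i + 1) (fOf T)) * tl i (fOf T) = tl i (fOf T) * tl i (fOf T) := by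
  have := hT.op.e_comm_tl i
  rw [hT.e_op, coeff_opS, ← opS_C, ← opS_tl, ← opS_mul, ← opS_mul, ← opS_mul,
    ← opS_sub] at this
  exact opS_injective this

variable {k : Type*} [Field k] [Algebra k A]

theorem d1_shift_f (i : ℕ) :
    T 0 0 * shiftHom (1 : k) (tl i (fOf T)) = tl i (fOf T) * T 0 0 := by
  have := hT.op.shift_e_d1 (k := k) i
  rw [hT.e_op, ← opS_tl, ← opS_shiftHom, opT, ← opS_mul, ← opS_mul] at this
  exact opS_injective this

theorem d2_shift_f (i : ℕ) :
    d2Of T * shiftHom (-1 : k) (tl i (fOf T)) = tl i (fOf T) * d2Of T := by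
  have := hT.op.shift_e_d2 (k := k) i
  rw [hT.e_op, hT.d2_op, ← opS_tl, ← opS_shiftHom, ← opS_mul, ← opS_mul] at this
  exact opS_injective this

variable (p : ℕ) [hp : Fact p.Prime]

theorem commute_f_pow_d1 (k : Type*) [Field k] [Algebra k A] [CharP k p] (r s : ℕ) :
    Commute (coeff r (fOf T) ^ p) (coeff s (T 0 0)) := by
  have := hT.op.commute_e_pow_d1 p k r s
  rw [hT.e_op, opT, coeff_opS, coeff_opS, ← MulOpposite.op_pow] at this
  exact this.unop

theorem commute_f_pow_d2 (k : Type*) [Field k] [Algebra k A] [CharP k p] (r s : ℕ) :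
    Commute (coeff r (fOf T) ^ p) (coeff s (d2Of T)) := by
  have := hT.op.commute_e_pow_d2 p k r s
  rw [hT.e_op, hT.d2_op, coeff_opS, coeff_opS, ← MulOpposite.op_pow] at this
  exact this.unop

theorem commute_f_pow_e (k : Type*) [Field k] [Algebra k A] [CharP k p] (r s : ℕ) :
    Commute (coeff r (fOf T) ^ p) (coeff s (eOf T)) := by
  have := hT.op.commute_e_pow_f p k r s
  rw [hT.e_op, hT.f_op, coeff_opS, coeff_opS, ← MulOpposite.op_pow] at this
  exact this.unop

end IsYangian
end Opposite

/-! ### The coefficients of bᵢ(u) commute with f -/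

section ShiftProd

variable {k A : Type*} [Field k] [Ring A] [Algebra k A]

theorem commute_of_coeff {g h : A⟦X⟧} (H : ∀ r s, Commute (coeff r g) (coeff s h)) :
    Commute g h := by
  ext n
  rw [coeff_mul, coeff_mul, ← Finset.Nat.sum_antidiagonal_swap]
  exact Finset.sum_congr rfl fun x _ => (H _ _).eq

theorem commute_shiftHom {g : A⟦X⟧} (H : ∀ r s, Commute (coeff r g) (coeff s g)) (c d : k) :
    Commute (shiftHom c g) (shiftHom d g) := by
  refine commute_of_coeff fun r s => ?_
  rw [← shift_eq_shiftHom, ← shift_eq_shiftHom, shift, shift, coeff_mk, coeff_mk]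
  refine Commute.sum_left _ _ _ fun i _ => Commute.sum_right _ _ _ fun j _ => ?_
  exact ((H i j).smul_left _).smul_right _

/-- The product `g(u) g(u - 1) ⋯ g(u - m + 1)`. -/
def partialProd (k : Type*) [Field k] [Algebra k A] (g : A⟦X⟧) (m : ℕ) : A⟦X⟧ :=
  ((List.range m).map fun j : ℕ => shiftHom (j : k) g).prod

theorem shiftProd_eq (p : ℕ) (g : A⟦X⟧) : shiftProd k p g = partialProd k g p := by
  simp only [shiftProd, partialProd, shift_eq_shiftHom]

theorem partialProd_zero (g : A⟦X⟧) : partialProd k g 0 = 1 := rfl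

theorem partialProd_succ (g : A⟦X⟧) (m : ℕ) :
    partialProd k g (m + 1) = partialProd k g m * shiftHom (m : k) g := by
  simp [partialProd, List.range_succ]

variable {T : Fin 2 → Fin 2 → A⟦X⟧}
namespace IsYangian
variable (hT : IsYangian T)
include hT

theorem partialProd_d1_shift_f (i m : ℕ) :
    partialProd k (T 0 0) m * shiftHom (m : k) (tl i (fOf T)) =
      tl i (fOf T) * partialProd k (T 0 0) m := by
  induction m with
  | zero => simp [partialProd_zero, shiftHom_zero]
  | succ m ih =>
    have h := congrArg (shiftHom (m : k)) (hT.d1_shift_f (k := k) i)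
    rw [map_mul, map_mul, shiftHom_shiftHom] at h
    rw [partialProd_succ, Nat.cast_succ, mul_assoc, h, ← mul_assoc, ih, mul_assoc]

/-- By the Leibniz rule each factor d₁(u - j) contributes the tail of f at u - j, and moving it left
across the j preceding factors brings it back to u. All m contributions agree, so the total dies at
m = p. -/
theorem f_comm_partialProd_d1 (i m : ℕ) :
    PowerSeries.C (coeff (i + 1) (fOf T)) * partialProd k (T 0 0) m -
      partialProd k (T 0 0) m * PowerSeries.C (coeff (i + 1) (fOf T)) =
        m • (tl i (fOf T) * partialProd k (T 0 0) m) := by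
  induction m with
  | zero => simp [partialProd_zero]
  | succ m ih =>
    have h := congrArg (shiftHom (m : k)) (hT.f_comm_d1 i)
    rw [map_sub, map_mul, map_mul, shiftHom_C, map_mul] at h
    rw [partialProd_succ, ad_mul, ih, h, ← mul_assoc (partialProd k (T 0 0) m),
      hT.partialProd_d1_shift_f, add_smul, one_smul, smul_mul_assoc, mul_assoc]

/-- Tails of f cross d₂ with the opposite shift, so the new factor must be placed on the left; this
uses that the coefficients of d₂ commute with each other. -/
theorem f_comm_partialProd_d2 (i m : ℕ) :
    PowerSeries.C (coeff (i + 1) (fOf T)) * partialProd k (d2Of T) m -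
      partialProd k (d2Of T) m * PowerSeries.C (coeff (i + 1) (fOf T)) =
        -(m • (shiftHom ((m : k) - 1) (tl i (fOf T)) * partialProd k (d2Of T) m)) := by
  induction m with
  | zero => simp [partialProd_zero]
  | succ m ih =>
    have h := congrArg (shiftHom (m : k)) (hT.f_comm_d2 i)
    rw [map_sub, map_mul, map_mul, shiftHom_C, map_neg, map_mul] at h
    have h2 := congrArg (shiftHom (m : k)) (hT.d2_shift_f (k := k) i)
    rw [map_mul, map_mul, shiftHom_shiftHom, ← sub_eq_add_neg] at h2
    have h3 : Commute (partialProd k (d2Of T) m) (shiftHom (m : k) (d2Of T)) := by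
      refine Commute.list_prod_left _ _ fun x hx => ?_
      obtain ⟨j, -, rfl⟩ := List.mem_map.1 hx
      exact commute_shiftHom hT.coeff_d2_d2 _ _
    rw [partialProd_succ, h3.eq, ad_mul, ih, h, mul_neg, mul_smul_comm, ← mul_assoc, h2,
      Nat.cast_succ, add_sub_cancel_right, add_smul, one_smul, neg_add, neg_mul, mul_assoc,
      add_comm]

variable (p : ℕ) [CharP k p]

theorem commute_shiftProd_d1_f (r s : ℕ) :
    Commute (coeff r (shiftProd k p (T 0 0))) (coeff s (fOf T)) := by
  rcases s with _ | i
  · rw [hT.coeff_zero_f]; exact Commute.zero_right _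
  have h := hT.f_comm_partialProd_d1 (k := k) i p
  rw [← Nat.cast_smul_eq_nsmul k, CharP.cast_eq_zero, zero_smul, sub_eq_zero] at h
  have := congrArg (coeff r) h
  rw [coeff_C_mul, coeff_mul_C] at this
  rw [shiftProd_eq]
  exact this.symm

theorem commute_shiftProd_d2_f (r s : ℕ) :
    Commute (coeff r (shiftProd k p (d2Of T))) (coeff s (fOf T)) := by
  rcases s with _ | i
  · rw [hT.coeff_zero_f]; exact Commute.zero_right _
  have h := hT.f_comm_partialProd_d2 (k := k) i p
  rw [← Nat.cast_smul_eq_nsmul k, CharP.cast_eq_zero, zero_smul, neg_zero, sub_eq_zero] at h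
  have := congrArg (coeff r) h
  rw [coeff_C_mul, coeff_mul_C] at this
  rw [shiftProd_eq]
  exact this.symm

end IsYangian
end ShiftProd
end RestrictedYangian

end

noncomputable section
namespace RestrictedYangian
open PowerSeries

/-! ### Nilpotency of the span of finitely many f's -/

section Nilpotent

variable {k A : Type*} [Field k] [Ring A] [Algebra k A]

/-- If `S = V + Φ` with `ΦV ≤ VS`, then nilpotency of `V` and `Φ` implies that of `S`. -/
theorem sup_pow_eq_bot {V Φ : Submodule k A} (h : Φ * V ≤ V * (V ⊔ Φ)) {m p : ℕ}
    (hp : Φ ^ (p + 1) = ⊥) (hV : V ^ m = ⊥) : (V ⊔ Φ) ^ (p + m) = ⊥ := by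
  set S := V ⊔ Φ with hS
  have hVS : V ≤ S := le_sup_left
  have h1 : S * V ≤ V * S := by
    conv_lhs => rw [hS]
    rw [Submodule.sup_mul]
    exact sup_le (mul_le_mul' le_rfl hVS) h
  have h2 : ∀ j, S ^ (j + 1) ≤ V * S ^ j ⊔ Φ ^ (j + 1) := by
    intro j
    induction j with
    | zero => simp [hS]
    | succ j ih =>
      rw [pow_succ' S (j + 1)]
      refine (mul_le_mul' le_rfl ih).trans ?_
      rw [Submodule.mul_sup, ← mul_assoc]
      refine sup_le ?_ ?_
      · refine le_sup_of_le_left ((mul_le_mul' h1 le_rfl).trans ?_)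
        rw [mul_assoc, ← pow_succ']
      · conv_lhs => rw [hS]
        rw [Submodule.sup_mul, ← pow_succ']
        exact sup_le_sup (mul_le_mul' le_rfl (pow_le_pow_left' le_sup_right _)) le_rfl
  have h3 : ∀ j, S ^ (p + j) ≤ V ^ j * S ^ p := by
    intro j
    induction j with
    | zero => simp
    | succ j ih =>
      rw [← add_assoc, pow_succ S (p + j)]
      refine (mul_le_mul' ih le_rfl).trans ?_
      rw [mul_assoc, ← pow_succ, pow_succ V, mul_assoc]
      refine mul_le_mul' le_rfl ((h2 p).trans ?_)
      rw [hp, sup_bot_eq]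
  rw [eq_bot_iff]
  refine (h3 m).trans ?_
  rw [hV, Submodule.bot_mul]

/-- The span of the first `n` members of a family. -/
def initSpan (k : Type*) [Field k] [Algebra k A] (φ : ℕ → A) (n : ℕ) : Submodule k A :=
  Submodule.span k (φ '' Set.Iio n)

/-- `initSpan` is closed under the straightening of products in a suitable order. -/
def Straightens (k : Type*) [Field k] [Algebra k A] (φ : ℕ → A) : Prop :=
  ∀ r n, r < n → φ n * φ r - φ r * φ n ∈ initSpan k φ n * initSpan k φ n

variable {φ : ℕ → A}

theorem mem_initSpan {i n : ℕ} (h : i < n) : φ i ∈ initSpan k φ n :=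
  Submodule.subset_span ⟨i, h, rfl⟩

theorem initSpan_mono {m n : ℕ} (h : m ≤ n) : initSpan k φ m ≤ initSpan k φ n :=
  Submodule.span_mono (Set.image_mono (Set.Iio_subset_Iio h))

theorem initSpan_succ (n : ℕ) :
    initSpan k φ (n + 1) = initSpan k φ n ⊔ Submodule.span k {φ n} := by
  rw [initSpan, initSpan, ← Submodule.span_union, ← Set.image_singleton, ← Set.image_union]
  congr 2
  ext i
  simp only [Set.mem_Iio, Set.mem_union, Set.mem_singleton_iff]
  omega

theorem initSpan_fg (n : ℕ) : (initSpan k φ n).FG :=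
  Submodule.fg_span ((Set.finite_Iio n).image φ)

section
variable {p : ℕ} (hp : 0 < p) (hφ : ∀ n, φ n ^ p = 0) (hs : Straightens k φ)
include hp hφ hs

/-- Adjoining one more element with vanishing p-th power raises the nilpotency exponent by p - 1;
straightening supplies the hypothesis of `sup_pow_eq_bot`. -/
theorem initSpan_pow (n : ℕ) : initSpan k φ n ^ (n * (p - 1) + 1) = ⊥ := by
  induction n with
  | zero => simp [initSpan]
  | succ n ih =>
    have := sup_pow_eq_bot (V := initSpan k φ n) (Φ := Submodule.span k {φ n}) (p := p - 1)
      ?_ ?_ ih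
    · rw [initSpan_succ, ← this]
      congr 1
      rw [add_mul, one_mul]; omega
    · rw [← initSpan_succ]
      conv_lhs => rw [initSpan]
      rw [Submodule.span_mul_span, Submodule.span_le]
      rintro _ ⟨_, rfl, _, ⟨r, hr, rfl⟩, rfl⟩
      have h1 : φ n * φ r = (φ n * φ r - φ r * φ n) + φ r * φ n := by abel
      change φ n * φ r ∈ _
      rw [h1]
      refine add_mem (mul_le_mul' le_rfl (initSpan_mono n.le_succ) (hs r n hr)) ?_
      exact Submodule.mul_mem_mul (mem_initSpan hr) (mem_initSpan n.lt_succ_self)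
    · rw [Nat.sub_add_cancel hp, Submodule.span_pow, Set.singleton_pow, hφ]
      simp

/-- The sum of the powers of `initSpan`. -/
def initAlg (k : Type*) [Field k] [Algebra k A] (φ : ℕ → A) (p n : ℕ) : Submodule k A :=
  ∑ i ∈ Finset.range (n * (p - 1) + 1), initSpan k φ n ^ i

omit hp hφ hs in
theorem pow_le_initAlg {n i : ℕ} (h : i < n * (p - 1) + 1) :
    initSpan k φ n ^ i ≤ initAlg k φ p n := by
  rw [initAlg, ← Finset.add_sum_erase _ _ (Finset.mem_range.2 h)]
  exact le_sup_left

omit hp hφ hs in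
theorem initAlg_le {n : ℕ} {U : Submodule k A}
    (h : ∀ i < n * (p - 1) + 1, initSpan k φ n ^ i ≤ U) : initAlg k φ p n ≤ U :=
  Finset.sum_induction _ (· ≤ U) (fun _ _ ha hb => sup_le ha hb) bot_le
    fun i hi => h i (Finset.mem_range.1 hi)

/-- The only power not already in the sum is V^{n(p-1)+1}, which is zero. -/
theorem initSpan_mul_initAlg (n : ℕ) : initSpan k φ n * initAlg k φ p n ≤ initAlg k φ p n := by
  conv_lhs => rw [initAlg]
  rw [Finset.mul_sum]
  refine Finset.sum_induction _ (· ≤ initAlg k φ p n) (fun _ _ ha hb => sup_le ha hb) bot_le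
    fun i hi => ?_
  rw [← pow_succ']
  rcases (Nat.succ_le_of_lt (Finset.mem_range.1 hi)).eq_or_lt with h | h
  · rw [← Nat.succ_eq_add_one, h, initSpan_pow hp hφ hs]; exact bot_le
  · exact pow_le_initAlg h

/-- The augmentation ideal of the subalgebra generated by the family. -/
def aug (k : Type*) [Field k] [Algebra k A] (φ : ℕ → A) (p : ℕ) : Submodule k A :=
  ⨆ n, initSpan k φ n * initAlg k φ p n

omit hp hφ hs in
theorem initSpan_mul_initAlg_mono :
    Monotone fun n => initSpan k φ n * initAlg k φ p n := fun m n h => by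
  refine mul_le_mul' (initSpan_mono h) (initAlg_le fun i hi => ?_)
  refine (pow_le_pow_left' (initSpan_mono h) i).trans (pow_le_initAlg ?_)
  have := Nat.mul_le_mul_right (p - 1) h
  omega

omit hp hφ hs in
theorem mem_aug {y : A} : y ∈ aug k φ p ↔ ∃ n, y ∈ initSpan k φ n * initAlg k φ p n := by
  exact Submodule.mem_iSup_of_directed _ initSpan_mul_initAlg_mono.directed_le

/-- The element lies in V·B, where V is nilpotent and B, a sum of powers of V, commutes with V; so
(VB)ᵐ = VᵐBᵐ. -/
theorem isNilpotent_of_mem_aug {y : A} (hy : y ∈ aug k φ p) : IsNilpotent y := by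
  obtain ⟨n, hy⟩ := mem_aug.1 hy
  refine ⟨n * (p - 1) + 1, ?_⟩
  have h1 := Submodule.pow_mem_pow _ hy (n * (p - 1) + 1)
  have hc : Commute (initSpan k φ n) (initAlg k φ p n) :=
    Commute.sum_right _ _ _ fun i _ => (Commute.refl _).pow_right i
  rw [hc.mul_pow, initSpan_pow hp hφ hs, Submodule.bot_mul] at h1
  exact h1

omit hp hφ hs in
theorem mem_aug_self (i : ℕ) : φ i ∈ aug k φ p := by
  refine mem_aug.2 ⟨i + 1, ?_⟩
  have h1 : (1 : A) ∈ initAlg k φ p (i + 1) :=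
    pow_le_initAlg (i := 0) (by omega) (by rw [pow_zero]; exact Submodule.one_le.1 le_rfl)
  simpa using Submodule.mul_mem_mul (mem_initSpan (k := k) (φ := φ) i.lt_succ_self) h1

theorem mul_mem_aug {y : A} (i : ℕ) (hy : y ∈ aug k φ p) : φ i * y ∈ aug k φ p := by
  obtain ⟨n, hy⟩ := mem_aug.1 hy
  refine mem_aug.2 ⟨max n (i + 1), ?_⟩
  have h1 := initSpan_mul_initAlg_mono (le_max_left n (i + 1)) hy
  have h2 := Submodule.mul_mem_mul (mem_initSpan (k := k) (φ := φ)
    (lt_of_lt_of_le i.lt_succ_self (le_max_right n (i + 1)))) h1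
  exact mul_le_mul' le_rfl (initSpan_mul_initAlg hp hφ hs _) h2

end

end Nilpotent

/-! ### Subspaces generated by the f's, and straightening -/

section Triangular

variable {k A : Type*} [Field k] [Ring A] [Algebra k A] {M : Type*} [AddCommGroup M] [Module k M]
  [Module A M] [IsScalarTower k A M]

/-- The subalgebra of elements that preserve a subspace. -/
def stab (A : Type*) [Ring A] [Algebra k A] [Module A M] [IsScalarTower k A M]
    (W : Submodule k M) : Subalgebra k A where
  carrier := {a | ∀ w ∈ W, a • w ∈ W}
  mul_mem' ha hb w hw := by rw [mul_smul]; exact ha _ (hb _ hw)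
  add_mem' ha hb w hw := by rw [add_smul]; exact add_mem (ha _ hw) (hb _ hw)
  algebraMap_mem' c w hw := by rw [algebraMap_smul]; exact W.smul_mem c hw

/-- All coefficients of a series lie in a subalgebra. -/
def CoeffsIn (S : Subalgebra k A) (g : A⟦X⟧) : Prop := ∀ n, coeff n g ∈ S

namespace CoeffsIn
variable {S : Subalgebra k A} {g h : A⟦X⟧}

theorem mul (hg : CoeffsIn S g) (hh : CoeffsIn S h) : CoeffsIn S (g * h) := fun n => by
  rw [coeff_mul]
  exact S.sum_mem fun x _ => S.mul_mem (hg _) (hh _)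

theorem add (hg : CoeffsIn S g) (hh : CoeffsIn S h) : CoeffsIn S (g + h) := fun n => by
  rw [map_add]; exact S.add_mem (hg n) (hh n)

theorem sub (hg : CoeffsIn S g) (hh : CoeffsIn S h) : CoeffsIn S (g - h) := fun n => by
  rw [map_sub]; exact S.sub_mem (hg n) (hh n)

theorem sc (s : k⟦X⟧) : CoeffsIn S (sc A s) := fun n => by
  rw [coeff_sc]; exact S.algebraMap_mem _

theorem invOfUnit (hg : CoeffsIn S g) : CoeffsIn S (PowerSeries.invOfUnit g 1) := fun n => by
  induction n using Nat.strong_induction_on with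
  | _ n ih =>
    rw [coeff_invOfUnit]
    split_ifs with hn
    · simp
    · rw [inv_one, Units.val_one, neg_one_mul]
      refine S.neg_mem (S.sum_mem fun x _ => ?_)
      split_ifs with hx
      · exact S.mul_mem (hg _) (ih _ hx)
      · exact S.zero_mem

end CoeffsIn

/-- The smallest subspace containing `W` and stable under a family of operators. -/
def opSpan (φ : ℕ → A) (W : Submodule k M) : Submodule k M :=
  sInf {U | W ≤ U ∧ ∀ i, ∀ x ∈ U, φ i • x ∈ U}

omit [Algebra k A] [IsScalarTower k A M] in
theorem le_opSpan (φ : ℕ → A) (W : Submodule k M) : W ≤ opSpan φ W := le_sInf fun _ h => h.1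

omit [Algebra k A] [IsScalarTower k A M] in
theorem smul_mem_opSpan (φ : ℕ → A) {W : Submodule k M} (i : ℕ) {x : M} (h : x ∈ opSpan φ W) :
    φ i • x ∈ opSpan φ W := by
  rw [opSpan, Submodule.mem_sInf] at h ⊢
  exact fun U hU => hU.2 i x (h U hU)

omit [Algebra k A] [IsScalarTower k A M] in
theorem opSpan_le {φ : ℕ → A} {W U : Submodule k M} (h : W ≤ U)
    (h' : ∀ i, ∀ x ∈ U, φ i • x ∈ U) : opSpan φ W ≤ U := sInf_le ⟨h, h'⟩

variable {T : Fin 2 → Fin 2 → A⟦X⟧}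

/-- The coefficients of `f(u)`, starting from `f⁽¹⁾`. -/
def fC (T : Fin 2 → Fin 2 → A⟦X⟧) (i : ℕ) : A := coeff (i + 1) (fOf T)

theorem coeff_tl_f (i n : ℕ) : coeff (n + 1) (tl i (fOf T)) = fC T (i + n) := by
  rw [coeff_tl_succ, fC]; congr 2; omega

/-- Elements mapping `x` into `U`, as a subspace of the `x`. -/
def preU (a : ℕ → A) (U : Submodule k M) : Submodule k M where
  carrier := {x | x ∈ U ∧ ∀ r, a r • x ∈ U}
  add_mem' hx hy := ⟨add_mem hx.1 hy.1, fun r => by rw [smul_add]; exact add_mem (hx.2 r) (hy.2 r)⟩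
  zero_mem' := ⟨zero_mem _, fun r => by rw [smul_zero]; exact zero_mem _⟩
  smul_mem' c x hx := ⟨U.smul_mem c hx.1, fun r => by
    rw [← algebraMap_smul A c x, ← mul_smul, ← Algebra.commutes, mul_smul, algebraMap_smul]
    exact U.smul_mem c (hx.2 r)⟩

/-- The vectors whose images under all coefficients of g stay in the span form a subspace stable
under the f's, because [fᵢ, g] is again a tail of f times g. -/
theorem opSpan_stable_of_comm {g : A⟦X⟧} (ε : ℤ) (h : ∀ i, PowerSeries.C (fC T i) * g -
      g * PowerSeries.C (fC T i) = ε • (tl i (fOf T) * g)) {W : Submodule k M}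
    (hW : CoeffsIn (stab A W) g) : CoeffsIn (stab A (opSpan (fC T) W)) g := by
  have key : opSpan (fC T) W ≤ preU (fun r => coeff r g) (opSpan (fC T) W) := by
    refine opSpan_le (fun w hw => ⟨le_opSpan _ _ hw, fun r => le_opSpan _ _ (hW r w hw)⟩) ?_
    rintro i x ⟨hx, hx'⟩
    refine ⟨smul_mem_opSpan _ i hx, fun r => ?_⟩
    have h1 := congrArg (coeff r) (h i)
    rw [map_sub, coeff_C_mul, coeff_mul_C, map_zsmul, sub_eq_iff_eq_add, ← sub_eq_iff_eq_add'] at h1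
    rw [← mul_smul, ← h1, sub_smul, mul_smul]
    refine sub_mem (smul_mem_opSpan _ i (hx' r)) ?_
    rw [smul_assoc]
    refine zsmul_mem ?_ ε
    rw [coeff_mul, Finset.sum_smul]
    refine sum_mem fun y _ => ?_
    rcases y.1 with _ | n
    · rw [coeff_tl_zero, zero_mul, zero_smul]; exact zero_mem _
    · rw [coeff_tl_f, mul_smul]; exact smul_mem_opSpan _ _ (hx' _)
  exact fun r x hx => (key hx).2 r

namespace IsYangian
variable (hT : IsYangian T)
include hT

theorem coeffsIn_f (W : Submodule k M) : CoeffsIn (stab A (opSpan (fC T) W)) (fOf T) := by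
  intro r
  rcases r with _ | r
  · rw [hT.coeff_zero_f]; exact Subalgebra.zero_mem _
  · exact fun x hx => smul_mem_opSpan _ r hx

/-- The triangular decomposition without PBW: d₁, d₂ and e can be moved past the f's at the cost of
terms in f and h only, so stability of W under them suffices. -/
theorem opSpan_stable {W : Submodule k M} (h1 : CoeffsIn (stab A W) (T 0 0))
    (h2 : CoeffsIn (stab A W) (d2Of T)) (he : CoeffsIn (stab A W) (eOf T)) (i j : Fin 2) :
    CoeffsIn (stab A (opSpan (fC T) W)) (T i j) := by
  have h1' : CoeffsIn (stab A (opSpan (fC T) W)) (T 0 0) :=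
    opSpan_stable_of_comm 1 (fun i => by rw [one_smul]; exact hT.f_comm_d1 i) h1
  have h2' : CoeffsIn (stab A (opSpan (fC T) W)) (d2Of T) :=
    opSpan_stable_of_comm (-1) (fun i => by rw [neg_smul, one_smul]; exact hT.f_comm_d2 i) h2
  have hf := hT.coeffsIn_f (k := k) W
  have hh : CoeffsIn (stab A (opSpan (fC T) W)) (hOf T) := h1'.invOfUnit.mul h2'
  have he' : CoeffsIn (stab A (opSpan (fC T) W)) (eOf T) := by
    have key : opSpan (fC T) W ≤ preU (fun r => coeff r (eOf T)) (opSpan (fC T) W) := by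
      refine opSpan_le (fun w hw => ⟨le_opSpan _ _ hw, fun r => le_opSpan _ _ (he r w hw)⟩) ?_
      rintro s x ⟨hx, hx'⟩
      refine ⟨smul_mem_opSpan _ s hx, fun r => ?_⟩
      rcases r with _ | r
      · beta_reduce
        rw [hT.coeff_zero_e, zero_smul]; exact zero_mem _
      · have h3 := hT.e_comm_f r s
        rw [sub_eq_iff_eq_add] at h3
        rw [fC, ← mul_smul, h3, add_smul, mul_smul, neg_smul]
        exact add_mem (neg_mem (hh _ _ hx)) (smul_mem_opSpan _ s (hx' _))
    exact fun r x hx => (key hx).2 r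
  have h01 : CoeffsIn (stab A (opSpan (fC T) W)) (T 0 1) := by
    rw [hT.t12_eq]; exact h1'.mul he'
  fin_cases i <;> fin_cases j
  · exact h1'
  · exact h01
  · change CoeffsIn _ (T 1 0)
    rw [hT.t21_eq]; exact hf.mul h1'
  · change CoeffsIn _ (T 1 1)
    rw [hT.t22_eq]; exact h2'.add (hf.mul h01)

/-- The bracket is a coefficient of the square of the tail starting at r, and only products of f's
with indices from r to n - 1 occur in it. -/
theorem straightens_f : Straightens k (fC T) := by
  intro r n hrn
  obtain ⟨m, rfl⟩ := Nat.exists_eq_add_of_lt hrn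
  have h := congrArg (coeff (m + 1 + 1)) (hT.f_comm_tl r)
  rw [map_sub, coeff_mul_C, coeff_C_mul, coeff_tl_f, coeff_mul] at h
  change fC T (r + (m + 1)) * fC T r - fC T r * fC T (r + (m + 1)) = _ at h
  rw [add_assoc, h]
  refine sum_mem fun x hx => ?_
  have hx := Finset.HasAntidiagonal.mem_antidiagonal.1 hx
  obtain ⟨a, b⟩ := x
  rcases a with _ | a
  · rw [coeff_tl_zero, zero_mul]; exact zero_mem _
  rcases b with _ | b
  · rw [coeff_tl_zero, mul_zero]; exact zero_mem _
  simp only at hx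
  rw [coeff_tl_f, coeff_tl_f]
  exact Submodule.mul_mem_mul (mem_initSpan (by omega)) (mem_initSpan (by omega))

end IsYangian

end Triangular
end RestrictedYangian

end

noncomputable section
namespace RestrictedYangian
open PowerSeries

/-! ### The presented Yangian, its restricted quotient and the RTT form -/

section Presentation

variable {k A : Type*} [Field k] [Ring A] [Algebra k A]

/-- The right-hand side of the RTT relation. -/
def exchangeSum (x y : ℕ → A) (r s : ℕ) : A :=
  ∑ a ∈ Finset.range (min r s), (x a * y (r + s - 1 - a) - x (r + s - 1 - a) * y a)

/-- The index r + s - 1 is the same in both sums, so they differ by at most one term. This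
telescoping links the closed RTT formula to the recursive form in `IsYangian`. -/
theorem exchangeSum_succ (x y : ℕ → A) (r s : ℕ) :
    exchangeSum x y (r + 1) s - exchangeSum x y r (s + 1) = x r * y s - x s * y r := by
  have e1 : r + 1 + s - 1 = r + s := by omega
  have e2 : r + (s + 1) - 1 = r + s := by omega
  rw [exchangeSum, exchangeSum, e1, e2]
  rcases lt_trichotomy r s with h | h | h
  · rw [min_eq_left (by omega), min_eq_left (by omega), Finset.sum_range_succ, Nat.add_sub_cancel_left]
    abel
  · subst h
    rw [min_eq_right (by omega), min_eq_left (by omega)]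
    simp
  · rw [min_eq_right (by omega), min_eq_right (by omega), Finset.sum_range_succ,
      Nat.add_sub_cancel]
    abel

theorem IsYangian.bracket {T : Fin 2 → Fin 2 → A⟦X⟧} (hT : IsYangian T) (i j m l : Fin 2)
    (r s : ℕ) : coeff r (T i j) * coeff s (T m l) - coeff s (T m l) * coeff r (T i j) =
      exchangeSum (fun a => coeff a (T m j)) (fun a => coeff a (T i l)) r s := by
  induction r generalizing s with
  | zero =>
    rw [hT.const, exchangeSum, Nat.zero_min, Finset.sum_range_zero]
    split_ifs <;> simp
  | succ r ih =>
    have h1 := hT.rel i j m l r s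
    have h2 := exchangeSum_succ (fun a => coeff a (T m j)) (fun a => coeff a (T i l)) r s
    rw [ih (s + 1), ← h2, sub_left_inj] at h1
    exact h1

theorem isYangian_of_bracket {T : Fin 2 → Fin 2 → A⟦X⟧}
    (hc : ∀ i j, coeff 0 (T i j) = if i = j then 1 else 0)
    (h : ∀ i j m l r s, 0 < r → 0 < s →
      coeff r (T i j) * coeff s (T m l) - coeff s (T m l) * coeff r (T i j) =
        exchangeSum (fun a => coeff a (T m j)) (fun a => coeff a (T i l)) r s) :
    IsYangian T where
  const := hc
  rel i j m l r s := by
    have h' : ∀ r s, coeff r (T i j) * coeff s (T m l) - coeff s (T m l) * coeff r (T i j) =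
        exchangeSum (fun a => coeff a (T m j)) (fun a => coeff a (T i l)) r s := by
      intro r s
      rcases r.eq_zero_or_pos with rfl | hr
      · rw [hc, exchangeSum, Nat.zero_min, Finset.sum_range_zero]
        split_ifs <;> simp
      rcases s.eq_zero_or_pos with rfl | hs
      · rw [hc m l, exchangeSum, Nat.min_zero, Finset.sum_range_zero]
        split_ifs <;> simp
      exact h i j m l r s hr hs
    rw [h', h', exchangeSum_succ]

/-- The projection from the free algebra to the Yangian. -/
def mkY2 (k : Type*) [Field k] : FreeAlgebra k (Fin 2 × Fin 2 × ℕ) →ₐ[k] Y2 k :=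
  RingQuot.mkAlgHom k (RTTRel k)

theorem coeff_t (i j : Fin 2) (r : ℕ) : coeff r (t k i j) = mkY2 k (tFree k i j r) := coeff_mk _ _

theorem mkY2_rel {x y : FreeAlgebra k (Fin 2 × Fin 2 × ℕ)} (h : RTTRel k x y) :
    mkY2 k x = mkY2 k y := RingQuot.mkAlgHom_rel k h

theorem isYangian_t (k : Type*) [Field k] : IsYangian (t k) := by
  refine isYangian_of_bracket (fun i j => ?_) fun i j m l r s hr hs => ?_
  · rw [coeff_t, tFree]
    split_ifs <;> simp
  · have := mkY2_rel (RTTRel.comm (k := k) i j m l r s hr hs)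
    simp only [map_sub, map_mul, map_sum] at this
    simp only [coeff_t, exchangeSum]
    exact this

theorem IsYangian.map {B : Type*} [Ring B] {T : Fin 2 → Fin 2 → A⟦X⟧}
    (hT : IsYangian T) (φ : A →+* B) : IsYangian fun i j => PowerSeries.map φ (T i j) where
  const i j := by
    rw [coeff_map, hT.const]; split_ifs <;> simp
  rel i j m l r s := by
    simpa only [coeff_map, map_sub, map_mul] using congrArg φ (hT.rel i j m l r s)

section Map

variable {B : Type*} [Ring B] {T : Fin 2 → Fin 2 → A⟦X⟧} (hT : IsYangian T) (φ : A →+* B)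
include hT

theorem IsYangian.d1Inv_map :
    d1InvOf (fun i j => PowerSeries.map φ (T i j)) = PowerSeries.map φ (d1InvOf T) := by
  refine left_inv_eq_right_inv (hT.map φ).inv_mul_d1 ?_
  rw [← map_mul, hT.d1_mul_inv, map_one]

theorem IsYangian.e_map :
    eOf (fun i j => PowerSeries.map φ (T i j)) = PowerSeries.map φ (eOf T) := by
  rw [eOf, hT.d1Inv_map, eOf, map_mul]

theorem IsYangian.f_map :
    fOf (fun i j => PowerSeries.map φ (T i j)) = PowerSeries.map φ (fOf T) := by
  rw [fOf, hT.d1Inv_map, fOf, map_mul]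

theorem IsYangian.d2_map :
    d2Of (fun i j => PowerSeries.map φ (T i j)) = PowerSeries.map φ (d2Of T) := by
  rw [d2Of, hT.e_map, hT.f_map, d2Of, map_sub, map_mul, map_mul]

end Map

theorem exists_algHom {T : Fin 2 → Fin 2 → A⟦X⟧} (hT : IsYangian T) :
    ∃ φ : Y2 k →ₐ[k] A, ∀ i j, PowerSeries.map (φ : Y2 k →+* A) (t k i j) = T i j := by
  set F : FreeAlgebra k (Fin 2 × Fin 2 × ℕ) →ₐ[k] A :=
    FreeAlgebra.lift k fun x => coeff (x.2.2 + 1) (T x.1 x.2.1) with hF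
  have h1 : ∀ i j r, F (tFree k i j r) = coeff r (T i j) := by
    intro i j r
    rcases r with _ | r
    · rw [hT.const, tFree]; split_ifs <;> simp
    · rw [tFree, hF, FreeAlgebra.lift_ι_apply]
  refine ⟨RingQuot.liftAlgHom k ⟨F, ?_⟩, fun i j => ?_⟩
  · rintro _ _ ⟨i, j, m, l, r, s, -, -⟩
    simp only [map_sub, map_mul, map_sum, h1]
    exact hT.bracket i j m l r s
  · ext r
    rw [coeff_map, coeff_t, ← h1]
    exact RingQuot.liftAlgHom_mkAlgHom_apply k F _ _

theorem adjoin_t (k : Type*) [Field k] :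
    Algebra.adjoin k {x | ∃ i j r, x = coeff r (t k i j)} = ⊤ := by
  rw [eq_top_iff]
  rintro x -
  obtain ⟨y, rfl⟩ := RingQuot.mkAlgHom_surjective k (RTTRel k) x
  induction y using FreeAlgebra.induction with
  | grade0 c =>
    rw [AlgHom.commutes]; exact Subalgebra.algebraMap_mem _ _
  | grade1 z =>
    obtain ⟨i, j, r⟩ := z
    exact Algebra.subset_adjoin ⟨i, j, r + 1, (coeff_t i j (r + 1)).symm⟩
  | mul a b ha hb => rw [map_mul]; exact Subalgebra.mul_mem _ ha hb
  | add a b ha hb => rw [map_add]; exact Subalgebra.add_mem _ ha hb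

variable (k) (p : ℕ)

/-- The images of the `tᵢⱼ(u)` over the restricted Yangian. -/
def tp (i j : Fin 2) : (Y2p k p)⟦X⟧ := PowerSeries.map (proj k p : Y2 k →+* Y2p k p) (t k i j)

theorem isYangian_tp : IsYangian (tp k p) := (isYangian_t k).map _

theorem proj_surjective : Function.Surjective (proj k p) := RingQuot.mkAlgHom_surjective _ _

theorem adjoin_tp : Algebra.adjoin k {x | ∃ i j r, x = coeff r (tp k p i j)} = ⊤ := by
  rw [eq_top_iff]
  rintro x -
  obtain ⟨y, rfl⟩ := proj_surjective k p x
  have hy : y ∈ Algebra.adjoin k {x | ∃ i j r, x = coeff r (t k i j)} := by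
    rw [adjoin_t]; trivial
  have : proj k p y ∈ (Algebra.adjoin k {x | ∃ i j r, x = coeff r (t k i j)}).map (proj k p) :=
    Subalgebra.mem_map.2 ⟨y, hy, rfl⟩
  rw [AlgHom.map_adjoin] at this
  refine Algebra.adjoin_mono ?_ this
  rintro _ ⟨_, ⟨i, j, r, rfl⟩, rfl⟩
  exact ⟨i, j, r, by rw [tp, coeff_map]; rfl⟩

theorem e_tp : eOf (tp k p) = PowerSeries.map (proj k p : Y2 k →+* Y2p k p) (e k) :=
  (isYangian_t k).e_map _
theorem f_tp : fOf (tp k p) = PowerSeries.map (proj k p : Y2 k →+* Y2p k p) (f k) :=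
  (isYangian_t k).f_map _
theorem d2_tp : d2Of (tp k p) = PowerSeries.map (proj k p : Y2 k →+* Y2p k p) (d k 1) :=
  (isYangian_t k).d2_map _

theorem proj_eq_zero {x : Y2 k} (h : IsPCenterGen k p x) : proj k p x = 0 := by
  have := RingQuot.mkAlgHom_rel k (s := fun x y : Y2 k => IsPCenterGen k p x ∧ y = 0) ⟨h, rfl⟩
  rw [map_zero] at this
  exact this

theorem fC_tp_pow (i : ℕ) : fC (tp k p) i ^ p = 0 := by
  rw [fC, f_tp, coeff_map, ← map_pow]
  exact proj_eq_zero k p (IsPCenterGen.f (i + 1) i.succ_pos)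

end Presentation
end RestrictedYangian

end

noncomputable section
namespace RestrictedYangian
open PowerSeries

/-! ### Highest weight vectors and truncated weights -/

section HighestWeight

variable {k A : Type*} [Field k] [Ring A] [Algebra k A] {M : Type*} [AddCommGroup M] [Module k M]
  [Module A M] [IsScalarTower k A M]

/-- The coefficients of `g(u)` act on `v` by the coefficients of the scalar series `μ(u)`. -/
def Acts (g : A⟦X⟧) (μ : k⟦X⟧) (v : M) : Prop := ∀ r, coeff r g • v = coeff r μ • v

theorem smul_smul_right (a : A) (c : k) (v : M) : a • c • v = c • a • v := by
  rw [← algebraMap_smul A c v, ← mul_smul, ← Algebra.commutes, mul_smul, algebraMap_smul]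

namespace Acts
variable {g h : A⟦X⟧} {μ ν : k⟦X⟧} {v : M}

theorem mul (hg : Acts g μ v) (hh : Acts h ν v) : Acts (g * h) (μ * ν) v := fun r => by
  rw [coeff_mul, coeff_mul, Finset.sum_smul, Finset.sum_smul]
  refine Finset.sum_congr rfl fun x _ => ?_
  rw [mul_smul, hh, smul_smul_right, hg, smul_smul, mul_comm]

omit [Algebra k A] [IsScalarTower k A M] in
theorem sub (hg : Acts g μ v) (hh : Acts h ν v) : Acts (g - h) (μ - ν) v := fun r => by
  rw [map_sub, map_sub, sub_smul, sub_smul, hg, hh]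

theorem sc (s : k⟦X⟧) (v : M) : Acts (sc A s) s v := fun r => by
  rw [coeff_sc, algebraMap_smul]

omit [Algebra k A] [IsScalarTower k A M] in
theorem mul_zero (hh : Acts h (0 : k⟦X⟧) v) (g : A⟦X⟧) : Acts (g * h) (0 : k⟦X⟧) v := fun r => by
  rw [coeff_mul, Finset.sum_smul, map_zero, zero_smul]
  refine Finset.sum_eq_zero fun x _ => ?_
  rw [mul_smul, hh, map_zero, zero_smul, smul_zero]

theorem coeffsIn_stab (hg : Acts g μ v) : CoeffsIn (stab A (Submodule.span k {v})) g := by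
  intro r w hw
  obtain ⟨c, rfl⟩ := Submodule.mem_span_singleton.1 hw
  rw [smul_smul_right, hg, smul_smul]
  exact Submodule.smul_mem _ _ (Submodule.mem_span_singleton_self v)

end Acts

variable {T : Fin 2 → Fin 2 → A⟦X⟧}

/-- The evaluation `a ↦ a v`. -/
def evalAt (k : Type*) [Field k] [Algebra k A] [Module k M] [IsScalarTower k A M] (v : M) :
    A →ₗ[k] M := (LinearMap.toSpanSingleton A M v).restrictScalars k

theorem evalAt_apply (v : M) (a : A) : evalAt k v a = a • v := rfl

section Augmentation

variable {p : ℕ} {φ : ℕ → A} (hp : 0 < p) (hf : ∀ i, φ i ^ p = 0) (hs : Straightens k φ)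
include hp hf hs

/-- If v = yv with y nilpotent, then v = yⁿv = 0. -/
theorem eq_zero_of_mem_aug {v : M} (h : v ∈ (aug k φ p).map (evalAt k v)) : v = 0 := by
  obtain ⟨y, hy, hv⟩ := h
  obtain ⟨n, hn⟩ := isNilpotent_of_mem_aug hp hf hs hy
  have hv' : y • v = v := hv
  have h1 : ∀ m, y ^ m • v = v := by
    intro m
    induction m with
    | zero => simp
    | succ m ih => rw [pow_succ, mul_smul, hv', ih]
  rw [← h1 n, hn, zero_smul]

theorem opSpan_le_aug {v : M} {W : Submodule k M} (h : W ≤ (aug k φ p).map (evalAt k v)) :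
    opSpan φ W ≤ (aug k φ p).map (evalAt k v) := by
  refine opSpan_le h ?_
  rintro i _ ⟨y, hy, rfl⟩
  exact ⟨φ i * y, mul_mem_aug hp hf hs i hy, by rw [evalAt_apply, evalAt_apply, mul_smul]⟩

theorem exists_of_mem_opSpan {v x : M} (h : x ∈ opSpan φ (Submodule.span k {v})) :
    ∃ c : k, ∃ y ∈ aug k φ p, x = c • v + y • v := by
  have h1 : opSpan φ (Submodule.span k {v}) ≤
      Submodule.span k {v} ⊔ (aug k φ p).map (evalAt k v) := by
    refine opSpan_le le_sup_left fun i x hx => ?_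
    obtain ⟨w, hw, z, ⟨y, hy, rfl⟩, rfl⟩ := Submodule.mem_sup.1 hx
    obtain ⟨c, rfl⟩ := Submodule.mem_span_singleton.1 hw
    refine Submodule.mem_sup_right ⟨c • φ i + φ i * y, ?_, ?_⟩
    · exact add_mem (Submodule.smul_mem _ _ (mem_aug_self i)) (mul_mem_aug hp hf hs i hy)
    · simp only [evalAt_apply, smul_add, add_smul, mul_smul, smul_smul_right, smul_assoc]
  obtain ⟨w, hw, z, ⟨y, hy, rfl⟩, rfl⟩ := Submodule.mem_sup.1 (h1 h)
  obtain ⟨c, rfl⟩ := Submodule.mem_span_singleton.1 hw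
  exact ⟨c, y, hy, rfl⟩

end Augmentation

/-- A subspace preserved by all coefficients of `T`. -/
def Invariant (T : Fin 2 → Fin 2 → A⟦X⟧) (U : Submodule k M) : Prop :=
  ∀ i j, CoeffsIn (stab A U) (T i j)

/-- A highest weight vector generating the module. -/
structure IsHighestWeight (T : Fin 2 → Fin 2 → A⟦X⟧) (v : M) (μ : Fin 2 → k⟦X⟧) : Prop where
  d1 : Acts (T 0 0) (μ 0) v
  d2 : Acts (d2Of T) (μ 1) v
  e : Acts (eOf T) (0 : k⟦X⟧) v
  cyclic : ∀ U : Submodule k M, v ∈ U → Invariant T U → U = ⊤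

namespace IsYangian
variable (hT : IsYangian T)
include hT

theorem opSpan_eq_top {v : M} {μ : Fin 2 → k⟦X⟧} (hv : IsHighestWeight T v μ) :
    opSpan (fC T) (Submodule.span k {v}) = ⊤ :=
  hv.cyclic _ (le_opSpan _ _ (Submodule.mem_span_singleton_self v))
    (hT.opSpan_stable hv.d1.coeffsIn_stab hv.d2.coeffsIn_stab hv.e.coeffsIn_stab)

theorem t12_acts {v : M} {μ : Fin 2 → k⟦X⟧} (hv : IsHighestWeight T v μ) :
    Acts (T 0 1) (0 : k⟦X⟧) v := by
  rw [hT.t12_eq]; exact hv.e.mul_zero _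

theorem t22_acts {v : M} {μ : Fin 2 → k⟦X⟧} (hv : IsHighestWeight T v μ) :
    Acts (T 1 1) (μ 1) v := by
  have h := hv.d2.sub ((hT.t12_acts hv).mul_zero (-fOf T))
  rw [sub_zero, neg_mul, sub_neg_eq_add, ← hT.t22_eq] at h
  exact h

section Truncated

variable {p : ℕ} (hp : 0 < p) (hf : ∀ i, fC T i ^ p = 0) {v : M} {μ : Fin 2 → k⟦X⟧}
  (hv : IsHighestWeight T v μ) {n : ℕ} (hμ : ∀ i, ∀ r > n, coeff r (μ i) = 0)
include hp hf hv hμ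

/-- If the weight is truncated at `n`, then so is the action of `t₂₁(u)` on the highest weight
vector of a simple module. -/
theorem t21_truncated (hsimple : ∀ U : Submodule k M, Invariant T U → U = ⊥ ∨ U = ⊤)
    (h0 : v ≠ 0) (r : ℕ) (hr : n < r) : coeff r (T 1 0) • v = 0 := by
  have h00 : ∀ r > n, coeff r (T 0 0) • v = 0 := fun r hr => by
    rw [hv.d1, hμ 0 r hr, zero_smul]
  have h11 : ∀ r > n, coeff r (T 1 1) • v = 0 := fun r hr => by
    rw [hT.t22_acts hv, hμ 1 r hr, zero_smul]
  have h01 : ∀ r, coeff r (T 0 1) • v = 0 := fun r => by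
    rw [hT.t12_acts hv, map_zero, zero_smul]
  -- W is killed by t₁₂ and stable under t₁₁ and t₂₂, so applying the f's to it gives an invariant
  -- subspace. It lies in (augmentation)·v, hence is not everything when v ≠ 0, and simplicity makes
  -- it zero.
  set W : Submodule k M := Submodule.span k {x | ∃ r > n, x = coeff r (T 1 0) • v} with hW
  have hmem : ∀ r > n, coeff r (T 1 0) • v ∈ W := fun r hr => Submodule.subset_span ⟨r, hr, rfl⟩
  have hstab : ∀ a : A, (∀ r > n, a • coeff r (T 1 0) • v ∈ W) → a ∈ stab A W := by
    intro a ha w hw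
    induction hw using Submodule.span_induction with
    | mem x hx => obtain ⟨r, hr, rfl⟩ := hx; exact ha r hr
    | zero => rw [smul_zero]; exact zero_mem _
    | add x y _ _ hx hy => rw [smul_add]; exact add_mem hx hy
    | smul c x _ hx => rw [smul_smul_right]; exact W.smul_mem c hx
  have hT01 : ∀ s, ∀ w ∈ W, coeff s (T 0 1) • w = 0 := by
    intro s w hw
    induction hw using Submodule.span_induction with
    | mem x hx =>
      obtain ⟨r, hr, rfl⟩ := hx
      have h1 := hT.bracket 0 1 1 0 s r
      rw [sub_eq_iff_eq_add] at h1
      rw [← mul_smul, h1, add_smul, mul_smul, h01, smul_zero, add_zero, exchangeSum,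
        Finset.sum_smul]
      refine Finset.sum_eq_zero fun a ha => ?_
      have ha := Finset.mem_range.1 ha
      -- Since a < s, the index s + r - 1 - a is at least r > n: both products contain a coefficient
      -- that kills v.
      have ha' := min_le_left s r
      rw [sub_smul, mul_smul, mul_smul, h00 _ (by omega), hv.d1, smul_smul_right,
        h11 _ (by omega), smul_zero, smul_zero, sub_zero]
    | zero => rw [smul_zero]
    | add x y _ _ hx hy => rw [smul_add, hx, hy, add_zero]
    | smul c x _ hx => rw [smul_smul_right, hx, smul_zero]
  have s00 : CoeffsIn (stab A W) (T 0 0) := by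
    intro s
    refine hstab _ fun r hr => ?_
    have h1 := hT.bracket 0 0 1 0 s r
    rw [sub_eq_iff_eq_add] at h1
    rw [← mul_smul, h1, add_smul, mul_smul, hv.d1, smul_smul_right]
    refine add_mem ?_ (W.smul_mem _ (hmem r hr))
    rw [exchangeSum, Finset.sum_smul]
    refine sum_mem fun a ha => ?_
    have ha := Finset.mem_range.1 ha
    have ha' := min_le_left s r
    rw [sub_smul, mul_smul, mul_smul, h00 _ (by omega), hv.d1, smul_smul_right, smul_zero, zero_sub]
    exact neg_mem (W.smul_mem _ (hmem _ (by omega)))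
  have s11 : CoeffsIn (stab A W) (T 1 1) := by
    intro s
    refine hstab _ fun r hr => ?_
    have h1 := hT.bracket 1 0 1 1 r s
    rw [sub_eq_iff_eq_add, ← sub_eq_iff_eq_add'] at h1
    rw [← mul_smul, ← h1, sub_smul, mul_smul, hT.t22_acts hv, smul_smul_right]
    refine sub_mem (W.smul_mem _ (hmem r hr)) ?_
    rw [exchangeSum, Finset.sum_smul]
    refine sum_mem fun a ha => ?_
    have ha := Finset.mem_range.1 ha
    have ha' := min_le_right r s
    rw [sub_smul, mul_smul, mul_smul, h11 _ (by omega), hT.t22_acts hv, smul_smul_right, smul_zero,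
      zero_sub]
    exact neg_mem (W.smul_mem _ (hmem _ (by omega)))
  have hmz : ∀ (g h : A⟦X⟧), (∀ r, ∀ w ∈ W, coeff r h • w = 0) → ∀ r, ∀ w ∈ W,
      coeff r (g * h) • w = 0 := fun g h hh r w hw => by
    rw [coeff_mul, Finset.sum_smul]
    exact Finset.sum_eq_zero fun x _ => by rw [mul_smul, hh _ w hw, smul_zero]
  have he : ∀ r, ∀ w ∈ W, coeff r (eOf T) • w = 0 := hmz (d1InvOf T) (T 0 1) hT01
  have sE : CoeffsIn (stab A W) (eOf T) := fun r w hw => by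
    rw [he r w hw]; exact zero_mem _
  have s2 : CoeffsIn (stab A W) (d2Of T) := fun r w hw => by
    rw [d2Of, map_sub, sub_smul, hmz _ _ he r w hw, sub_zero]
    exact s11 r w hw
  have hWaug : W ≤ (aug k (fC T) p).map (evalAt k v) := by
    refine Submodule.span_le.2 ?_
    rintro _ ⟨r, hr, rfl⟩
    rw [hT.t21_eq, coeff_mul, Finset.sum_smul]
    refine sum_mem fun x _ => ?_
    obtain ⟨a, b⟩ := x
    rw [mul_smul, hv.d1, smul_smul_right]
    refine Submodule.smul_mem _ _ ?_
    rcases a with _ | a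
    · rw [hT.coeff_zero_f, zero_smul]; exact zero_mem _
    · exact ⟨fC T a, mem_aug_self a, rfl⟩
  rcases hsimple _ (hT.opSpan_stable s00 s2 sE) with h | h
  · have := le_opSpan (fC T) W (hmem r hr)
    rw [h] at this
    exact this
  · refine absurd (eq_zero_of_mem_aug hp hf hT.straightens_f (v := v) (k := k) ?_) h0
    exact opSpan_le_aug hp hf hT.straightens_f hWaug (by rw [h]; trivial)

/-- The vectors killed by all coefficients beyond n form an invariant subspace containing v.
Commuting t⁽ʳ⁾ past t⁽ˢ⁾ gives terms with an index r + s - 1 - a ≥ r and one index a < s, so strong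
induction on s applies. -/
theorem truncated (hsimple : ∀ U : Submodule k M, Invariant T U → U = ⊥ ∨ U = ⊤)
    (h0 : v ≠ 0) (i j : Fin 2) (r : ℕ) (hr : n < r) (x : M) : coeff r (T i j) • x = 0 := by
  let K : Submodule k M :=
    { carrier := {x | ∀ i j, ∀ r > n, coeff r (T i j) • x = 0}
      add_mem' := fun hx hy i j r hr => by rw [smul_add, hx i j r hr, hy i j r hr, add_zero]
      zero_mem' := fun i j r hr => smul_zero _
      smul_mem' := fun c x hx i j r hr => by rw [smul_smul_right, hx i j r hr, smul_zero] }
  have hv' : v ∈ K := by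
    intro i j r hr
    fin_cases i <;> fin_cases j
    · exact (hv.d1 r).trans (by rw [hμ 0 r hr, zero_smul])
    · exact (hT.t12_acts hv r).trans (by rw [map_zero, zero_smul])
    · exact hT.t21_truncated hp hf hv hμ hsimple h0 r hr
    · exact (hT.t22_acts hv r).trans (by rw [hμ 1 r hr, zero_smul])
  have hK : ∀ s, ∀ m l, ∀ x ∈ K, coeff s (T m l) • x ∈ K := by
    intro s
    induction s using Nat.strong_induction_on with
    | _ s ih =>
      intro m l x hx i j r hr
      have h1 := hT.bracket i j m l r s
      rw [sub_eq_iff_eq_add] at h1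
      rw [← mul_smul, h1, add_smul, mul_smul, hx i j r hr, smul_zero, add_zero, exchangeSum,
        Finset.sum_smul]
      refine Finset.sum_eq_zero fun a ha => ?_
      have ha := Finset.mem_range.1 ha
      have ha' := min_le_right r s
      rw [sub_smul, mul_smul, mul_smul, hx i l _ (by omega),
        ih a (by omega) i l x hx m j _ (by omega), smul_zero, sub_zero]
  have htop := hv.cyclic K hv' fun i j r x hx => hK r i j x hx
  have : x ∈ K := by rw [htop]; trivial
  exact this i j r hr

/-- Let V be the span of f⁽¹⁾, …, f⁽ⁿ⁾. Vanishing of t₂₁ beyond n lets every f act on Vᴺv as V does,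
so the finitely many nonzero powers of V applied to v already exhaust the module. -/
theorem finite_of_truncated (hsimple : ∀ U : Submodule k M, Invariant T U → U = ⊥ ∨ U = ⊤) :
    Module.Finite k M := by
  by_cases h0 : v = 0
  · have : (⊥ : Submodule k M) = ⊤ := hv.cyclic ⊥ h0 fun i j r x hx => by
      rw [(Submodule.mem_bot k).1 hx, smul_zero]; exact zero_mem _
    exact ⟨this ▸ Submodule.fg_bot⟩
  have htr := hT.truncated hp hf hv hμ hsimple h0
  set V := initSpan k (fC T) n with hV
  have hQ : ∀ N, (∀ r, ∀ w ∈ V ^ N, coeff r (T 0 0) • w • v ∈ (V ^ N).map (evalAt k v)) →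
      ∀ m, ∀ x ∈ (V ^ N).map (evalAt k v), fC T m • x ∈ (V ^ (N + 1)).map (evalAt k v) := by
    intro N hP m
    induction m using Nat.strong_induction_on with
    | _ m ih =>
      rintro x ⟨w, hw, rfl⟩
      rcases lt_or_ge m n with hm | hm
      · exact ⟨fC T m * w, by
          rw [pow_succ']; exact Submodule.mul_mem_mul (mem_initSpan hm) hw, by
          rw [evalAt_apply, evalAt_apply, mul_smul]⟩
      · have h1 := htr 1 0 (m + 1) (by omega) (w • v)
        rw [hT.t21_eq, coeff_mul, Finset.sum_smul, Finset.Nat.sum_antidiagonal_succ'] at h1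
        dsimp only at h1
        rw [hT.const, if_pos rfl, mul_one] at h1
        rw [evalAt_apply, fC, eq_neg_of_add_eq_zero_left h1]
        refine neg_mem (sum_mem fun y hy => ?_)
        have hy := Finset.HasAntidiagonal.mem_antidiagonal.1 hy
        obtain ⟨a, b⟩ := y
        rw [mul_smul]
        rcases a with _ | a
        · rw [hT.coeff_zero_f, zero_smul]; exact zero_mem _
        · exact ih a (by dsimp only at hy; omega) _ (hP _ w hw)
  -- Moving t₁₁ past one f produces terms f_j·t₁₁ with j possibly at least n; these return to Vᴺ⁺¹v
  -- by `hQ` at level N.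
  have hP : ∀ N, ∀ r, ∀ w ∈ V ^ N, coeff r (T 0 0) • w • v ∈ (V ^ N).map (evalAt k v) := by
    intro N
    induction N with
    | zero =>
      intro r w hw
      rw [pow_zero] at hw ⊢
      obtain ⟨c, rfl⟩ := Submodule.mem_one.1 hw
      refine ⟨algebraMap k A (coeff r (μ 0) * c), Submodule.mem_one.2 ⟨_, rfl⟩, ?_⟩
      rw [evalAt_apply, algebraMap_smul, algebraMap_smul, smul_smul_right, hv.d1, smul_smul,
        mul_comm]
    | succ N ih =>
      intro r w hw
      rw [pow_succ'] at hw
      induction hw using Submodule.mul_induction_on' with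
      | add x _ y _ hx hy => rw [add_smul, smul_add]; exact add_mem hx hy
      | mem_mul_mem a ha b hb =>
        induction ha using Submodule.span_induction with
        | zero => rw [zero_mul, zero_smul, smul_zero]; exact zero_mem _
        | add x y _ _ hx hy => rw [add_mul, add_smul, smul_add]; exact add_mem hx hy
        | smul c x _ hx =>
          rw [smul_mul_assoc, smul_assoc, smul_smul_right]; exact Submodule.smul_mem _ c hx
        | mem x hx =>
          obtain ⟨i, hi, rfl⟩ := hx
          have h1 := congrArg (coeff r) (hT.f_comm_d1 i)
          rw [map_sub, coeff_C_mul, coeff_mul_C, sub_eq_iff_eq_add, ← sub_eq_iff_eq_add'] at h1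
          change coeff r (T 0 0) • (fC T i * b) • v ∈ _
          rw [mul_smul, ← mul_smul, fC, ← h1, sub_smul, mul_smul]
          refine sub_mem (hQ N ih i _ (ih r b hb)) ?_
          rw [coeff_mul, Finset.sum_smul]
          refine sum_mem fun y _ => ?_
          rcases y.1 with _ | a
          · rw [coeff_tl_zero, zero_mul, zero_smul]; exact zero_mem _
          · rw [coeff_tl_f, mul_smul]
            exact hQ N ih _ _ (ih _ b hb)
  have htop : (initAlg k (fC T) p n).map (evalAt k v) = ⊤ := by
    rw [eq_top_iff, ← hT.opSpan_eq_top hv]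
    refine opSpan_le ?_ ?_
    · rw [Submodule.span_le, Set.singleton_subset_iff]
      exact ⟨1, pow_le_initAlg (i := 0) (by omega)
        (by rw [pow_zero]; exact Submodule.one_le.1 le_rfl), one_smul _ _⟩
    · rintro m _ ⟨w, hw, rfl⟩
      have hle : initAlg k (fC T) p n ≤ ((initAlg k (fC T) p n).map (evalAt k v)).comap
          (evalAt k v ∘ₗ LinearMap.mulLeft k (fC T m)) := by
        refine initAlg_le fun N hN w hw => ?_
        have h1 := hQ N (hP N) m _ ⟨w, hw, rfl⟩
        rw [Submodule.mem_comap, LinearMap.comp_apply, LinearMap.mulLeft_apply, evalAt_apply,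
          mul_smul]
        -- For the top power of V the image lies in a zero power times v.
        rcases (Nat.succ_le_of_lt hN).eq_or_lt with h | h
        · rw [← Nat.succ_eq_add_one, h, initSpan_pow hp hf hT.straightens_f, Submodule.map_bot] at h1
          rw [evalAt_apply] at h1
          rw [(Submodule.mem_bot k).1 h1]; exact zero_mem _
        · exact Submodule.map_mono (pow_le_initAlg h) h1
      have := hle hw
      rw [Submodule.mem_comap, LinearMap.comp_apply, LinearMap.mulLeft_apply, evalAt_apply,
          mul_smul] at this
      exact this
  refine ⟨htop ▸ Submodule.FG.map _ ?_⟩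
  exact Finset.sum_induction _ Submodule.FG (fun _ _ ha hb => ha.sup hb) Submodule.fg_bot
    fun i _ => (initSpan_fg n).pow i

end Truncated
end IsYangian
end HighestWeight
end RestrictedYangian

end

noncomputable section
namespace RestrictedYangian
open PowerSeries

/-! ### Multiplying T(u) by a scalar series -/

section Twist

theorem coeff_zero_mul' {R : Type*} [Semiring R] (g h : R⟦X⟧) :
    coeff 0 (g * h) = coeff 0 g * coeff 0 h := by
  simp [coeff_mul]

variable {k A : Type*} [Field k] [Ring A] [Algebra k A]

/-- The matrix `s(u) T(u)` for a scalar series `s(u)`. -/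
def twist (s : k⟦X⟧) (T : Fin 2 → Fin 2 → A⟦X⟧) (i j : Fin 2) : A⟦X⟧ := sc A s * T i j

theorem inU_sc_comm (s : k⟦X⟧) (G : A⟦X⟧⟦X⟧) : inU (sc A s) * G = G * inU (sc A s) := by
  ext1 n
  rw [inU, coeff_C_mul, coeff_mul_C, sc_comm]

theorem inV_sc_comm (s : k⟦X⟧) (G : A⟦X⟧⟦X⟧) : inV (sc A s) * G = G * inV (sc A s) := by
  have h : inV (sc A s) = sc A⟦X⟧ s := by
    rw [inV, sc, sc]
    ext1 n
    rw [coeff_map, coeff_map, coeff_map]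
    exact PowerSeries.algebraMap_apply.symm
  rw [h, sc_comm]

variable {T : Fin 2 → Fin 2 → A⟦X⟧} (hT : IsYangian T) {s : k⟦X⟧} (hs : coeff 0 s = 1)
include hT hs

theorem IsYangian.twist : IsYangian (twist s T) := by
  refine isYangian_of_rtt (fun i j => ?_) fun i j m l => ?_
  · rw [RestrictedYangian.twist, coeff_zero_mul', coeff_sc, hs, hT.const, map_one, one_mul]
  · have h1 : ∀ g h : A⟦X⟧, inU (sc A s * g) * inV (sc A s * h) =
        inU (sc A s) * inV (sc A s) * (inU g * inV h) := fun g h => by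
      rw [map_mul, map_mul, mul_assoc, ← mul_assoc (inU g), ← inV_sc_comm, mul_assoc, mul_assoc]
    have h2 : ∀ g h : A⟦X⟧, inV (sc A s * g) * inU (sc A s * h) =
        inU (sc A s) * inV (sc A s) * (inV g * inU h) := fun g h => by
      rw [map_mul, map_mul, mul_assoc, ← mul_assoc (inV g), ← inU_sc_comm, mul_assoc, ← mul_assoc,
        ← inU_sc_comm, mul_assoc]
    simp only [RestrictedYangian.twist, h1, h2, ← mul_sub]
    rw [← mul_smul_comm, hT.rtt, mul_smul_comm]

theorem d1InvOf_twist : d1InvOf (twist s T) = sc A s⁻¹ * d1InvOf T := by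
  have hs' : constantCoeff s ≠ 0 := by
    rw [← coeff_zero_eq_constantCoeff_apply, hs]; exact one_ne_zero
  refine left_inv_eq_right_inv (hT.twist hs).inv_mul_d1 ?_
  rw [twist, mul_assoc, ← mul_assoc (T 0 0), ← sc_comm, mul_assoc, hT.d1_mul_inv, mul_one,
    ← map_mul, PowerSeries.mul_inv_cancel _ hs', map_one]

/-- The scalar cancels in e and likewise in f; only d₁ and d₂ are rescaled. The nilpotency of the
f's therefore survives the twist. -/
theorem eOf_twist : eOf (twist s T) = eOf T := by
  have hs' : constantCoeff s ≠ 0 := by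
    rw [← coeff_zero_eq_constantCoeff_apply, hs]; exact one_ne_zero
  rw [eOf, d1InvOf_twist hT hs, twist, mul_assoc, ← mul_assoc (d1InvOf T), ← sc_comm, mul_assoc,
    ← mul_assoc, ← map_mul, PowerSeries.inv_mul_cancel _ hs', map_one, one_mul]
  rfl

theorem fOf_twist : fOf (twist s T) = fOf T := by
  have hs' : constantCoeff s ≠ 0 := by
    rw [← coeff_zero_eq_constantCoeff_apply, hs]; exact one_ne_zero
  rw [fOf, d1InvOf_twist hT hs, twist, mul_assoc, ← mul_assoc (T 1 0), ← sc_comm, mul_assoc,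
    ← mul_assoc, ← map_mul, PowerSeries.mul_inv_cancel _ hs', map_one, one_mul]
  rfl

theorem d2Of_twist : d2Of (twist s T) = sc A s * d2Of T := by
  rw [d2Of, eOf_twist hT hs, fOf_twist hT hs, twist, twist, ← mul_assoc (fOf T), ← sc_comm, d2Of,
    mul_sub, mul_assoc, mul_assoc, mul_assoc]

theorem fC_twist : fC (twist s T) = fC T := by
  funext i
  rw [fC, fOf_twist hT hs]; rfl

omit hT in
theorem invariant_twist {M : Type*} [AddCommGroup M] [Module k M] [Module A M]
    [IsScalarTower k A M] {U : Submodule k M} (hU : Invariant (twist s T) U) : Invariant T U := by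
  have hs' : constantCoeff s ≠ 0 := by
    rw [← coeff_zero_eq_constantCoeff_apply, hs]; exact one_ne_zero
  intro i j
  have h := (CoeffsIn.sc (S := stab A U) s⁻¹).mul (hU i j)
  rwa [twist, ← mul_assoc, ← map_mul, PowerSeries.inv_mul_cancel _ hs', map_one, one_mul] at h

theorem IsHighestWeight.twist {M : Type*} [AddCommGroup M] [Module k M] [Module A M]
    [IsScalarTower k A M] {v : M} {μ : Fin 2 → k⟦X⟧} (hv : IsHighestWeight T v μ) :
    IsHighestWeight (twist s T) v fun i => s * μ i where
  d1 := (Acts.sc s v).mul hv.d1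
  d2 := by rw [d2Of_twist hT hs]; exact (Acts.sc s v).mul hv.d2
  e := by rw [eOf_twist hT hs]; exact hv.e
  cyclic U hvU hU := hv.cyclic U hvU (invariant_twist hs hU)

end Twist

/-! ### The baby Verma module and its head as highest weight modules -/

section Simple

variable {k : Type*} [Field k] (p : ℕ) (lam : Fin 2 → k⟦X⟧)

theorem Invariant.smul_mem {M : Type*} [AddCommGroup M] [Module k M] [Module (Y2p k p) M]
    [IsScalarTower k (Y2p k p) M] {U : Submodule k M} (hU : Invariant (tp k p) U) (a : Y2p k p)
    {x : M} (hx : x ∈ U) : a • x ∈ U := by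
  have h : (⊤ : Subalgebra k (Y2p k p)) ≤ stab (Y2p k p) U := by
    rw [← adjoin_tp, Algebra.adjoin_le_iff]
    rintro _ ⟨i, j, r, rfl⟩
    exact hU i j r
  exact h trivial x hx

/-- The submodule underlying an invariant subspace. -/
def Invariant.toSubmodule {M : Type*} [AddCommGroup M] [Module k M] [Module (Y2p k p) M]
    [IsScalarTower k (Y2p k p) M] {U : Submodule k M} (hU : Invariant (tp k p) U) :
    Submodule (Y2p k p) M :=
  { U with smul_mem' := fun a _ hx => hU.smul_mem p a hx }

/-- The highest weight vector of the baby Verma module. -/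
def bvVec : BabyVerma p lam := Submodule.Quotient.mk 1

/-- The highest weight vector of the simple module. -/
def simpleVec : L p lam := Submodule.Quotient.mk (bvVec p lam)

theorem exists_smul_bvVec (x : BabyVerma p lam) : ∃ a : Y2p k p, x = a • bvVec p lam := by
  obtain ⟨a, rfl⟩ := Submodule.Quotient.mk_surjective _ x
  exact ⟨a, by rw [bvVec, ← Submodule.Quotient.mk_smul, smul_eq_mul, mul_one]⟩

theorem exists_smul_simpleVec (x : L p lam) : ∃ a : Y2p k p, x = a • simpleVec p lam := by
  obtain ⟨x, rfl⟩ := Submodule.Quotient.mk_surjective _ x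
  obtain ⟨a, rfl⟩ := exists_smul_bvVec p lam x
  exact ⟨a, rfl⟩

theorem smul_bvVec_eq_zero {a : Y2p k p} (h : a ∈ babyVermaIdeal p lam) : a • bvVec p lam = 0 := by
  rw [bvVec, ← Submodule.Quotient.mk_smul, smul_eq_mul, mul_one]
  exact (Submodule.Quotient.mk_eq_zero _).2 h

variable {lam}

theorem isHighestWeight_bvVec (hlam : ∀ i, constantCoeff (lam i) = 1) :
    IsHighestWeight (tp k p) (bvVec p lam) lam := by
  have hd : ∀ i r, coeff 0 (d k i) = 1 → proj k p (coeff r (d k i)) • bvVec p lam =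
      coeff r (lam i) • bvVec p lam := by
    intro i r h0
    rcases r.eq_zero_or_pos with rfl | hr
    · rw [h0, map_one, one_smul, coeff_zero_eq_constantCoeff_apply, hlam, one_smul]
    · have h := smul_bvVec_eq_zero p lam (Submodule.subset_span (Or.inr ⟨i, r, hr, rfl⟩))
      rwa [sub_smul, sub_eq_zero, algebraMap_smul] at h
  have h1 : coeff 0 (d k 0) = 1 := (isYangian_t k).const 0 0
  have h2 : coeff 0 (d k 1) = 1 := by
    change coeff 0 (d2Of (t k)) = 1
    rw [d2Of, map_sub, (isYangian_t k).const, mul_assoc, coeff_zero_mul',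
      (isYangian_t k).coeff_zero_f, zero_mul, sub_zero, if_pos rfl]
  refine ⟨fun r => ?_, fun r => ?_, fun r => ?_, fun U hv hU => ?_⟩
  · rw [tp, coeff_map]; exact hd 0 r h1
  · rw [d2_tp, coeff_map]; exact hd 1 r h2
  · rw [e_tp, coeff_map, map_zero, zero_smul]
    rcases r.eq_zero_or_pos with rfl | hr
    · have : coeff 0 (e k) = 0 := (isYangian_t k).coeff_zero_e
      rw [this, map_zero, zero_smul]
    · exact smul_bvVec_eq_zero p lam (Submodule.subset_span (Or.inl ⟨r, hr, rfl⟩))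
  · rw [eq_top_iff]
    rintro x -
    obtain ⟨a, rfl⟩ := exists_smul_bvVec p lam x
    exact hU.smul_mem p a hv

theorem isHighestWeight_simpleVec (hlam : ∀ i, constantCoeff (lam i) = 1) :
    IsHighestWeight (tp k p) (simpleVec p lam) lam := by
  have h := isHighestWeight_bvVec p hlam
  refine ⟨fun r => ?_, fun r => ?_, fun r => ?_, fun U hv hU => ?_⟩
  · exact congrArg (Submodule.Quotient.mk (p := maxSubmodule p lam)) (h.d1 r)
  · exact congrArg (Submodule.Quotient.mk (p := maxSubmodule p lam)) (h.d2 r)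
  · exact congrArg (Submodule.Quotient.mk (p := maxSubmodule p lam)) (h.e r)
  · rw [eq_top_iff]
    rintro x -
    obtain ⟨a, rfl⟩ := exists_smul_simpleVec p lam x
    exact hU.smul_mem p a hv

/-- The preimage in the baby Verma module is either everything or one of the proper submodules that
are summed to form the kernel. -/
theorem eq_bot_or_eq_top_of_invariant (U : Submodule k (L p lam)) (hU : Invariant (tp k p) U) :
    U = ⊥ ∨ U = ⊤ := by
  by_cases h : (hU.toSubmodule p).comap (maxSubmodule p lam).mkQ = ⊤
  · right
    rw [eq_top_iff]
    rintro x -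
    obtain ⟨y, rfl⟩ := Submodule.Quotient.mk_surjective _ x
    have : y ∈ (hU.toSubmodule p).comap (maxSubmodule p lam).mkQ := by rw [h]; trivial
    exact this
  · left
    have h1 : (hU.toSubmodule p).comap (maxSubmodule p lam).mkQ ≤ maxSubmodule p lam := le_sSup h
    rw [eq_bot_iff]
    intro x hx
    obtain ⟨y, rfl⟩ := Submodule.Quotient.mk_surjective _ x
    exact (Submodule.mem_bot k).2 ((Submodule.Quotient.mk_eq_zero _).2 (h1 hx))

end Simple

/-! ### The ratio condition on power series; sufficiency -/

section Ratio

variable {k : Type*} [Field k]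

/-- The series `u⁻ⁿ P(u)`, where `n` is the degree of `P`. -/
def rev (P : Polynomial k) : k⟦X⟧ := (P.reverse : k⟦X⟧)

theorem coeff_rev_of_lt (P : Polynomial k) {r : ℕ} (h : P.natDegree < r) : coeff r (rev P) = 0 := by
  rw [rev, Polynomial.coeff_coe]
  exact Polynomial.coeff_eq_zero_of_natDegree_lt (P.reverse_natDegree_le.trans_lt h)

theorem coeff_zero_rev (P : Polynomial k) : coeff 0 (rev P) = P.leadingCoeff := by
  rw [rev, Polynomial.coeff_coe, Polynomial.coeff_zero_reverse]

theorem eval₂_u (P : Polynomial k) : P.eval₂ HahnSeries.C (u k) =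
    HahnSeries.ofPowerSeries ℤ k (rev P) * u k ^ P.natDegree := by
  have h1 : HahnSeries.ofPowerSeries ℤ k X * u k = 1 := by
    rw [HahnSeries.ofPowerSeries_X, u, HahnSeries.single_mul_single]
    simp
  let _ : Invertible (u k) := ⟨HahnSeries.ofPowerSeries ℤ k X, h1, by rw [mul_comm, h1]⟩
  rw [← Polynomial.eval₂_reverse_mul_pow]
  congr 1
  change Polynomial.eval₂ _ (HahnSeries.ofPowerSeries ℤ k X) _ = _
  rw [rev]
  induction P.reverse using Polynomial.induction_on' with
  | add f g hf hg => rw [Polynomial.eval₂_add, hf, hg, Polynomial.coe_add, map_add]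
  | monomial n a =>
    rw [← Polynomial.C_mul_X_pow_eq_monomial, Polynomial.eval₂_mul, Polynomial.eval₂_C,
      Polynomial.eval₂_X_pow, Polynomial.coe_mul, Polynomial.coe_pow, Polynomial.coe_X,
      Polynomial.coe_C, map_mul, map_pow, HahnSeries.ofPowerSeries_C]

/-- P(u+1) and P(u) have the same degree, so the powers of u cancel and an identity of series in u⁻¹
remains. -/
theorem ratio_iff {P : Polynomial k} (hP : P.Monic) {a c : k⟦X⟧} (hc : c ≠ 0) :
    (HahnSeries.ofPowerSeries ℤ k a / HahnSeries.ofPowerSeries ℤ k c : LaurentSeries k) =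
        P.eval₂ HahnSeries.C (u k + 1) / P.eval₂ HahnSeries.C (u k) ↔
      a * rev P = c * rev (P.comp (Polynomial.X + 1)) := by
  have hu : u k ≠ 0 := by
    rw [u]; exact HahnSeries.single_ne_zero one_ne_zero
  have hinj : Function.Injective (HahnSeries.ofPowerSeries ℤ k) := HahnSeries.ofPowerSeries_injective
  have h1 : P.eval₂ HahnSeries.C (u k + 1) =
      (P.comp (Polynomial.X + 1)).eval₂ HahnSeries.C (u k) := by
    rw [Polynomial.eval₂_comp]; simp
  have hd : (P.comp (Polynomial.X + 1)).natDegree = P.natDegree := by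
    rw [Polynomial.natDegree_comp, ← Polynomial.C_1, Polynomial.natDegree_X_add_C, mul_one]
  have hr : rev P ≠ 0 := fun h => by
    have := coeff_zero_rev P
    rw [h, hP.leadingCoeff, map_zero] at this
    exact zero_ne_one this
  rw [h1, eval₂_u, eval₂_u, hd, mul_div_mul_right _ _ (pow_ne_zero _ hu), div_eq_div_iff,
    ← map_mul, ← map_mul, hinj.eq_iff, mul_comm (rev _) c]
  · rw [Ne, map_eq_zero_iff _ hinj]; exact hc
  · rw [Ne, map_eq_zero_iff _ hinj]; exact hr

/-- The twist by s = u⁻ⁿP(u)/λ₂(u) turns the weights into u⁻ⁿP(u+1) and u⁻ⁿP(u), both truncated at n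
= deg P. -/
theorem finite_L {p : ℕ} (hp : 0 < p) {lam : Fin 2 → k⟦X⟧}
    (hlam : ∀ i, constantCoeff (lam i) = 1) {P : Polynomial k} (hP : P.Monic)
    (h : lam 0 * rev P = lam 1 * rev (P.comp (Polynomial.X + 1))) : Module.Finite k (L p lam) := by
  set s := rev P * (lam 1)⁻¹ with hs
  have h1 : constantCoeff (lam 1) ≠ 0 := by rw [hlam]; exact one_ne_zero
  have hs0 : coeff 0 s = 1 := by
    rw [hs, coeff_zero_mul', coeff_zero_rev, hP.leadingCoeff, coeff_zero_eq_constantCoeff_apply,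
      constantCoeff_inv, hlam, inv_one, one_mul]
  have e1 : s * lam 1 = rev P := by
    rw [hs, mul_assoc, PowerSeries.inv_mul_cancel _ h1, mul_one]
  have e0 : s * lam 0 = rev (P.comp (Polynomial.X + 1)) := by
    rw [hs, mul_right_comm, mul_comm (rev P), h, mul_right_comm, PowerSeries.mul_inv_cancel _ h1,
      one_mul]
  have hT := isYangian_tp k p
  refine (hT.twist hs0).finite_of_truncated hp (fun i => ?_) (v := simpleVec p lam)
    (μ := fun i => s * lam i) (n := P.natDegree) ?_ (fun i r hr => ?_) (fun U hU => ?_)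
  · rw [fC_twist hT hs0]; exact fC_tp_pow k p i
  · exact IsHighestWeight.twist hT hs0 (isHighestWeight_simpleVec p hlam)
  · fin_cases i
    · change coeff r (s * lam 0) = 0
      rw [e0]
      refine coeff_rev_of_lt _ ?_
      rwa [Polynomial.natDegree_comp, ← Polynomial.C_1, Polynomial.natDegree_X_add_C, mul_one]
    · change coeff r (s * lam 1) = 0
      rw [e1]
      exact coeff_rev_of_lt _ hr
  · exact eq_bot_or_eq_top_of_invariant p U (invariant_twist hs0 hU)

end Ratio
end RestrictedYangian

end

noncomputable section
namespace RestrictedYangian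
open PowerSeries

/-! ### Products of commuting RTT matrices -/

section Fusion

variable {A : Type*} [Ring A] {P Q : Fin 2 → Fin 2 → A⟦X⟧}

/-- The product of two commuting solutions of the RTT relations is a solution. -/
theorem IsYangian.mul (hP : IsYangian P) (hQ : IsYangian Q)
    (hc : ∀ i j m l r s, Commute (coeff r (P i j)) (coeff s (Q m l))) :
    IsYangian fun i j => ∑ a, P i a * Q a j := by
  have c1 : ∀ i j m l, inU (Q i j) * inV (P m l) = inV (P m l) * inU (Q i j) := fun i j m l =>
    ext2 fun r s => by simpa using (hc m l i j s r).eq.symm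
  have c2 : ∀ i j m l, inV (Q i j) * inU (P m l) = inU (P m l) * inV (Q i j) := fun i j m l =>
    ext2 fun r s => by simpa using (hc m l i j r s).eq.symm
  refine isYangian_of_rtt (fun i j => ?_) fun i j m l => ?_
  · rw [map_sum]
    simp only [coeff_zero_mul', hP.const, hQ.const]
    simp
  · have e1 : ∀ i j m l, inU (∑ a, P i a * Q a j) * inV (∑ a, P m a * Q a l) =
        ∑ a, ∑ b, inU (P i a) * inV (P m b) * (inU (Q a j) * inV (Q b l)) := by
      intro i j m l
      simp only [map_sum, map_mul, Finset.sum_mul_sum]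
      refine Finset.sum_congr rfl fun a _ => Finset.sum_congr rfl fun b _ => ?_
      rw [mul_assoc, ← mul_assoc (inU (Q a j)), c1, mul_assoc, mul_assoc]
    have e2 : ∀ i j m l, inV (∑ a, P i a * Q a j) * inU (∑ a, P m a * Q a l) =
        ∑ a, ∑ b, inV (P i a) * inU (P m b) * (inV (Q a j) * inU (Q b l)) := by
      intro i j m l
      simp only [map_sum, map_mul, Finset.sum_mul_sum]
      refine Finset.sum_congr rfl fun a _ => Finset.sum_congr rfl fun b _ => ?_
      rw [mul_assoc, ← mul_assoc (inV (Q a j)), c2, mul_assoc, mul_assoc]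
    -- The factors P are exchanged first, then the factors Q. After summation over a and b the mixed
    -- terms cancel upon interchanging a and b.
    have k1 : ∀ a b, wt A • (inU (P i a) * inV (P m b) * (inU (Q a j) * inV (Q b l)) -
        inV (P m b) * inU (P i a) * (inV (Q b l) * inU (Q a j))) =
        qt A • ((inU (P m a) * inV (P i b) - inV (P m a) * inU (P i b)) *
          (inU (Q a j) * inV (Q b l)) + inV (P m b) * inU (P i a) *
          (inU (Q b j) * inV (Q a l) - inV (Q b j) * inU (Q a l))) := by
      intro a b
      rw [smul_add, ← smul_mul_assoc, ← hP.rtt, ← mul_smul_comm, ← hQ.rtt, smul_mul_assoc,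
        mul_smul_comm, ← smul_add]
      congr 1
      noncomm_ring
    rw [e1, e2, e1, e2]
    rw [Finset.sum_comm (f := fun a b => inV (P m a) * inU (P i b) * (inV (Q a l) * inU (Q b j)))]
    simp only [← Finset.sum_sub_distrib]
    simp only [Finset.smul_sum, k1]
    simp only [← Finset.smul_sum]
    congr 1
    simp only [Fin.sum_univ_two]
    noncomm_ring

end Fusion

/-! ### Verma-type modules: evaluation and tensor products -/

section Verma

universe w
variable {k : Type w} [Field k]

/-- There is a module over the Yangian with a vector of weight `μ` annihilated by `t₁₂(u)` and not
in the image of `t₂₁(u)`. -/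
def HasVerma (μ : Fin 2 → k⟦X⟧) : Prop :=
  ∃ (V : Type w) (_ : AddCommGroup V) (_ : Module k V) (T : Fin 2 → Fin 2 → (Module.End k V)⟦X⟧)
    (v : V) (ε : V →ₗ[k] k), IsYangian T ∧ ε v = 1 ∧ (∀ r, coeff r (T 0 1) v = 0) ∧
    (∀ i r, coeff r (T i i) v = coeff r (μ i) • v) ∧ ∀ r x, ε (coeff r (T 1 0) x) = 0

open TensorProduct in
-- On the tensor product the matrix product of the two T's acts. Weights multiply since off-diagonal
-- terms contain a t₁₂ killing its vector; the product of the functionals kills t₂₁ because each of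
-- its terms has a t₂₁ in one factor.
theorem HasVerma.mul {μ ν : Fin 2 → k⟦X⟧} (hμ : HasVerma μ) (hν : HasVerma ν) :
    HasVerma fun i => μ i * ν i := by
  obtain ⟨V, _, _, T, v, ε, hT, hε, h12, hii, h21⟩ := hμ
  obtain ⟨V', _, _, T', v', ε', hT', hε', h12', hii', h21'⟩ := hν
  let P : Fin 2 → Fin 2 → (Module.End k (V ⊗[k] V'))⟦X⟧ := fun i j =>
    PowerSeries.map (Module.End.rTensorAlgHom k V V' : _ →+* _) (T i j)
  let Q : Fin 2 → Fin 2 → (Module.End k (V ⊗[k] V'))⟦X⟧ := fun i j =>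
    PowerSeries.map (Module.End.lTensorAlgHom k V' V : _ →+* _) (T' i j)
  have hPx : ∀ i j r x y, coeff r (P i j) (x ⊗ₜ y) = (coeff r (T i j) x) ⊗ₜ[k] y := by
    intro i j r x y; rw [coeff_map]; rfl
  have hQx : ∀ i j r x y, coeff r (Q i j) (x ⊗ₜ y) = x ⊗ₜ[k] (coeff r (T' i j) y) := by
    intro i j r x y; rw [coeff_map]; rfl
  have hPQ : ∀ i j r x y, coeff r (∑ a, P i a * Q a j) (x ⊗ₜ y) =
      ∑ a, ∑ z ∈ Finset.HasAntidiagonal.antidiagonal r, (coeff z.1 (T i a) x) ⊗ₜ[k] (coeff z.2 (T' a j) y) := by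
    intro i j r x y
    simp only [map_sum, coeff_mul, LinearMap.sum_apply, Module.End.mul_apply, hQx, hPx]
  have hc : ∀ i j m l r s, Commute (coeff r (P i j)) (coeff s (Q m l)) := by
    intro i j m l r s
    refine TensorProduct.ext' fun x y => ?_
    rw [Module.End.mul_apply, Module.End.mul_apply, hQx, hPx, hPx, hQx]
  have hPY : IsYangian P := hT.map _
  have hQY : IsYangian Q := hT'.map _
  refine ⟨V ⊗[k] V', inferInstance, inferInstance, fun i j => ∑ a, P i a * Q a j, v ⊗ₜ v',
    LinearMap.mul' k k ∘ₗ TensorProduct.map ε ε', hPY.mul hQY hc, ?_, ?_, ?_, ?_⟩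
  · simp [hε, hε']
  · intro r
    rw [hPQ]
    refine Finset.sum_eq_zero fun a _ => Finset.sum_eq_zero fun z _ => ?_
    fin_cases a
    · exact (congrArg _ (h12' _)).trans (TensorProduct.tmul_zero _ _)
    · exact (congrArg (· ⊗ₜ[k] _) (h12 _)).trans (TensorProduct.zero_tmul _ _)
  · intro i r
    rw [hPQ, coeff_mul, Finset.sum_smul, Finset.sum_eq_single i]
    · refine Finset.sum_congr rfl fun z _ => ?_
      rw [hii, hii', TensorProduct.smul_tmul_smul]
    · intro a _ ha
      refine Finset.sum_eq_zero fun z _ => ?_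
      fin_cases i <;> fin_cases a
      · exact absurd rfl ha
      · exact (congrArg (· ⊗ₜ[k] _) (h12 _)).trans (TensorProduct.zero_tmul _ _)
      · exact (congrArg _ (h12' _)).trans (TensorProduct.tmul_zero _ _)
      · exact absurd rfl ha
    · simp
  · intro r z
    induction z using TensorProduct.induction_on with
    | zero => simp
    | add x y hx hy => rw [map_add, map_add, hx, hy, add_zero]
    | tmul x y =>
      rw [hPQ, map_sum]
      refine Finset.sum_eq_zero fun a _ => ?_
      rw [map_sum]
      refine Finset.sum_eq_zero fun z _ => ?_
      rw [LinearMap.comp_apply, TensorProduct.map_tmul, LinearMap.mul'_apply]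
      fin_cases a
      · exact (congrArg (· * _) (h21 _ _)).trans (zero_mul _)
      · exact (congrArg _ (h21' _ _)).trans (mul_zero _)

/-- The operators of the Verma module of `gl₂` of weight `(a, b)`. -/
def vermaOp (a b : k) : Fin 2 → Fin 2 → Module.End k (Polynomial k) :=
  ![![algebraMap k _ a - LinearMap.mulLeft k Polynomial.X * Polynomial.derivative,
      (a - b) • Polynomial.derivative -
        LinearMap.mulLeft k Polynomial.X * Polynomial.derivative * Polynomial.derivative],
    ![LinearMap.mulLeft k Polynomial.X,
      algebraMap k _ b + LinearMap.mulLeft k Polynomial.X * Polynomial.derivative]]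

/-- The evaluation map T(u) = 1 + Eu⁻¹: the only relation with content is the gl₂ bracket. -/
theorem isYangian_of_gl {A : Type*} [Ring A] (E : Fin 2 → Fin 2 → A)
    (h : ∀ i j m l, E i j * E m l - E m l * E i j =
      (if m = j then E i l else 0) - if i = l then E m j else 0) :
    IsYangian fun i j => PowerSeries.C (if i = j then 1 else 0) + PowerSeries.C (E i j) * X := by
  have c0 : ∀ i j, coeff 0 (PowerSeries.C (if i = j then 1 else 0) + PowerSeries.C (E i j) * X) =
      if i = j then 1 else 0 := fun i j => by simp
  have c1 : ∀ i j, coeff 1 (PowerSeries.C (if i = j then 1 else 0) + PowerSeries.C (E i j) * X) =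
      E i j := fun i j => by rw [map_add, coeff_C_mul, coeff_C]; simp
  have c2 : ∀ i j r, coeff (r + 1 + 1)
      (PowerSeries.C (if i = j then 1 else 0) + PowerSeries.C (E i j) * X) = 0 := fun i j r => by
    rw [map_add, coeff_C_mul, coeff_C, coeff_X]; simp
  refine ⟨c0, fun i j m l r s => ?_⟩
  have h0 := h i j m l
  rcases r with _ | _ | r <;> rcases s with _ | _ | s <;>
    simp only [zero_add, c0, c1, c2, mul_zero, zero_mul, sub_zero, zero_sub, sub_self, h0, ite_mul,
      mul_ite, one_mul, mul_one, neg_sub, ite_self]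

/-- In k[X] the highest weight vector is 1 and E₂₁ is multiplication by X, so the constant
coefficient serves as functional. This model works for every a and b in characteristic p. -/
theorem hasVerma_linear (a b : k) :
    HasVerma ![1 + PowerSeries.C a * X, 1 + PowerSeries.C b * X] := by
  refine ⟨Polynomial k, inferInstance, inferInstance,
    fun i j => PowerSeries.C (if i = j then 1 else 0) + PowerSeries.C (vermaOp a b i j) * X, 1,
    Polynomial.lcoeff k 0, isYangian_of_gl _ ?_, ?_, ?_, ?_, ?_⟩
  · intro i j m l
    fin_cases i <;> fin_cases j <;> fin_cases m <;> fin_cases l <;>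
    · refine LinearMap.ext fun P => ?_
      simp [vermaOp, Polynomial.derivative_mul, Polynomial.smul_eq_C_mul]
      try ring
  · simp
  · intro r
    rcases r with _ | _ | r <;> simp [vermaOp]
  · intro i r
    fin_cases i <;> rcases r with _ | _ | r <;> simp [vermaOp, coeff_C, coeff_one]
  · intro r x
    rcases r with _ | _ | r <;> simp [vermaOp, coeff_C, coeff_X]

end Verma
end RestrictedYangian

end

noncomputable section
namespace RestrictedYangian
open PowerSeries

/-! ### Every polynomial weight occurs -/

section Polynomials

universe w
variable {k : Type w} [Field k]

theorem HasVerma.one : HasVerma (fun _ => (1 : k⟦X⟧)) := by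
  have h := hasVerma_linear (0 : k) 0
  convert h using 1
  funext i
  fin_cases i <;> simp

theorem hasVerma_linear_single (a : k) (i : Fin 2) :
    HasVerma (Function.update (fun _ => (1 : k⟦X⟧)) i (1 + PowerSeries.C a * X)) := by
  fin_cases i
  · convert hasVerma_linear a 0 using 1
    funext j
    fin_cases j <;> simp
  · convert hasVerma_linear 0 a using 1
    funext j
    fin_cases j <;> simp

/-- Over an algebraically closed field a polynomial with constant term 1 is a product of factors 1 -
r⁻¹X, each realized by one evaluation module. -/
theorem hasVerma_polynomial_single [IsAlgClosed k] (i : Fin 2) (P : Polynomial k)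
    (h0 : P.coeff 0 = 1) : HasVerma (Function.update (fun _ => (1 : k⟦X⟧)) i (P : k⟦X⟧)) := by
  induction hn : P.natDegree generalizing P with
  | zero =>
    rw [Polynomial.eq_C_of_natDegree_eq_zero hn, h0, Polynomial.C_1, Polynomial.coe_one,
      Function.update_eq_self_iff.2 rfl]
    exact HasVerma.one
  | succ n ih =>
    have hdeg : P.degree ≠ 0 := fun h => by
      have := Polynomial.natDegree_eq_of_degree_eq_some (n := 0) h
      omega
    obtain ⟨r, hr⟩ := IsAlgClosed.exists_root P hdeg
    obtain ⟨Q, rfl⟩ := Polynomial.dvd_iff_isRoot.2 hr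
    rw [Polynomial.mul_coeff_zero, Polynomial.coeff_sub, Polynomial.coeff_X_zero,
      Polynomial.coeff_C_zero, zero_sub] at h0
    have hr0 : r ≠ 0 := by rintro rfl; simp at h0
    have hQ0 : Q ≠ 0 := by rintro rfl; simp at h0
    have hd : Q.natDegree = n := by
      rw [Polynomial.natDegree_mul (Polynomial.X_sub_C_ne_zero r) hQ0,
        Polynomial.natDegree_X_sub_C] at hn
      omega
    -- The factor -r restores constant term 1 in the cofactor.
    have h1 := ih (Polynomial.C (-r) * Q) (by rw [Polynomial.coeff_C_mul, h0])
      (by rw [Polynomial.natDegree_C_mul (neg_ne_zero.2 hr0), hd])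
    convert (hasVerma_linear_single (-r⁻¹) i).mul h1 using 1
    funext j
    rcases eq_or_ne j i with rfl | hj
    · rw [Function.update_self, Function.update_self, Function.update_self]
      have : (Polynomial.X - Polynomial.C r) * Q =
          (1 + Polynomial.C (-r⁻¹) * Polynomial.X) * (Polynomial.C (-r) * Q) := by
        have h2 : Polynomial.C r * Polynomial.C r⁻¹ = 1 := by
          rw [← Polynomial.C_mul, mul_inv_cancel₀ hr0, Polynomial.C_1]
        rw [Polynomial.C_neg, Polynomial.C_neg]
        linear_combination (-Polynomial.X * Q) * h2
      rw [this]
      simp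
    · rw [Function.update_of_ne hj, Function.update_of_ne hj, Function.update_of_ne hj, mul_one]

theorem hasVerma_polynomial [IsAlgClosed k] (P : Fin 2 → Polynomial k)
    (h0 : ∀ i, (P i).coeff 0 = 1) : HasVerma fun i => (P i : k⟦X⟧) := by
  convert (hasVerma_polynomial_single 0 (P 0) (h0 0)).mul
    (hasVerma_polynomial_single 1 (P 1) (h0 1)) using 1
  funext i
  fin_cases i <;> simp

end Polynomials

/-! ### Shift products acting on weight vectors, and congruences -/

section Shifts

variable {k A : Type*} [Field k] [Ring A] [Algebra k A] {M : Type*} [AddCommGroup M] [Module k M]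
  [Module A M] [IsScalarTower k A M]

theorem Acts.shift {g : A⟦X⟧} {μ : k⟦X⟧} {v : M} (h : Acts g μ v) (c : k) :
    Acts (shift c g) (shift c μ) v := fun n => by
  rw [RestrictedYangian.shift, RestrictedYangian.shift, coeff_mk, coeff_mk, Finset.sum_smul,
    Finset.sum_smul]
  refine Finset.sum_congr rfl fun r _ => ?_
  rw [smul_assoc, h, smul_assoc]

omit [Algebra k A] [IsScalarTower k A M] in
theorem Acts.one (v : M) : Acts (1 : A⟦X⟧) (1 : k⟦X⟧) v := fun n => by
  rw [coeff_one, coeff_one]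
  split_ifs <;> simp

theorem Acts.partialProd {g : A⟦X⟧} {μ : k⟦X⟧} {v : M} (h : Acts g μ v) (m : ℕ) :
    Acts (partialProd k g m) (partialProd k μ m) v := by
  induction m with
  | zero => exact Acts.one v
  | succ m ih =>
    rw [partialProd_succ, partialProd_succ, ← shift_eq_shiftHom, ← shift_eq_shiftHom]
    exact ih.mul (h.shift _)

theorem coeff_map' {B : Type*} [Ring B] [Algebra k B] (φ : A →ₐ[k] B) (r : ℕ) (g : A⟦X⟧) :
    coeff r (PowerSeries.map (φ : A →+* B) g) = φ (coeff r g) := coeff_map _ _ _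

theorem map_shiftProd {B : Type*} [Ring B] [Algebra k B] (φ : A →ₐ[k] B) (p : ℕ) (g : A⟦X⟧) :
    PowerSeries.map (φ : A →+* B) (shiftProd k p g) =
      shiftProd k p (PowerSeries.map (φ : A →+* B) g) := by
  rw [shiftProd, shiftProd, map_list_prod, List.map_map]
  congr 1
  refine List.map_congr_left fun j _ => ?_
  ext1 n
  rw [Function.comp_apply, coeff_map', RestrictedYangian.shift, RestrictedYangian.shift, coeff_mk,
    coeff_mk, map_sum]
  exact Finset.sum_congr rfl fun r _ => by rw [map_smul, coeff_map']

theorem sc_self (g : k⟦X⟧) : sc k g = g := by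
  ext n; rw [coeff_sc]; rfl

theorem dvd_shiftHom_sub {n : ℕ} {f g : k⟦X⟧} (h : X ^ n ∣ f - g) (c : k) :
    X ^ n ∣ shiftHom c f - shiftHom c g := by
  obtain ⟨q, hq⟩ := h
  rw [← map_sub, hq, map_mul, map_pow, shiftHom_X, sc_self, invSub, mul_pow, mul_assoc]
  exact dvd_mul_right _ _

theorem dvd_partialProd_sub {n : ℕ} {f g : k⟦X⟧} (h : X ^ n ∣ f - g) (m : ℕ) :
    X ^ n ∣ partialProd k f m - partialProd k g m := by
  induction m with
  | zero => rw [partialProd_zero, partialProd_zero, sub_self]; exact dvd_zero _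
  | succ m ih =>
    have h1 : partialProd k f (m + 1) - partialProd k g (m + 1) =
        (partialProd k f m - partialProd k g m) * shiftHom (m : k) f +
          partialProd k g m * (shiftHom (m : k) f - shiftHom (m : k) g) := by
      rw [partialProd_succ, partialProd_succ]; ring
    rw [h1]
    exact dvd_add (ih.mul_right _) ((dvd_shiftHom_sub h _).mul_left _)

/-- Since (u - c)⁻¹ is divisible by u⁻¹, shifts and products preserve congruence modulo u⁻ⁿ. -/
theorem coeff_shiftProd_congr {n r p : ℕ} {f g : k⟦X⟧} (h : X ^ n ∣ f - g) (hr : r < n) :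
    coeff r (shiftProd k p f) = coeff r (shiftProd k p g) := by
  have := X_pow_dvd_iff.1 (dvd_partialProd_sub h p) r hr
  rwa [map_sub, sub_eq_zero, ← shiftProd_eq, ← shiftProd_eq] at this

end Shifts

/-! ### A truncated form of the nonvanishing of the baby Verma module -/

section Existence

universe w
variable {k : Type w} [Field k]

/-- The `p`-central elements that are compatible with a weight known up to order `n`. -/
inductive IsTruncPCenterGen (k : Type*) [Field k] (p n : ℕ) : Y2 k → Prop
  | b (i : Fin 2) (r : ℕ) (hr : 0 < r) (hn : r * p ≤ n) :
    IsTruncPCenterGen k p n (coeff (r * p) (b k p i))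
  | e (r : ℕ) : IsTruncPCenterGen k p n (coeff r (e k) ^ p)
  | f (r : ℕ) : IsTruncPCenterGen k p n (coeff r (f k) ^ p)

/-- The left ideal of the Yangian generated by `e(u)`, by the coefficients up to `n` of
`dᵢ(u) - λᵢ(u)` and by the compatible part of the ideal of the `p`-center. -/
def truncIdeal (p : ℕ) (lam : Fin 2 → k⟦X⟧) (n : ℕ) : Submodule (Y2 k) (Y2 k) :=
  Submodule.span (Y2 k) ({x | ∃ g y, IsTruncPCenterGen k p n g ∧ x = g * y} ∪
    ({x | ∃ r, x = coeff r (e k)} ∪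
      {x | ∃ i, ∃ r ≤ n, x = coeff r (d k i) - algebraMap k (Y2 k) (coeff r (lam i))}))

namespace IsYangian
variable {A : Type*} [Ring A] [Algebra k A] {M : Type*} [AddCommGroup M] [Module k M]
  [Module A M] [IsScalarTower k A M] {T : Fin 2 → Fin 2 → A⟦X⟧}

theorem smul_eq_zero_of_commute {a : A} (ha : ∀ i, Commute a (fC T i)) {v : M} (hv : a • v = 0)
    {x : M} (hx : x ∈ opSpan (fC T) (Submodule.span k {v})) : a • x = 0 := by
  let K : Submodule k M :=
    { carrier := {x | a • x = 0}
      add_mem' := fun {x y} hx hy => by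
        change a • (x + y) = 0
        rw [smul_add, show a • x = 0 from hx, show a • y = 0 from hy, add_zero]
      zero_mem' := smul_zero _
      smul_mem' := fun c x hx => by
        change a • c • x = 0
        rw [smul_smul_right, show a • x = 0 from hx, smul_zero] }
  have h : opSpan (fC T) (Submodule.span k {v}) ≤ K := by
    refine opSpan_le ((Submodule.span_singleton_le_iff_mem _ _).2 hv) fun i x hx => ?_
    change a • fC T i • x = 0
    rw [← mul_smul, (ha i).eq, mul_smul, show a • x = 0 from hx, smul_zero]
  exact h hx

theorem coeffsIn_of_invariant {U : Submodule k M} (hU : Invariant T U) :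
    CoeffsIn (stab A U) (eOf T) ∧ CoeffsIn (stab A U) (fOf T) ∧ CoeffsIn (stab A U) (d2Of T) := by
  have h1 : CoeffsIn (stab A U) (d1InvOf T) := (hU 0 0).invOfUnit
  have he : CoeffsIn (stab A U) (eOf T) := h1.mul (hU 0 1)
  have hf : CoeffsIn (stab A U) (fOf T) := (hU 1 0).mul h1
  exact ⟨he, hf, (hU 1 1).sub ((hf.mul (hU 0 0)).mul he)⟩

variable (hT : IsYangian T)
include hT

/-- The `f`-part of the `p`-center acts by zero modulo an invariant subspace that lies in the kernel
of any functional killing the image of `t₂₁(u)`. -/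
theorem exists_invariant {p : ℕ} [hp : Fact p.Prime] [CharP k p] {U : Submodule k M}
    (hU : Invariant T U) {ε : M →ₗ[k] k} (hε : ∀ r x, ε (coeff r (T 1 0) • x) = 0) :
    ∃ N : Submodule k M, Invariant T N ∧ N ≤ LinearMap.ker ε ∧
      ∀ r, ∀ x ∈ U, coeff r (fOf T) ^ p • x ∈ N := by
  obtain ⟨he, -, h2⟩ := coeffsIn_of_invariant hU
  set W : Submodule k M := Submodule.span k {y | ∃ r, ∃ x ∈ U, y = coeff r (fOf T) ^ p • x}
    with hW
  have hst : ∀ a : A, (∀ r, Commute (coeff r (fOf T) ^ p) a) → a ∈ stab A U → a ∈ stab A W := by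
    intro a hc ha w hw
    induction hw using Submodule.span_induction with
    | mem y hy =>
      obtain ⟨r, x, hx, rfl⟩ := hy
      rw [← mul_smul, ← (hc r).eq, mul_smul]
      exact Submodule.subset_span ⟨r, a • x, ha x hx, rfl⟩
    | zero => rw [smul_zero]; exact zero_mem _
    | add x y _ _ hx hy => rw [smul_add]; exact add_mem hx hy
    | smul c x _ hx => rw [smul_smul_right]; exact W.smul_mem c hx
  have hεf : ∀ r x, ε (coeff r (fOf T) • x) = 0 := by
    intro r x
    rw [fOf, coeff_mul, Finset.sum_smul, map_sum]
    exact Finset.sum_eq_zero fun z _ => by rw [mul_smul, hε]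
  refine ⟨opSpan (fC T) W, hT.opSpan_stable (fun s => hst _ (fun r => ?_) (hU 0 0 s))
    (fun s => hst _ (fun r => ?_) (h2 s)) (fun s => hst _ (fun r => ?_) (he s)),
    opSpan_le (Submodule.span_le.2 ?_) fun i x _ => LinearMap.mem_ker.2 (hεf _ _), fun r x hx =>
      le_opSpan _ _ (Submodule.subset_span ⟨r, x, hx, rfl⟩)⟩
  · exact hT.commute_f_pow_d1 p k r s
  · exact hT.commute_f_pow_d2 p k r s
  · exact hT.commute_f_pow_e p k r s
  · rintro _ ⟨r, x, hx, rfl⟩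
    -- The outermost factor of the p-th power is already an f, whose image lies in ker ε.
    rw [← Nat.sub_add_cancel hp.out.one_lt.le, pow_succ', mul_smul]
    exact LinearMap.mem_ker.2 (hεf _ _)

end IsYangian

/-- In a Verma-type module whose weight is the truncation of λ, every generator of the ideal sends v
into a submodule N ⊆ ker ε, while ε(v) = 1. -/
theorem one_notMem_truncIdeal [IsAlgClosed k] {p : ℕ} [hp : Fact p.Prime] [CharP k p]
    {lam : Fin 2 → k⟦X⟧} (hlam : ∀ i, IsRestricted p (lam i)) (n : ℕ) :
    (1 : Y2 k) ∉ truncIdeal p lam n := by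
  set μ : Fin 2 → k⟦X⟧ := fun i => (trunc (n + 1) (lam i) : k⟦X⟧) with hμ
  have hdvd : ∀ i, X ^ (n + 1) ∣ μ i - lam i := fun i => by
    refine X_pow_dvd_iff.2 fun m hm => ?_
    rw [map_sub, hμ, Polynomial.coeff_coe, coeff_trunc, if_pos hm, sub_self]
  obtain ⟨V, _, _, T, v, ε, hT, hε, h12, hii, h21⟩ :=
    hasVerma_polynomial (fun i => trunc (n + 1) (lam i)) fun i => by
      rw [coeff_trunc, if_pos n.succ_pos, coeff_zero_eq_constantCoeff_apply, (hlam i).1]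
  have a1 : Acts (T 0 0) (μ 0) v := hii 0
  have ae : Acts (eOf T) (0 : k⟦X⟧) v := Acts.mul_zero (h := T 0 1) (fun r => by
    rw [map_zero, zero_smul]; exact h12 r) _
  have a2 : Acts (d2Of T) (μ 1) v := by
    have h := Acts.sub (g := T 1 1) (μ := μ 1) (hii 1) (ae.mul_zero (fOf T * T 0 0))
    rwa [sub_zero] at h
  set U := opSpan (fC T) (Submodule.span k {v}) with hU
  have hUi : Invariant T U :=
    hT.opSpan_stable a1.coeffsIn_stab a2.coeffsIn_stab ae.coeffsIn_stab
  have hvU : v ∈ U := le_opSpan _ _ (Submodule.mem_span_singleton_self v)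
  obtain ⟨N, hN, hNε, hNf⟩ := hT.exists_invariant (p := p) hUi h21
  obtain ⟨φ, hφ⟩ := exists_algHom (k := k) hT
  have hφi : ∀ {S : Submodule k V}, Invariant T S → ∀ y x, x ∈ S → φ y x ∈ S := by
    intro S hS y x hx
    have h1 : y ∈ Algebra.adjoin k {x | ∃ i j r, x = coeff r (t k i j)} := by
      rw [adjoin_t]; trivial
    have h2 : Algebra.adjoin k {x | ∃ i j r, x = coeff r (t k i j)} ≤
        (stab (Module.End k V) S).comap φ := by
      refine Algebra.adjoin_le ?_
      rintro _ ⟨i, j, r, rfl⟩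
      have := hS i j r
      rw [← hφ, coeff_map] at this
      exact this
    exact h2 h1 x hx
  have hTφ : T = fun i j => PowerSeries.map (φ : Y2 k →+* _) (t k i j) := by
    funext i j; exact (hφ i j).symm
  have hφe : ∀ r, φ (coeff r (e k)) = coeff r (eOf T) := fun r => by
    rw [hTφ, (isYangian_t k).e_map, coeff_map]; rfl
  have hφf : ∀ r, φ (coeff r (f k)) = coeff r (fOf T) := fun r => by
    rw [hTφ, (isYangian_t k).f_map, coeff_map]; rfl
  have hφd : ∀ i, ∃ g : (Module.End k V)⟦X⟧, Acts g (μ i) v ∧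
      (∀ r, φ (coeff r (d k i)) = coeff r g) ∧
      ∀ r s, Commute (coeff r (shiftProd k p g)) (coeff s (fOf T)) := by
    intro i
    fin_cases i
    · refine ⟨T 0 0, a1, fun r => ?_, hT.commute_shiftProd_d1_f p⟩
      rw [← hφ, coeff_map]; rfl
    · refine ⟨d2Of T, a2, fun r => ?_, hT.commute_shiftProd_d2_f p⟩
      rw [hTφ, (isYangian_t k).d2_map, coeff_map]; rfl
  have hK : truncIdeal p lam n ≤
      { carrier := {y | φ y v ∈ N}
        add_mem' := fun {x y} hx hy => by
          change φ (x + y) v ∈ N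
          rw [map_add]; exact add_mem hx hy
        zero_mem' := by
          change φ 0 v ∈ N
          rw [map_zero]; exact zero_mem _
        smul_mem' := fun c x hx => by
          change φ (c * x) v ∈ N
          rw [map_mul]; exact hφi hN c _ hx } := by
    refine Submodule.span_le.2 ?_
    rintro _ (⟨g, y, hg, rfl⟩ | ⟨r, rfl⟩ | ⟨i, r, hr, rfl⟩)
    · change φ (g * y) v ∈ N
      have hy := hφi hUi y v hvU
      rw [map_mul, Module.End.mul_apply]
      rcases hg with ⟨i, r, hr, hn⟩ | r | r
      · obtain ⟨g, hg, hgd, hgc⟩ := hφd i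
        have h1 : φ (coeff (r * p) (b k p i)) = coeff (r * p) (shiftProd k p g) := by
          rw [b, ← coeff_map', map_shiftProd]
          congr 2
          ext1 s
          rw [coeff_map', hgd]
        rw [h1]
        -- As rp ≤ n, this coefficient is the same for λ and its truncation, and restrictedness of λ
        -- makes it zero.
        have h2 : coeff (r * p) (shiftProd k p g) • v = 0 := by
          rw [shiftProd_eq, hg.partialProd p, ← shiftProd_eq,
            coeff_shiftProd_congr (hdvd i) (Nat.lt_succ_of_le hn), (hlam i).2, coeff_one,
            if_neg (Nat.mul_pos hr hp.out.pos).ne', zero_smul]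
        have h3 := IsYangian.smul_eq_zero_of_commute (k := k) (fun j => hgc _ _) h2 hy
        change coeff (r * p) (shiftProd k p g) • _ ∈ N
        rw [h3]; exact zero_mem _
      · rw [map_pow, hφe]
        have h2 : coeff r (eOf T) ^ p • v = 0 := by
          rw [← Nat.sub_add_cancel hp.out.one_lt.le, pow_succ, mul_smul, ae, map_zero, zero_smul,
            smul_zero]
        have h3 := IsYangian.smul_eq_zero_of_commute (k := k)
          (fun j => hT.commute_e_pow_f p k r (j + 1)) h2 hy
        change coeff r (eOf T) ^ p • _ ∈ N
        rw [h3]; exact zero_mem _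
      · rw [map_pow, hφf]
        exact hNf r _ hy
    · change φ _ v ∈ N
      rw [hφe]
      have := ae r
      rw [map_zero, zero_smul] at this
      change coeff r (eOf T) • v ∈ N
      rw [this]; exact zero_mem _
    · change φ _ v ∈ N
      obtain ⟨g, hg, hgd, -⟩ := hφd i
      rw [map_sub, hgd, AlgHom.commutes, LinearMap.sub_apply, Module.algebraMap_end_apply]
      have h1 := hg r
      have h2 := X_pow_dvd_iff.1 (hdvd i) r (Nat.lt_succ_of_le hr)
      rw [map_sub, sub_eq_zero] at h2
      rw [h2] at h1
      change coeff r g • v - _ ∈ N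
      rw [h1, sub_self]; exact zero_mem _
  intro h1
  have h2 : φ 1 v ∈ N := hK h1
  rw [map_one, Module.End.one_apply] at h2
  have h3 := LinearMap.mem_ker.1 (hNε h2)
  rw [hε] at h3
  exact one_ne_zero h3

end Existence
end RestrictedYangian

end

noncomputable section
namespace RestrictedYangian
open PowerSeries

/-! ### The baby Verma module and its head are nonzero -/

section NonzeroHead

universe w
variable {k : Type w} [Field k]


theorem isTruncPCenterGen_of_isPCenterGen {p : ℕ} {g : Y2 k} (h : IsPCenterGen k p g) :
    ∃ n, ∀ m ≥ n, IsTruncPCenterGen k p m g := by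
  rcases h with ⟨i, r, hr⟩ | ⟨r, -⟩ | ⟨r, -⟩
  · exact ⟨r * p, fun m hm => .b i r hr hm⟩
  · exact ⟨0, fun m _ => .e r⟩
  · exact ⟨0, fun m _ => .f r⟩

theorem truncIdeal_mono {p : ℕ} (lam : Fin 2 → k⟦X⟧) : Monotone (truncIdeal p lam) := by
  intro m n h
  refine Submodule.span_mono ?_
  rintro _ (⟨g, y, hg, rfl⟩ | ⟨r, rfl⟩ | ⟨i, r, hr, rfl⟩)
  · refine Or.inl ⟨g, y, ?_, rfl⟩
    rcases hg with ⟨i, r, hr, hm⟩ | r | r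
    exacts [.b i r hr (hm.trans h), .e r, .f r]
  · exact Or.inr (Or.inl ⟨r, rfl⟩)
  · exact Or.inr (Or.inr ⟨i, r, hr.trans h, rfl⟩)

/-- Each p-central generator lies in the truncated ideals from some n on. The increasing union I
contains all products gy, so Y₂/I is a module over the restricted Yangian, and 1 ∉ I. -/
theorem one_notMem_babyVermaIdeal [IsAlgClosed k] {p : ℕ} [hp : Fact p.Prime] [CharP k p]
    {lam : Fin 2 → k⟦X⟧} (hlam : ∀ i, IsRestricted p (lam i)) :
    (1 : Y2p k p) ∉ babyVermaIdeal p lam := by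
  set I : Submodule (Y2 k) (Y2 k) := ⨆ n, truncIdeal p lam n with hI
  have hmem : ∀ x, x ∈ I ↔ ∃ n, x ∈ truncIdeal p lam n := fun x =>
    Submodule.mem_iSup_of_directed _ (truncIdeal_mono lam).directed_le
  have hg : ∀ g, IsPCenterGen k p g → ∀ y, g * y ∈ I := by
    intro g hg y
    obtain ⟨n, hn⟩ := isTruncPCenterGen_of_isPCenterGen hg
    exact (hmem _).2 ⟨n, Submodule.subset_span (Or.inl ⟨g, y, hn n le_rfl, rfl⟩)⟩
  let ψ : Y2p k p →ₐ[k] Module.End k (Y2 k ⧸ I) :=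
    RingQuot.liftAlgHom k ⟨Algebra.lsmul k k (Y2 k ⧸ I), by
      rintro g _ ⟨hgen, rfl⟩
      rw [map_zero]
      refine LinearMap.ext fun z => ?_
      obtain ⟨y, rfl⟩ := Submodule.Quotient.mk_surjective _ z
      exact (Submodule.Quotient.mk_eq_zero _).2 (hg g hgen y)⟩
  have hψ : ∀ y : Y2 k, ψ (proj k p y) = Algebra.lsmul k k (Y2 k ⧸ I) y := fun y =>
    RingQuot.liftAlgHom_mkAlgHom_apply k _ _ _
  let v : Y2 k ⧸ I := Submodule.Quotient.mk 1
  have hv : ∀ y : Y2 k, ψ (proj k p y) v = Submodule.Quotient.mk y := fun y => by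
    rw [hψ]
    change Submodule.Quotient.mk (y * 1) = _
    rw [mul_one]
  have hK : babyVermaIdeal p lam ≤
      { carrier := {a | ψ a v = 0}
        add_mem' := fun {x y} hx hy => by
          change ψ (x + y) v = 0
          rw [map_add, LinearMap.add_apply, show ψ x v = 0 from hx, show ψ y v = 0 from hy,
            add_zero]
        zero_mem' := by
          change ψ 0 v = 0
          rw [map_zero, LinearMap.zero_apply]
        smul_mem' := fun c x hx => by
          change ψ (c * x) v = 0
          rw [map_mul, Module.End.mul_apply, show ψ x v = 0 from hx, map_zero] } := by
    refine Submodule.span_le.2 ?_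
    rintro _ (⟨r, -, rfl⟩ | ⟨i, r, -, rfl⟩)
    · change ψ _ v = 0
      rw [hv, Submodule.Quotient.mk_eq_zero]
      exact (hmem _).2 ⟨0, Submodule.subset_span (Or.inr (Or.inl ⟨r, rfl⟩))⟩
    · change ψ _ v = 0
      rw [← AlgHom.commutes (proj k p), ← map_sub, hv, Submodule.Quotient.mk_eq_zero]
      exact (hmem _).2 ⟨r, Submodule.subset_span (Or.inr (Or.inr ⟨i, r, le_rfl, rfl⟩))⟩
  intro h1
  have h2 : ψ 1 v = 0 := hK h1
  rw [← map_one (proj k p), hv, Submodule.Quotient.mk_eq_zero, hmem] at h2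
  obtain ⟨n, hn⟩ := h2
  exact one_notMem_truncIdeal hlam n hn

variable [IsAlgClosed k] {p : ℕ} [hp : Fact p.Prime] [CharP k p]
    {lam : Fin 2 → k⟦X⟧} (hlam : ∀ i, IsRestricted p (lam i))
include hlam

theorem bvVec_ne_zero : bvVec p lam ≠ 0 := fun h =>
  one_notMem_babyVermaIdeal hlam ((Submodule.Quotient.mk_eq_zero _).1 h)

omit hlam [IsAlgClosed k] [CharP k p] hp in
theorem eq_top_of_bvVec_mem {N : Submodule (Y2p k p) (BabyVerma p lam)} (h : bvVec p lam ∈ N) :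
    N = ⊤ := by
  rw [eq_top_iff]
  rintro x -
  obtain ⟨a, rfl⟩ := exists_smul_bvVec p lam x
  exact N.smul_mem a h

omit [IsAlgClosed k] [CharP k p] in
/-- A proper submodule is contained in the augmentation part of the baby Verma module. -/
theorem exists_mem_aug_of_ne_top {N : Submodule (Y2p k p) (BabyVerma p lam)} (hN : N ≠ ⊤)
    {x : BabyVerma p lam} (hx : x ∈ N) : ∃ y ∈ aug k (fC (tp k p)) p, x = y • bvVec p lam := by
  have hT := isYangian_tp k p
  have hs := hT.straightens_f (k := k)
  have hf := fC_tp_pow k p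
  have hv := isHighestWeight_bvVec p fun i => (hlam i).1
  obtain ⟨c, y, hy, rfl⟩ := exists_of_mem_opSpan hp.out.pos hf hs
    (v := bvVec p lam) (x := x) (by rw [hT.opSpan_eq_top hv]; trivial)
  refine ⟨y, hy, ?_⟩
  rcases eq_or_ne c 0 with rfl | hc
  · rw [zero_smul, zero_add]
  · refine absurd (eq_top_of_bvVec_mem ?_) hN
    -- A nonzero scalar plus a nilpotent is invertible, so such an element of N would put v in N.
    have hu : IsUnit (algebraMap k (Y2p k p) c + y) := by
      refine (isNilpotent_of_mem_aug hp.out.pos hf hs hy).isUnit_add_left_of_commute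
        ((IsUnit.mk0 c hc).map (algebraMap k _)) (Algebra.commutes c y).symm
    obtain ⟨z, hz⟩ := hu.exists_left_inv
    have := N.smul_mem z hx
    rwa [← algebraMap_smul (Y2p k p) c, ← add_smul, ← mul_smul, hz, one_smul] at this

/-- Proper submodules lie in (augmentation)·v, and v does not. So two of them have a proper sum, the
family is directed, and v lies in its supremum only if it lies in a member. -/
theorem maxSubmodule_ne_top : maxSubmodule p lam ≠ ⊤ := by
  intro htop
  have hT := isYangian_tp k p
  have hbot : (⊥ : Submodule (Y2p k p) (BabyVerma p lam)) ≠ ⊤ := fun h =>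
    bvVec_ne_zero hlam ((Submodule.mem_bot (Y2p k p)).1 (by rw [h]; trivial))
  have hdir : DirectedOn (· ≤ ·) {N : Submodule (Y2p k p) (BabyVerma p lam) | N ≠ ⊤} := by
    intro N₁ h₁ N₂ h₂
    refine ⟨N₁ ⊔ N₂, fun h => ?_, le_sup_left, le_sup_right⟩
    have hv : bvVec p lam ∈ N₁ ⊔ N₂ := by rw [h]; trivial
    obtain ⟨x₁, hx₁, x₂, hx₂, hx⟩ := Submodule.mem_sup.1 hv
    obtain ⟨y₁, hy₁, rfl⟩ := exists_mem_aug_of_ne_top hlam h₁ hx₁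
    obtain ⟨y₂, hy₂, rfl⟩ := exists_mem_aug_of_ne_top hlam h₂ hx₂
    refine bvVec_ne_zero hlam (eq_zero_of_mem_aug (k := k) hp.out.pos (fC_tp_pow k p)
      (hT.straightens_f (k := k)) ⟨y₁ + y₂, add_mem hy₁ hy₂, ?_⟩)
    rw [evalAt_apply, add_smul, hx]
  have hv : bvVec p lam ∈ maxSubmodule p lam := by rw [htop]; trivial
  obtain ⟨N, hN, hvN⟩ := (Submodule.mem_sSup_of_directed ⟨⊥, hbot⟩ hdir).1 hv
  exact hN (eq_top_of_bvVec_mem hvN)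

theorem simpleVec_ne_zero : simpleVec p lam ≠ 0 := fun h =>
  maxSubmodule_ne_top hlam (eq_top_of_bvVec_mem ((Submodule.Quotient.mk_eq_zero _).1 h))

end NonzeroHead
end RestrictedYangian

end

noncomputable section
namespace RestrictedYangian
open PowerSeries

/-! ### Hilbert 90 without denominators -/

section HilbertNinety

variable {R : Type*} [CommRing R] [IsDomain R]

/-- A denominator-free form of Hilbert's theorem 90 for a cyclic group of ring endomorphisms. -/
theorem exists_mul_map_eq_mul {p : ℕ} (hp : 0 < p) (τ : R →+* R) (hτ : ∀ x, τ^[p] x = x) {a b : R}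
    (ha : a ≠ 0) (hb : b ≠ 0)
    (hab : ∏ j ∈ Finset.range p, τ^[j] a = ∏ j ∈ Finset.range p, τ^[j] b) {x : R}
    (hx : Function.Injective fun i : Fin p => τ^[i] x) : ∃ θ ≠ 0, a * τ θ = b * θ := by
  have hinj : ∀ y, τ y = 0 → y = 0 := fun y hy => by
    have h1 := hτ y
    rw [← Nat.sub_add_cancel hp, Function.iterate_succ_apply, hy] at h1
    rw [← h1]
    exact Function.iterate_fixed (map_zero τ) _
  have hne : ∀ y, y ≠ 0 → ∀ j, τ^[j] y ≠ 0 := fun y hy j => by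
    induction j with
    | zero => exact hy
    | succ j ih => rw [Function.iterate_succ_apply']; exact fun h => ih (hinj _ h)
  -- Bᵢ is the partial product of the cocycle a/b over the first i conjugates, multiplied by the
  -- norm of b. Equality of the norms makes the sequence close up, Bₚ = B₀.
  set B : ℕ → R := fun i => (∏ j ∈ Finset.range i, τ^[j] a) * ∏ j ∈ Finset.Ico i p, τ^[j] b with hB
  have hB0 : ∀ i, B i ≠ 0 := fun i => mul_ne_zero (Finset.prod_ne_zero_iff.2 fun j _ => hne a ha j)
    (Finset.prod_ne_zero_iff.2 fun j _ => hne b hb j)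
  have hBp : B p = B 0 := by
    simp only [hB, Finset.Ico_self, Finset.prod_empty, Finset.range_zero, mul_one, one_mul,
      ← Finset.range_eq_Ico, hab]
  have hstep : ∀ i < p, a * τ (B i) = b * B (i + 1) := by
    intro i hi
    have h1 : ∏ j ∈ Finset.Ico i p, τ^[j + 1] b =
        (∏ j ∈ Finset.Ico (i + 1) p, τ^[j] b) * b := by
      rw [Finset.prod_Ico_add' (fun j => τ^[j] b) i p 1, Finset.prod_Ico_succ_top (by omega), hτ]
    simp only [hB, map_mul, map_prod, ← Function.iterate_succ_apply' (f := τ), Nat.succ_eq_add_one]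
    rw [h1, Finset.prod_range_succ' _ i]
    simp only [Function.iterate_zero, id]
    ring
  by_contra! hcon
  -- The sums ∑ Bᵢτⁱ(xᵐ) all solve the equation, so in the absence of nonzero solutions they vanish.
  have hθ : ∀ m : Fin p, ∑ i : Fin p, B i * (τ^[i] x) ^ (m : ℕ) = 0 := by
    intro m
    set c := x ^ (m : ℕ) with hc
    have hc' : ∀ i, (τ^[i] x) ^ (m : ℕ) = τ^[i] c := fun i => (iterate_map_pow τ i x _).symm
    simp only [hc']
    rw [Fin.sum_univ_eq_sum_range (fun i => B i * τ^[i] c)]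
    by_contra hne0
    refine hcon _ hne0 ?_
    rw [map_sum, Finset.mul_sum, Finset.mul_sum]
    have h1 : ∀ i ∈ Finset.range p, a * τ (B i * τ^[i] c) = b * (B (i + 1) * τ^[i + 1] c) := by
      intro i hi
      rw [map_mul, ← mul_assoc, hstep i (Finset.mem_range.1 hi), Function.iterate_succ_apply',
        mul_assoc]
    rw [Finset.sum_congr rfl h1]
    have h2 := Finset.sum_range_succ' (fun i => b * (B i * τ^[i] c)) p
    rw [Finset.sum_range_succ, hBp, hτ] at h2
    exact (add_right_cancel h2).symm
  -- The conjugates of x are distinct, so a Vandermonde argument gives Bᵢ = 0.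
  have := Matrix.eq_zero_of_forall_pow_sum_mul_pow_eq_zero hx hθ
  exact hB0 0 (congrFun this ⟨0, hp⟩)

end HilbertNinety

/-! ### Polynomials in u as series in u⁻¹; from rational to shift ratio -/

section Reverse

variable {k : Type*} [Field k]

theorem rev_mul (P Q : Polynomial k) : rev (P * Q) = rev P * rev Q := by
  rw [rev, Polynomial.reverse_mul_of_domain, Polynomial.coe_mul]; rfl

theorem rev_C (a : k) : rev (Polynomial.C a) = PowerSeries.C a := by
  rw [rev, Polynomial.reverse_C, Polynomial.coe_C]

theorem rev_X_sub_C (a : k) : rev (Polynomial.X - Polynomial.C a) = 1 - PowerSeries.C a * X := by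
  rw [rev, Polynomial.reverse, Polynomial.natDegree_X_sub_C, Polynomial.reflect_sub,
    Polynomial.reflect_one_X, Polynomial.reflect_C]
  simp

theorem coeff_rev_of_le {P : Polynomial k} {i : ℕ} (h : i ≤ P.natDegree) :
    coeff i (rev P) = P.coeff (P.natDegree - i) := by
  rw [rev, Polynomial.coeff_coe, Polynomial.coeff_reverse, Polynomial.revAt_le h]

theorem rev_inj {P Q : Polynomial k} (hd : P.natDegree = Q.natDegree) (h : rev P = rev Q) :
    P = Q := by
  have h1 : P.reverse = Q.reverse := Polynomial.coe_injective k h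
  rw [Polynomial.reverse, Polynomial.reverse, hd] at h1
  rw [← Polynomial.reflect_reflect (p := P) (N := Q.natDegree), h1, Polynomial.reflect_reflect]

theorem exists_rev_eq {g : k⟦X⟧} {n : ℕ} (h0 : coeff 0 g ≠ 0) (h : ∀ r > n, coeff r g = 0) :
    ∃ P : Polynomial k, P.natDegree = n ∧ rev P = g := by
  have hd : ((trunc (n + 1) g).reflect n).natDegree = n := by
    refine le_antisymm (Polynomial.natDegree_reflect_le.trans
      (max_le le_rfl (Nat.lt_succ_iff.1 (natDegree_trunc_lt g n)))) ?_
    refine Polynomial.le_natDegree_of_ne_zero ?_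
    rw [Polynomial.coeff_reflect, Polynomial.revAt_le le_rfl, Nat.sub_self, coeff_trunc,
      if_pos n.succ_pos]
    exact h0
  refine ⟨_, hd, ?_⟩
  ext r
  rw [rev, Polynomial.reverse, hd, Polynomial.reflect_reflect, Polynomial.coeff_coe, coeff_trunc]
  split_ifs with hr
  · rfl
  · exact (h r (by omega)).symm

/-- For n = deg P this is u⁻ⁿP(u-c) = (1 - cu⁻¹)ⁿ·(u-c)⁻ⁿP(u-c), checked root by root. -/
theorem rev_comp_X_sub_C [IsAlgClosed k] (c : k) {P : Polynomial k} (hP : P ≠ 0) :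
    rev (P.comp (Polynomial.X - Polynomial.C c)) =
      (1 - PowerSeries.C c * X) ^ P.natDegree * shiftHom c (rev P) := by
  induction hn : P.natDegree generalizing P with
  | zero =>
    rw [Polynomial.eq_C_of_natDegree_eq_zero hn, Polynomial.C_comp, rev_C, shiftHom_C, pow_zero,
      one_mul]
  | succ n ih =>
    have hdeg : P.degree ≠ 0 := fun h => by
      have := Polynomial.natDegree_eq_of_degree_eq_some (n := 0) h
      omega
    obtain ⟨r, hr⟩ := IsAlgClosed.exists_root P hdeg
    obtain ⟨Q, rfl⟩ := Polynomial.dvd_iff_isRoot.2 hr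
    have hQ0 : Q ≠ 0 := right_ne_zero_of_mul hP
    have hd : Q.natDegree = n := by
      rw [Polynomial.natDegree_mul (Polynomial.X_sub_C_ne_zero r) hQ0,
        Polynomial.natDegree_X_sub_C] at hn
      omega
    have h1 := invSub_mul c
    have h2 : (Polynomial.X - Polynomial.C r).comp (Polynomial.X - Polynomial.C c) =
        Polynomial.X - Polynomial.C (c + r) := by
      rw [Polynomial.sub_comp, Polynomial.X_comp, Polynomial.C_comp, Polynomial.C_add]; ring
    rw [Polynomial.mul_comp, rev_mul, ih hQ0 hd, h2, rev_mul, map_mul, rev_X_sub_C, rev_X_sub_C,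
      map_sub, map_one, map_mul, shiftHom_C, shiftHom_X, sc_self, pow_succ, map_add]
    linear_combination ((1 - PowerSeries.C c * X) ^ n * shiftHom c (rev Q) * PowerSeries.C r) * h1

theorem partialProd_mul (f g : k⟦X⟧) (m : ℕ) :
    partialProd k (f * g) m = partialProd k f m * partialProd k g m := by
  induction m with
  | zero => rw [partialProd_zero, partialProd_zero, partialProd_zero, one_mul]
  | succ m ih => rw [partialProd_succ, ih, map_mul, partialProd_succ, partialProd_succ]; ring

theorem rev_prod_comp [IsAlgClosed k] {P : Polynomial k} (hP : P ≠ 0) (m : ℕ) :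
    rev (∏ j ∈ Finset.range m, P.comp (Polynomial.X - Polynomial.C (j : k))) =
      (∏ j ∈ Finset.range m, (1 - PowerSeries.C (j : k) * X)) ^ P.natDegree *
        partialProd k (rev P) m := by
  induction m with
  | zero =>
    rw [Finset.prod_range_zero, Finset.prod_range_zero, one_pow, partialProd_zero, one_mul,
      ← Polynomial.C_1, rev_C, map_one]
  | succ m ih =>
    rw [Finset.prod_range_succ, rev_mul, ih, rev_comp_X_sub_C _ hP, Finset.prod_range_succ, mul_pow,
      partialProd_succ]
    ring

theorem natDegree_prod_comp (P : Polynomial k) (hP : P ≠ 0) (m : ℕ) :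
    (∏ j ∈ Finset.range m, P.comp (Polynomial.X - Polynomial.C (j : k))).natDegree =
      m * P.natDegree := by
  rw [Polynomial.natDegree_prod]
  · simp only [Polynomial.natDegree_comp, Polynomial.natDegree_X_sub_C, mul_one, Finset.sum_const,
      Finset.card_range, smul_eq_mul]
  · intro j _ h
    have := congrArg (fun R => Polynomial.comp R (Polynomial.X + Polynomial.C (j : k))) h
    simp only [Polynomial.comp_assoc, Polynomial.sub_comp, Polynomial.X_comp, Polynomial.C_comp,
      add_sub_cancel_right, Polynomial.comp_X, Polynomial.zero_comp] at this
    exact hP this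

/-- Here a/c = Q/N. Since a and c are restricted, Q and N have the same norm under u ↦ u - 1, and
Hilbert 90 gives θ with Q/N = θ/τθ. -/
theorem exists_monic_of_rational [IsAlgClosed k] {p : ℕ} [hp : Fact p.Prime] [CharP k p]
    {a c : k⟦X⟧} (ha : IsRestricted p a) (hc : IsRestricted p c) {N Q : Polynomial k}
    (hN : N ≠ 0) (hQ : Q ≠ 0) (hd : N.natDegree = Q.natDegree) (h : a * rev N = c * rev Q) :
    ∃ P : Polynomial k, P.Monic ∧ a * rev P = c * rev (P.comp (Polynomial.X + 1)) := by
  set τ : Polynomial k →+* Polynomial k :=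
    Polynomial.compRingHom (Polynomial.X - Polynomial.C 1) with hτ
  have hτi : ∀ j (P : Polynomial k), τ^[j] P = P.comp (Polynomial.X - Polynomial.C (j : k)) := by
    intro j
    induction j with
    | zero => intro P; simp
    | succ j ih =>
      intro P
      rw [Function.iterate_succ_apply', ih, hτ, Polynomial.coe_compRingHom_apply,
        Polynomial.comp_assoc]
      congr 1
      rw [Polynomial.sub_comp, Polynomial.X_comp, Polynomial.C_comp, Nat.cast_succ,
        Polynomial.C_add]
      ring
  have hτp : ∀ P, τ^[p] P = P := fun P => by
    rw [hτi, CharP.cast_eq_zero, Polynomial.C_0, sub_zero, Polynomial.comp_X]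
  have hprod : ∏ j ∈ Finset.range p, τ^[j] Q = ∏ j ∈ Finset.range p, τ^[j] N := by
    simp only [hτi]
    refine rev_inj ?_ ?_
    · rw [natDegree_prod_comp Q hQ, natDegree_prod_comp N hN, hd]
    · have h1 := congrArg (fun g => partialProd k g p) h
      simp only [partialProd_mul] at h1
      rw [← shiftProd_eq, ha.2, one_mul, ← shiftProd_eq, ← shiftProd_eq, hc.2, one_mul, ← shiftProd_eq] at h1
      rw [rev_prod_comp hQ, rev_prod_comp hN, hd, ← shiftProd_eq, ← shiftProd_eq, h1]
  have hX : Function.Injective fun i : Fin p => τ^[i] (Polynomial.X : Polynomial k) := by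
    intro i j hij
    simp only [hτi, Polynomial.X_comp, sub_right_inj, Polynomial.C_inj] at hij
    exact Fin.ext (CharP.natCast_injOn_Iio k p i.2 j.2 hij)
  obtain ⟨θ, hθ0, hθ⟩ := exists_mul_map_eq_mul hp.out.pos τ hτp hQ hN hprod hX
  have hback : (τ θ).comp (Polynomial.X + 1) = θ := by
    rw [hτ, Polynomial.coe_compRingHom_apply, Polynomial.comp_assoc]
    simp
  have hτ0 : τ θ ≠ 0 := fun h0 => hθ0 (by rw [← hback, h0, Polynomial.zero_comp])
  -- P is τθ made monic; then P(u+1) is θ up to the same scalar.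
  refine ⟨τ θ * Polynomial.C (τ θ).leadingCoeff⁻¹, Polynomial.monic_mul_leadingCoeff_inv hτ0, ?_⟩
  rw [Polynomial.mul_comp, Polynomial.C_comp, hback, rev_mul, rev_mul]
  have h1 : rev Q * rev (τ θ) = rev N * rev θ := by rw [← rev_mul, hθ, rev_mul]
  have hQ0 : rev Q ≠ 0 := fun h0 => by
    have := coeff_zero_rev Q
    rw [h0, map_zero] at this
    exact Polynomial.leadingCoeff_ne_zero.2 hQ this.symm
  refine mul_left_cancel₀ hQ0 ?_
  linear_combination a * rev (Polynomial.C (τ θ).leadingCoeff⁻¹) * h1 +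
    rev θ * rev (Polynomial.C (τ θ).leadingCoeff⁻¹) * h

end Reverse

/-! ### Finite dimension makes the weight ratio rational -/

section Rationality

variable {k A : Type*} [Field k] [Ring A] [Algebra k A] {M : Type*} [AddCommGroup M] [Module k M]
  [Module A M] [IsScalarTower k A M] {T : Fin 2 → Fin 2 → A⟦X⟧}

theorem IsYangian.h_acts (hT : IsYangian T) {v : M} {μ : Fin 2 → k⟦X⟧}
    (h0 : constantCoeff (μ 0) ≠ 0) (hv : IsHighestWeight T v μ) :
    Acts (hOf T) ((μ 0)⁻¹ * μ 1) v := by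
  have h1 : Acts (d1InvOf T * (T 0 0 * sc A (μ 0)⁻¹ - 1)) (0 : k⟦X⟧) v := by
    refine Acts.mul_zero ?_ _
    have := (hv.d1.mul (Acts.sc (A := A) (μ 0)⁻¹ v)).sub (Acts.one (k := k) (A := A) v)
    rwa [PowerSeries.mul_inv_cancel _ h0, sub_self] at this
  have h2 : Acts (d1InvOf T) (μ 0)⁻¹ v := by
    have := (Acts.sc (A := A) (μ 0)⁻¹ v).sub h1
    rwa [sub_zero, mul_sub, ← mul_assoc, hT.inv_mul_d1, one_mul, mul_one, sub_sub_cancel] at this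
  exact h2.mul hv.d2

/-- If the highest weight space generates a finite-dimensional module, the ratio of the weights is
rational. -/
theorem IsYangian.exists_rational [Module.Finite k M] (hT : IsYangian T) {v : M} (hv0 : v ≠ 0)
    {μ : Fin 2 → k⟦X⟧} (hμ : ∀ i, constantCoeff (μ i) = 1) (hv : IsHighestWeight T v μ) :
    ∃ N Q : Polynomial k, N ≠ 0 ∧ Q ≠ 0 ∧ N.natDegree = Q.natDegree ∧
      μ 0 * rev N = μ 1 * rev Q := by
  have h0 : constantCoeff (μ 0) ≠ 0 := by rw [hμ]; exact one_ne_zero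
  set η := (μ 0)⁻¹ * μ 1 with hη
  have hh : Acts (hOf T) η v := hT.h_acts h0 hv
  set Φ : Polynomial k →ₗ[k] M :=
    Polynomial.lsum fun r => LinearMap.toSpanSingleton k M (fC T r • v) with hΦ
  -- The polynomial ring is infinite-dimensional, so Q ↦ ∑ q_r f⁽ʳ⁺¹⁾v cannot be injective.
  obtain ⟨Q, hQ0, hQ⟩ : ∃ Q : Polynomial k, Q ≠ 0 ∧ Φ Q = 0 := by
    by_contra! hcon
    have hinj : Function.Injective Φ := (injective_iff_map_eq_zero Φ).2 fun Q hQ => by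
      by_contra h
      exact hcon Q h hQ
    exact Polynomial.not_finite (Module.Finite.of_injective Φ hinj)
  have hsum : ∑ r ∈ Finset.range (Q.natDegree + 1), Q.coeff r • fC T r • v = 0 := by
    rw [← hQ, hΦ, Polynomial.lsum_apply, Polynomial.sum_over_range]
    · rfl
    · intro n; exact map_zero _
  have hrel : ∀ s, ∑ r ∈ Finset.range (Q.natDegree + 1), Q.coeff r * coeff (r + s + 1) η = 0 := by
    intro s
    have h1 := congrArg (fun x => coeff (s + 1) (eOf T) • x) hsum
    simp only [smul_zero, Finset.smul_sum] at h1
    have h2 : ∀ r, coeff (s + 1) (eOf T) • Q.coeff r • fC T r • v =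
        -((Q.coeff r * coeff (r + s + 1) η) • v) := by
      intro r
      have h3 := hT.e_comm_f s r
      rw [sub_eq_iff_eq_add] at h3
      rw [smul_smul_right, fC, ← mul_smul, h3, add_smul, mul_smul, hv.e, map_zero, zero_smul,
        smul_zero, add_zero, neg_smul, hh, smul_neg, mul_smul, add_comm s r]
    simp only [h2] at h1
    rw [Finset.sum_neg_distrib, ← Finset.sum_smul, neg_eq_zero, smul_eq_zero] at h1
    exact h1.resolve_right hv0
  have hc : coeff 0 (rev Q * η) ≠ 0 := by
    rw [coeff_zero_mul', coeff_zero_rev, hη, coeff_zero_mul', coeff_zero_eq_constantCoeff_apply,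
      constantCoeff_inv, coeff_zero_eq_constantCoeff_apply, hμ, hμ, inv_one, mul_one, mul_one]
    exact Polynomial.leadingCoeff_ne_zero.2 hQ0
  -- The recurrence `hrel` says exactly that the coefficients of `rev Q * η` beyond deg Q vanish.
  -- Its constant term is nonzero, so N has the same degree as Q.
  obtain ⟨N, hN, hNη⟩ := exists_rev_eq hc (n := Q.natDegree) fun m hm => by
    obtain ⟨s, rfl⟩ : ∃ s, m = Q.natDegree + s + 1 := ⟨m - Q.natDegree - 1, by omega⟩
    rw [coeff_mul, ← hrel s, Finset.Nat.sum_antidiagonal_eq_sum_range_succ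
      (fun i j => coeff i (rev Q) * coeff j η),
      ← Finset.sum_flip (fun r => Q.coeff r * coeff (r + s + 1) η)]
    refine (Finset.sum_subset (Finset.range_mono (by omega)) fun i _ hi => ?_).symm.trans
      (Finset.sum_congr rfl fun i hi => ?_)
    · rw [coeff_rev_of_lt _ (by simpa using hi), zero_mul]
    · have hi := Finset.mem_range.1 hi
      rw [coeff_rev_of_le (by omega)]
      congr 3
      omega
  refine ⟨N, Q, ?_, hQ0, hN, ?_⟩
  · rintro rfl
    rw [← hNη, coeff_zero_rev, Polynomial.leadingCoeff_zero] at hc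
    exact hc rfl
  · rw [hNη, hη]
    have := PowerSeries.mul_inv_cancel _ h0
    linear_combination (rev Q * μ 1) * this

end Rationality

end RestrictedYangian

end

/-! ### The theorem -/

theorem theorem2p14 {k : Type*} [Field k] [IsAlgClosed k] (p : ℕ) [Fact p.Prime] [CharP k p]
    (lam : Fin 2 → PowerSeries k) (hlam : ∀ i, RestrictedYangian.IsRestricted p (lam i)) :
    Module.Finite k (RestrictedYangian.L p lam) ↔
      ∃ P : Polynomial k, P.Monic ∧
        (HahnSeries.ofPowerSeries ℤ k (lam 0) / HahnSeries.ofPowerSeries ℤ k (lam 1) :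
            LaurentSeries k) =
          P.eval₂ HahnSeries.C (RestrictedYangian.u k + 1) /
            P.eval₂ HahnSeries.C (RestrictedYangian.u k) := by
  have h1 : lam 1 ≠ 0 := fun h => by
    have := (hlam 1).1
    rw [h, map_zero] at this
    exact zero_ne_one this
  constructor
  · intro hfin
    obtain ⟨N, Q, hN, hQ, hd, h⟩ := (RestrictedYangian.isYangian_tp k p).exists_rational
      (RestrictedYangian.simpleVec_ne_zero hlam) (fun i => (hlam i).1)
      (RestrictedYangian.isHighestWeight_simpleVec p fun i => (hlam i).1)
    obtain ⟨P, hP, hP'⟩ := RestrictedYangian.exists_monic_of_rational (hlam 0) (hlam 1) hN hQ hd h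
    exact ⟨P, hP, (RestrictedYangian.ratio_iff hP h1).2 hP'⟩
  · rintro ⟨P, hP, h⟩
    exact RestrictedYangian.finite_L (Fact.out : p.Prime).pos (fun i => (hlam i).1) hP
      ((RestrictedYangian.ratio_iff hP h1).1 h)
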